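/- Let $\mathbb F$ be any field, let $d, D, m \ge 0$ be integers, let $\gamma \in \mathbb F^\times$ be an element of (finite or infinite) multiplicative order greater than $d$, and let $$Q(x,y_0,\dots,y_m)=\tilde Q(x)+\sum_{i=0}^m Q_i(x)\,y_i$$ be a nonzero polynomial over $\mathbb F$ of $x$-degree at most $D$. Then the set of polynomials $f\in\mathbb F[x]$ of degree at most $d$ that satisfy $$Q\bigl(x,f(x),f(\gamma x),\dots,f(\gamma^m x)\bigr)\equiv 0$$ is a (possibly empty) affine subspace of $\mathbb F[x]$ of dimension at most $m$. Moreover, there is a deterministic algorithm which, given $\gamma$, the parameter $d$ and the coefficient vectors (of length $D+1$) of $\tilde Q,Q_0,\dots,Q_m$, outputs the coefficient vectors (of length $d+1$) of a basis of this affine space, performing at most $\tilde O((D+d)\,\mathrm{poly}(m))$ field operations. Here a basis of an affine space $A$ is a finite affinely independent family in $A$ whose affine span is $A$ (the empty family if $A=\emptyset$). The algorithm is one fixed program, the same for all $\mathbb F,\gamma,d,D,m,Q$, which accesses field elements only through the constants $0,1$, addition, subtraction, multiplication, inversion of nonzero elements and tests for zero; its number of field operations, zero tests included, is at most $K\,(D+d+1)\,(m+1)^{a}\,\bigl\lfloor\log_2(D+d+2)\bigr\rfloor^{e}$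 for absolute constants $K,a,e\in\mathbb N$. -/

import Mathlib

open Polynomial

universe u

/-! ## Algorithms over a field

An algorithm is a finite program in a small deterministic first-order functional language with
general recursion.  The program text does not mention the field: the same program runs over every
field.  Field elements are atoms that can be moved around, but they can be created, combined and
inspected only by the field operations of the language (the constants `0` and `1`, addition,
subtraction, multiplication, inversion of a nonzero element, test for being zero).  The cost of a
run is the number of field operations that it performs (zero tests are counted as well). -/

namespace FieldAlg

/-- Data: binary trees whose leaves are `nil` or elements of `F`.  Lists are right-nested pairs
ending in `nil`. -/
inductive Val (F : Type*) where
  | nil : Val F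
  | elem (a : F) : Val F
  | pair (x y : Val F) : Val F

/-- Program terms.  A variable `var i` refers to the `i`-th entry of the current environment;
`call k t` calls the `k`-th function of the program on one argument. -/
inductive Term where
  | var (i : ℕ)
  | letIn (t body : Term)
  | call (k : ℕ) (t : Term)
  | nil
  | pair (t s : Term)
  /-- `onNil` if the value of `t` is `nil`; if it is a pair `(x, y)`, then `onPair` with `x` and
  `y` pushed to the environment as variables `0` and `1`. -/
  | split (t onNil onPair : Term)
  | zero
  | one
  | add (t s : Term)
  | sub (t s : Term)
  | mul (t s : Term)
  | inv (t : Term)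
  /-- Test whether the field element `t` is zero. -/
  | ifZero (t onZero onNonzero : Term)

/-- A program is a finite list of function bodies, which may call each other (and themselves). -/
abbrev Program := List Term

/-- `Eval P env t v c`: in the environment `env`, the evaluation of the term `t` terminates with
the value `v`, and performs exactly `c` field operations. -/
inductive Eval {F : Type*} [Field F] (P : Program) : List (Val F) → Term → Val F → ℕ → Prop where
  | var {env i v} : env[i]? = some v → Eval P env (.var i) v 0
  | letIn {env t body u v c₁ c₂} : Eval P env t u c₁ → Eval P (u :: env) body v c₂ →
      Eval P env (.letIn t body) v (c₁ + c₂)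
  | call {env k t body u v c₁ c₂} : Eval P env t u c₁ → P[k]? = some body →
      Eval P [u] body v c₂ → Eval P env (.call k t) v (c₁ + c₂)
  | nil {env} : Eval P env .nil .nil 0
  | pair {env t s u v c₁ c₂} : Eval P env t u c₁ → Eval P env s v c₂ →
      Eval P env (.pair t s) (.pair u v) (c₁ + c₂)
  | splitNil {env t t₀ t₁ v c₁ c₂} : Eval P env t .nil c₁ → Eval P env t₀ v c₂ →
      Eval P env (.split t t₀ t₁) v (c₁ + c₂)
  | splitPair {env t t₀ t₁ x y v c₁ c₂} : Eval P env t (.pair x y) c₁ →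
      Eval P (x :: y :: env) t₁ v c₂ → Eval P env (.split t t₀ t₁) v (c₁ + c₂)
  | zero {env} : Eval P env .zero (.elem 0) 0
  | one {env} : Eval P env .one (.elem 1) 0
  | add {env t s a b c₁ c₂} : Eval P env t (.elem a) c₁ → Eval P env s (.elem b) c₂ →
      Eval P env (.add t s) (.elem (a + b)) (c₁ + c₂ + 1)
  | sub {env t s a b c₁ c₂} : Eval P env t (.elem a) c₁ → Eval P env s (.elem b) c₂ →
      Eval P env (.sub t s) (.elem (a - b)) (c₁ + c₂ + 1)
  | mul {env t s a b c₁ c₂} : Eval P env t (.elem a) c₁ → Eval P env s (.elem b) c₂ →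
      Eval P env (.mul t s) (.elem (a * b)) (c₁ + c₂ + 1)
  | inv {env t a c₁} : Eval P env t (.elem a) c₁ → a ≠ 0 →
      Eval P env (.inv t) (.elem a⁻¹) (c₁ + 1)
  | ifZeroPos {env t t₀ t₁ v c₁ c₂} : Eval P env t (.elem 0) c₁ → Eval P env t₀ v c₂ →
      Eval P env (.ifZero t t₀ t₁) v (c₁ + c₂ + 1)
  | ifZeroNeg {env t t₀ t₁ a v c₁ c₂} : Eval P env t (.elem a) c₁ → a ≠ 0 →
      Eval P env t₁ v c₂ → Eval P env (.ifZero t t₀ t₁) v (c₁ + c₂ + 1)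

/-- Programs are deterministic: result and cost are determined by the input. -/
theorem Eval.deterministic {F : Type*} [Field F] {P : Program} {env : List (Val F)} {t : Term}
    {v w : Val F} {c c' : ℕ} (h : Eval P env t v c) (h' : Eval P env t w c') :
    v = w ∧ c = c' := by
  induction h generalizing w c' with
  | var h₁ => cases h'; simp_all
  | letIn _ _ ih₁ ih₂ =>
    cases h' with | letIn a b => obtain ⟨rfl, rfl⟩ := ih₁ a; obtain ⟨rfl, rfl⟩ := ih₂ b; simp
  | call _ hk _ ih₁ ih₂ =>
    cases h' with
    | call a hk' b =>
      obtain ⟨rfl, rfl⟩ := ih₁ a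
      rw [hk] at hk'
      cases hk'
      obtain ⟨rfl, rfl⟩ := ih₂ b
      simp
  | nil => cases h'; simp
  | pair _ _ ih₁ ih₂ =>
    cases h' with | pair a b => obtain ⟨rfl, rfl⟩ := ih₁ a; obtain ⟨rfl, rfl⟩ := ih₂ b; simp
  | splitNil _ _ ih₁ ih₂ =>
    cases h' with
    | splitNil a b => obtain ⟨_, rfl⟩ := ih₁ a; obtain ⟨rfl, rfl⟩ := ih₂ b; simp
    | splitPair a b => cases (ih₁ a).1
  | splitPair _ _ ih₁ ih₂ =>
    cases h' with
    | splitNil a b => cases (ih₁ a).1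
    | splitPair a b =>
      obtain ⟨h₁, rfl⟩ := ih₁ a
      cases h₁
      obtain ⟨rfl, rfl⟩ := ih₂ b
      simp
  | zero => cases h'; simp
  | one => cases h'; simp
  | add _ _ ih₁ ih₂ =>
    cases h' with
    | add a b => obtain ⟨h₁, rfl⟩ := ih₁ a; obtain ⟨h₂, rfl⟩ := ih₂ b; cases h₁; cases h₂; simp
  | sub _ _ ih₁ ih₂ =>
    cases h' with
    | sub a b => obtain ⟨h₁, rfl⟩ := ih₁ a; obtain ⟨h₂, rfl⟩ := ih₂ b; cases h₁; cases h₂; simp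
  | mul _ _ ih₁ ih₂ =>
    cases h' with
    | mul a b => obtain ⟨h₁, rfl⟩ := ih₁ a; obtain ⟨h₂, rfl⟩ := ih₂ b; cases h₁; cases h₂; simp
  | inv _ _ ih₁ => cases h' with | inv a _ => obtain ⟨h₁, rfl⟩ := ih₁ a; cases h₁; simp
  | ifZeroPos _ _ ih₁ ih₂ =>
    cases h' with
    | ifZeroPos a b => obtain ⟨_, rfl⟩ := ih₁ a; obtain ⟨rfl, rfl⟩ := ih₂ b; simp
    | ifZeroNeg a hn b => cases (ih₁ a).1; exact absurd rfl hn
  | ifZeroNeg _ hn _ ih₁ ih₂ =>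
    cases h' with
    | ifZeroPos a b => cases (ih₁ a).1; exact absurd rfl hn
    | ifZeroNeg a _ b => obtain ⟨_, rfl⟩ := ih₁ a; obtain ⟨rfl, rfl⟩ := ih₂ b; simp

/-- On `input`, the program (its function number `0`) terminates with `output` after exactly
`cost` field operations. -/
def Program.Runs {F : Type*} [Field F] (P : Program) (input output : Val F) (cost : ℕ) : Prop :=
  Eval P [input] (.call 0 (.var 0)) output cost

/-- A list as nested pairs. -/
def Val.ofList {F : Type*} : List (Val F) → Val F
  | [] => .nil
  | x :: l => .pair x (Val.ofList l)

/-- A natural number, in unary. -/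
def Val.ofNat {F : Type*} (n : ℕ) : Val F :=
  Val.ofList (List.replicate n .nil)

/-- The coefficient vector `(p₀, …, pₙ)` of a polynomial of degree at most `n`. -/
def Val.coeffVec {F : Type*} [Field F] (n : ℕ) (p : F[X]) : Val F :=
  Val.ofList ((List.range (n + 1)).map fun i => .elem (p.coeff i))

end FieldAlg

/-! ## The functional equation -/

/-- The polynomial `Q(x, y₀, …, yₘ) = Q̃(x) + ∑ Qᵢ(x) yᵢ`, as a polynomial in the `yᵢ` with
coefficients in `F[x]`. -/
noncomputable def affinePoly {F : Type*} [Field F] {m : ℕ} (Qt : F[X]) (Q : Fin (m + 1) → F[X]) :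
    MvPolynomial (Fin (m + 1)) F[X] :=
  MvPolynomial.C Qt + ∑ i, MvPolynomial.C (Q i) * MvPolynomial.X i

/-- The polynomials `f` of degree at most `d` with `Q(x, f(x), f(γx), …, f(γᵐx)) ≡ 0`. -/
def functionalSolutions {F : Type*} [Field F] {m : ℕ} (γ : F) (d : ℕ)
    (Q : MvPolynomial (Fin (m + 1)) F[X]) : Set F[X] :=
  {f | f.natDegree ≤ d ∧ MvPolynomial.eval (fun i : Fin (m + 1) => f.comp (C (γ ^ (i : ℕ)) * X)) Q = 0}

/-- The input of the solver: `γ`, `d`, and the coefficient vectors of `Q̃, Q₀, …, Qₘ`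
(each with `D + 1` entries). -/
def solverInput {F : Type*} [Field F] {m : ℕ} (γ : F) (d D : ℕ) (Qt : F[X])
    (Q : Fin (m + 1) → F[X]) : FieldAlg.Val F :=
  .pair (.elem γ) (.pair (.ofNat d)
    (.ofList (.coeffVec D Qt :: List.ofFn fun i => .coeffVec D (Q i))))

/-- The output of the solver: the list of the coefficient vectors (each with `d + 1` entries) of
the polynomials `b₀, …, bₖ₋₁`. -/
def solverOutput {F : Type*} [Field F] {k : ℕ} (d : ℕ) (b : Fin k → F[X]) : FieldAlg.Val F :=
  .ofList (List.ofFn fun j => .coeffVec d (b j))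

/-- `b` is an affine basis of the set `S`: its members are affinely independent and their affine
span is `S` (for empty `S`: the empty family). -/
def IsAffineBasisOf {F : Type*} [Field F] {k : ℕ} (b : Fin k → F[X]) (S : Set F[X]) : Prop :=
  AffineIndependent F b ∧ (affineSpan F (Set.range b) : Set F[X]) = S

/-! Comparing coefficients makes the functional equation a linear system for the coefficients of
`f`. With `kernel Q l g = ∑ i, (Q i).coeff l * g ^ i`, the coefficient of `x ^ n` in `∑ Q_i(x) f(γ^i
x)` is `∑_{j ≤ n} f_j * kernel Q (n - j) (γ ^ j)` (`coeff_shiftMap`). If all `Q_i` vanish, then `Q̃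
≠ 0` and there is no solution. Otherwise let `v` be the least index at which some `Q_i` has a
nonzero coefficient. The equation at `x ^ (v + j)` is `kernel Q v (γ ^ j) * f_j + (terms in f_i, i <
j) = -Q̃_{v+j}`, so `f_j` is determined by its predecessors unless `γ ^ j` is a root of `g ↦ kernel
Q v g`, a nonzero polynomial of degree at most `m`. Since `γ ^ 0, ..., γ ^ d` are distinct, at most
`m` indices are exceptional (`length_zeros_weightL_le`), and the corresponding coefficients are the
only free parameters.

The solver makes this effective. It solves the recursion once with right-hand side `Q̃` and free
coefficients zero, and once homogeneously for each exceptional index, with a unit vector of free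
coefficients. Combinations of these generators contain every solution; the equations not used by the
recursion remain to be imposed. So each generator is stored as its residual in the full equation (`D
+ d + 1` entries), a flag `h` (1 for the inhomogeneous one, 0 otherwise), and `f`. By
`exists_comb_iff`, the combinations with zero residual are exactly the pairs `(h, f)` with `h * Q̃ +
∑ Q_i f(γ^i x) = 0`. Gaussian elimination on the residual columns finds them; a vector with `h ≠ 0`
then gives a particular solution, and one more elimination gives a basis of the direction. With at
most `m + 1` vectors there are at most `m + 1` pivots, so elimination costs linearly in `D + d`. The
dimension bound is read off the length of the output.

The recursion is solved by divide and conquer (`exists_computes_solve`): solve the first half, push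
its contribution into the second half by polynomial products, solve the second half. This needs
quasi-linear multiplication over an arbitrary field, done in the style of Schönhage and Strassen
with radix `p = 2`, or `p = 3` in characteristic 2, so that `p` is invertible. Operands are cut into
rows and become polynomials in `y` over `F[x]` modulo `1 + x^r + ... + x^((p-1)r)`, where `x` is a
root of unity and multiplication by its powers is a cyclic shift, which costs no field operation. A
radix-`p` Fourier transform in `y` reduces the product to recursive products of about square-root
length (`pmulSpec`, `polyOf_recombL_eq`, `mulSpec`).

Programs are verified through weakest preconditions whose postconditions mention result and cost
together. -/

namespace FieldAlg

/-! ### Program logic -/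

section Logic

variable {F : Type*}

/-- Case distinction on a value that has to be a list. -/
def Val.onList (v : Val F) (p : Prop) (q : Val F → Val F → Prop) : Prop :=
  match v with
  | .nil => p
  | .pair x y => q x y
  | .elem _ => False

/-- Use of a value that has to be a field element. -/
def Val.onElem (v : Val F) (q : F → Prop) : Prop :=
  match v with
  | .elem a => q a
  | _ => False

@[simp ↓] theorem Val.onList_nil (p : Prop) (q : Val F → Val F → Prop) :
    (Val.nil : Val F).onList p q ↔ p := Iff.rfl
@[simp ↓] theorem Val.onList_pair (x y : Val F) (p : Prop) (q : Val F → Val F → Prop) :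
    (Val.pair x y).onList p q ↔ q x y := Iff.rfl
@[simp ↓] theorem Val.onElem_elem (a : F) (q : F → Prop) : (Val.elem a).onElem q ↔ q a := Iff.rfl
@[simp] theorem Val.ofList_nil : (Val.ofList [] : Val F) = .nil := rfl
@[simp] theorem Val.ofList_cons (x : Val F) (l : List (Val F)) :
    Val.ofList (x :: l) = .pair x (Val.ofList l) := rfl

variable [Field F]

/-- The term `t` evaluates in `env` to a value and with a cost that satisfy `Q`. -/
def wp (P : Program) (env : List (Val F)) (t : Term) (Q : Val F → ℕ → Prop) : Prop :=
  ∃ v c, Eval P env t v c ∧ Q v c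

/-- The `k`-th function evaluates on `u` to a value and with a cost that satisfy `Q`. -/
def wpCall (P : Program) (k : ℕ) (u : Val F) (Q : Val F → ℕ → Prop) : Prop :=
  ∃ body, P[k]? = some body ∧ wp P [u] body Q

variable {P : Program} {env : List (Val F)} {Q : Val F → ℕ → Prop}

/-- The rules for the term formers are equivalences in continuation form: the cost so far is carried
into the postcondition of what remains. As pre-order simp lemmas they let simp run a program
symbolically, outermost construct first. -/
theorem wp_var {i : ℕ} : wp P env (.var i) Q ↔ ∃ v, env[i]? = some v ∧ Q v 0 := by
  constructor
  · rintro ⟨v, c, h, hQ⟩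
    cases h
    exact ⟨v, ‹_›, hQ⟩
  · rintro ⟨v, h, hQ⟩
    exact ⟨v, 0, .var h, hQ⟩

theorem wp_letIn {t b : Term} : wp P env (.letIn t b) Q ↔
    wp P env t fun u c₁ => wp P (u :: env) b fun v c₂ => Q v (c₁ + c₂) := by
  constructor
  · rintro ⟨v, c, h, hQ⟩
    cases h with | letIn h₁ h₂ => exact ⟨_, _, h₁, _, _, h₂, hQ⟩
  · rintro ⟨_, _, h₁, _, _, h₂, hQ⟩
    exact ⟨_, _, .letIn h₁ h₂, hQ⟩

theorem wp_call {k : ℕ} {t : Term} : wp P env (.call k t) Q ↔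
    wp P env t fun u c₁ => wpCall P k u fun v c₂ => Q v (c₁ + c₂) := by
  constructor
  · rintro ⟨v, c, h, hQ⟩
    cases h with | call h₁ hk h₂ => exact ⟨_, _, h₁, _, hk, _, _, h₂, hQ⟩
  · rintro ⟨_, _, h₁, _, hk, _, _, h₂, hQ⟩
    exact ⟨_, _, .call h₁ hk h₂, hQ⟩

theorem wp_nil : wp P env .nil Q ↔ Q .nil 0 := by
  constructor
  · rintro ⟨v, c, h, hQ⟩
    cases h
    exact hQ
  · exact fun h => ⟨_, _, .nil, h⟩

theorem wp_pair {t s : Term} : wp P env (.pair t s) Q ↔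
    wp P env t fun u c₁ => wp P env s fun v c₂ => Q (.pair u v) (c₁ + c₂) := by
  constructor
  · rintro ⟨v, c, h, hQ⟩
    cases h with | pair h₁ h₂ => exact ⟨_, _, h₁, _, _, h₂, hQ⟩
  · rintro ⟨_, _, h₁, _, _, h₂, hQ⟩
    exact ⟨_, _, .pair h₁ h₂, hQ⟩

theorem wp_split {t t₀ t₁ : Term} : wp P env (.split t t₀ t₁) Q ↔
    wp P env t fun u c₁ => u.onList (wp P env t₀ fun v c₂ => Q v (c₁ + c₂))
      fun x y => wp P (x :: y :: env) t₁ fun v c₂ => Q v (c₁ + c₂) := by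
  constructor
  · rintro ⟨v, c, h, hQ⟩
    cases h with
    | splitNil h₁ h₂ => exact ⟨_, _, h₁, _, _, h₂, hQ⟩
    | splitPair h₁ h₂ => exact ⟨_, _, h₁, _, _, h₂, hQ⟩
  · rintro ⟨u, _, h₁, h⟩
    match u, h₁, h with
    | .nil, h₁, ⟨_, _, h₂, hQ⟩ => exact ⟨_, _, .splitNil h₁ h₂, hQ⟩
    | .pair x y, h₁, ⟨_, _, h₂, hQ⟩ => exact ⟨_, _, .splitPair h₁ h₂, hQ⟩

theorem wp_zero : wp P env .zero Q ↔ Q (.elem 0) 0 := by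
  constructor
  · rintro ⟨v, c, h, hQ⟩
    cases h
    exact hQ
  · exact fun h => ⟨_, _, .zero, h⟩

theorem wp_one : wp P env .one Q ↔ Q (.elem 1) 0 := by
  constructor
  · rintro ⟨v, c, h, hQ⟩
    cases h
    exact hQ
  · exact fun h => ⟨_, _, .one, h⟩

theorem wp_add {t s : Term} : wp P env (.add t s) Q ↔
    wp P env t fun u c₁ => u.onElem fun a => wp P env s fun v c₂ => v.onElem fun b =>
      Q (.elem (a + b)) (c₁ + c₂ + 1) := by
  constructor
  · rintro ⟨v, c, h, hQ⟩
    cases h with | add h₁ h₂ => exact ⟨_, _, h₁, _, _, h₂, hQ⟩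
  · rintro ⟨u, _, h₁, h⟩
    match u, h₁, h with
    | .elem a, h₁, ⟨.elem b, _, h₂, hQ⟩ => exact ⟨_, _, .add h₁ h₂, hQ⟩

theorem wp_sub {t s : Term} : wp P env (.sub t s) Q ↔
    wp P env t fun u c₁ => u.onElem fun a => wp P env s fun v c₂ => v.onElem fun b =>
      Q (.elem (a - b)) (c₁ + c₂ + 1) := by
  constructor
  · rintro ⟨v, c, h, hQ⟩
    cases h with | sub h₁ h₂ => exact ⟨_, _, h₁, _, _, h₂, hQ⟩
  · rintro ⟨u, _, h₁, h⟩
    match u, h₁, h with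
    | .elem a, h₁, ⟨.elem b, _, h₂, hQ⟩ => exact ⟨_, _, .sub h₁ h₂, hQ⟩

theorem wp_mul {t s : Term} : wp P env (.mul t s) Q ↔
    wp P env t fun u c₁ => u.onElem fun a => wp P env s fun v c₂ => v.onElem fun b =>
      Q (.elem (a * b)) (c₁ + c₂ + 1) := by
  constructor
  · rintro ⟨v, c, h, hQ⟩
    cases h with | mul h₁ h₂ => exact ⟨_, _, h₁, _, _, h₂, hQ⟩
  · rintro ⟨u, _, h₁, h⟩
    match u, h₁, h with
    | .elem a, h₁, ⟨.elem b, _, h₂, hQ⟩ => exact ⟨_, _, .mul h₁ h₂, hQ⟩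

theorem wp_inv {t : Term} : wp P env (.inv t) Q ↔
    wp P env t fun u c₁ => u.onElem fun a => a ≠ 0 ∧ Q (.elem a⁻¹) (c₁ + 1) := by
  constructor
  · rintro ⟨v, c, h, hQ⟩
    cases h with | inv h₁ h₂ => exact ⟨_, _, h₁, h₂, hQ⟩
  · rintro ⟨u, _, h₁, h⟩
    match u, h₁, h with
    | .elem a, h₁, ⟨h₂, hQ⟩ => exact ⟨_, _, .inv h₁ h₂, hQ⟩

/-- The branches are guarded by implications; exactly one guard holds, so this loses nothing and
leaves one goal per branch. -/
theorem wp_ifZero {t t₀ t₁ : Term} : wp P env (.ifZero t t₀ t₁) Q ↔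
    wp P env t fun u c₁ => u.onElem fun a =>
      (a = 0 → wp P env t₀ fun v c₂ => Q v (c₁ + c₂ + 1)) ∧
      (a ≠ 0 → wp P env t₁ fun v c₂ => Q v (c₁ + c₂ + 1)) := by
  constructor
  · rintro ⟨v, c, h, hQ⟩
    cases h with
    | ifZeroPos h₁ h₂ => exact ⟨_, _, h₁, fun _ => ⟨_, _, h₂, hQ⟩, fun h => absurd rfl h⟩
    | ifZeroNeg h₁ hn h₂ => exact ⟨_, _, h₁, fun h => absurd h hn, fun _ => ⟨_, _, h₂, hQ⟩⟩
  · rintro ⟨u, _, h₁, h⟩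
    match u, h₁, h with
    | .elem a, h₁, h =>
      by_cases ha : a = 0
      · subst ha
        obtain ⟨_, _, h₂, hQ⟩ := h.1 rfl
        exact ⟨_, _, .ifZeroPos h₁ h₂, hQ⟩
      · obtain ⟨_, _, h₂, hQ⟩ := h.2 ha
        exact ⟨_, _, .ifZeroNeg h₁ ha h₂, hQ⟩

/-- The `k`-th function maps `u` to `v`, at a cost of at most `c`. -/
def Computes (P : Program) (k : ℕ) (u v : Val F) (c : ℕ) : Prop :=
  wpCall P k u fun v' c' => v' = v ∧ c' ≤ c

/-- Where only an upper bound for the cost is known, the continuation must be proved for every cost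
below that bound. This is how specifications compose. -/
theorem Computes.wpCall {k : ℕ} {u v : Val F} {c : ℕ} (h : Computes P k u v c)
    (hQ : ∀ c' ≤ c, Q v c') : wpCall P k u Q := by
  obtain ⟨b, hb, _, c', h, rfl, hc⟩ := h
  exact ⟨b, hb, _, c', h, hQ _ hc⟩

end Logic

/-! ### Programs with named variables -/

/-- A program term as a function of the length of its environment. -/
abbrev Code := ℕ → Term

namespace Code

/-- A bound variable remembers the depth at which it was bound and turns it into a de Bruijn index
at the depth `e` of its use. Program bodies can thus be written with Lean binders. -/
def letC (t : Code) (f : Code → Code) : Code := fun d =>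
  .letIn (t d) (f (fun e => .var (e - (d + 1))) (d + 1))

def cases (t n : Code) (f : Code → Code → Code) : Code := fun d =>
  .split (t d) (n d) (f (fun e => .var (e - (d + 2))) (fun e => .var (e - (d + 1))) (d + 2))

def call (k : ℕ) (t : Code) : Code := fun d => .call k (t d)
def nil : Code := fun _ => .nil
def pair (t s : Code) : Code := fun d => .pair (t d) (s d)
def zero : Code := fun _ => .zero
def one : Code := fun _ => .one
def add (t s : Code) : Code := fun d => .add (t d) (s d)
def sub (t s : Code) : Code := fun d => .sub (t d) (s d)
def mul (t s : Code) : Code := fun d => .mul (t d) (s d)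
def inv (t : Code) : Code := fun d => .inv (t d)
def ifZero (t a b : Code) : Code := fun d => .ifZero (t d) (a d) (b d)

/-- The head of a list, `0` for the empty list. -/
def hd (t : Code) : Code := cases t zero fun x _ => x
/-- The tail of a list. -/
def tl (t : Code) : Code := cases t nil fun _ y => y
/-- Addition of `1` to a unary number. -/
def succ (t : Code) : Code := pair nil t

def fn (f : Code → Code) : Term := f (fun e => .var (e - 1)) 1
def fn2 (f : Code → Code → Code) : Term := fn fun x => cases x nil f
def fn3 (f : Code → Code → Code → Code) : Term :=
  fn fun x => cases x nil fun a r => cases r nil fun b c => f a b c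
def fn4 (f : Code → Code → Code → Code → Code) : Term :=
  fn fun x => cases x nil fun a r => cases r nil fun b r => cases r nil fun c d => f a b c d
def fn5 (f : Code → Code → Code → Code → Code → Code) : Term :=
  fn fun x => cases x nil fun a r => cases r nil fun b r => cases r nil fun c r =>
    cases r nil fun d e => f a b c d e
def fn6 (f : Code → Code → Code → Code → Code → Code → Code) : Term :=
  fn fun x => cases x nil fun a r => cases r nil fun b r => cases r nil fun c r =>
    cases r nil fun d r => cases r nil fun e g => f a b c d e g

def call2 (k : ℕ) (a b : Code) : Code := call k (pair a b)
def call3 (k : ℕ) (a b c : Code) : Code := call k (pair a (pair b c))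
def call4 (k : ℕ) (a b c d : Code) : Code := call k (pair a (pair b (pair c d)))
def call5 (k : ℕ) (a b c d e : Code) : Code := call k (pair a (pair b (pair c (pair d e))))
def call6 (k : ℕ) (a b c d e g : Code) : Code :=
  call k (pair a (pair b (pair c (pair d (pair e g)))))

end Code

/-! ### The program -/

namespace Fn

abbrev main : ℕ := 0
abbrev append : ℕ := 1
abbrev take : ℕ := 2
abbrev drop : ℕ := 3
abbrev rot : ℕ := 4
abbrev rep : ℕ := 5
abbrev pow : ℕ := 6
abbrev half : ℕ := 7
abbrev thin : ℕ := 8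
abbrev clog : ℕ := 9
abbrev pad : ℕ := 10
abbrev add : ℕ := 11
abbrev smul : ℕ := 12
abbrev pmulL : ℕ := 13
abbrev naive : ℕ := 14
abbrev addR : ℕ := 15
abbrev rotR : ℕ := 16
abbrev horner : ℕ := 17
abbrev chunk : ℕ := 18
abbrev rows : ℕ := 19
abbrev fwd : ℕ := 20
abbrev inter : ℕ := 21
abbrev pmul : ℕ := 22
abbrev mulK : ℕ := 23
abbrev recomb : ℕ := 24
abbrev mul : ℕ := 25
abbrev contrib : ℕ := 26
abbrev takeAll : ℕ := 27
abbrev solve : ℕ := 28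
abbrev evalAt : ℕ := 29
abbrev weights : ℕ := 30
abbrev consZero : ℕ := 31
abbrev units : ℕ := 32
abbrev headsZero : ℕ := 33
abbrev tails : ℕ := 34
abbrev heads : ℕ := 35
abbrev norm : ℕ := 36
abbrev powers : ℕ := 37
abbrev vec : ℕ := 38
abbrev gens : ℕ := 39
abbrev reduce : ℕ := 40
abbrev elim : ℕ := 41
abbrev elimN : ℕ := 42
abbrev pivot : ℕ := 43
abbrev addAll : ℕ := 44

end Fn

namespace Body

open Code

/-- `a ++ b` -/
def append : Term := fn2 fun a b => cases a b fun h t => pair h (call2 Fn.append t b)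

/-- The first `|n|` entries of `l`. -/
def take : Term := fn2 fun n l => cases n nil fun _ n => cases l nil fun h t =>
  pair h (call2 Fn.take n t)

/-- `l` without its first `|n|` entries. -/
def drop : Term := fn2 fun n l => cases n l fun _ n => cases l nil fun _ t => call2 Fn.drop n t

/-- The cyclic left shift of `l` by `|n|` places. -/
def rot : Term := fn2 fun n l => cases n l fun _ n => cases l nil fun h t =>
  call2 Fn.rot n (call2 Fn.append t (pair h nil))

/-- `|n|` copies of `l`. -/
def rep : Term := fn2 fun n l => cases n nil fun _ n => call2 Fn.append l (call2 Fn.rep n l)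

/-- A list of length `|p| ^ |k|`. -/
def pow : Term := fn2 fun k p => cases k (succ nil) fun _ k =>
  call2 Fn.rep p (call2 Fn.pow k p)

/-- A list of length `|n| / 2`. -/
def half : Term := fn fun n => cases n nil fun _ n => cases n nil fun _ n => succ (call Fn.half n)

/-- A list of length `⌈|l| / |p|⌉`. -/
def thin : Term := fn2 fun p l => cases l nil fun h _ =>
  pair h (call2 Fn.thin p (call2 Fn.drop p l))

/-- The least `k` with `|l| ≤ |p| ^ k`. -/
def clog : Term := fn2 fun p l => cases l nil fun _ t => cases t nil fun _ _ =>
  succ (call2 Fn.clog p (call2 Fn.thin p l))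

/-- The first `|n|` entries of `l`, padded with zeros. -/
def pad : Term := fn2 fun n l => cases n nil fun _ n => cases l
  (pair zero (call2 Fn.pad n nil)) fun h t => pair h (call2 Fn.pad n t)

/-- The sum of two polynomials. -/
def add : Term := fn2 fun a b => cases a b fun x a' => cases b a fun y b =>
  pair (Code.add x y) (call2 Fn.add a' b)

/-- A polynomial times a scalar. -/
def smul : Term := fn2 fun c a => cases a nil fun x a => pair (Code.mul c x) (call2 Fn.smul c a)

/-- The entrywise product. -/
def pmulL : Term := fn2 fun a b => cases a nil fun x a => cases b nil fun y b =>
  pair (Code.mul x y) (call2 Fn.pmulL a b)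

/-- The schoolbook product of two polynomials. -/
def naive : Term := fn2 fun a b => cases a nil fun x a =>
  call2 Fn.add (call2 Fn.smul x b) (pair zero (call2 Fn.naive a b))

/-- The sum of two lists of polynomials. -/
def addR : Term := fn2 fun a b => cases a b fun x a' => cases b a fun y b =>
  pair (call2 Fn.add x y) (call2 Fn.addR a' b)

/-- Cyclic shift of all the polynomials of a list. -/
def rotR : Term := fn2 fun n a => cases a nil fun x a =>
  pair (call2 Fn.rot n x) (call2 Fn.rotR n a)

/-- Evaluation of a polynomial whose coefficients are lists of polynomials, at the element that
acts as the cyclic shift by `|z|` places. -/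
def horner : Term := fn2 fun z as => cases as nil fun a r =>
  call2 Fn.addR a (call2 Fn.rotR z (call2 Fn.horner z r))

/-- Division of `l` into `|c|` blocks of length `|n|`. -/
def chunk : Term := fn3 fun c n l => cases c nil fun _ c =>
  pair (call2 Fn.take n l) (call3 Fn.chunk c n (call2 Fn.drop n l))

/-- Division of `l` into `|c|` blocks of length `|s|`, each padded to length `|n|`. -/
def rows : Term := fn4 fun c s n l => cases c nil fun _ c =>
  pair (call2 Fn.pad n (call2 Fn.take s l)) (call4 Fn.rows c s n (call2 Fn.drop s l))

/-- `ctx` holds a unary number `h`, the prime `p`, its inverse and `N = p ^ (h + 4)`. -/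
def fwd : Term := fn fun x =>
  cases x nil fun cnt x => cases cnt nil fun _ cnt =>
  cases x nil fun k x => cases x nil fun e x => cases x nil fun w x => cases x nil fun q x =>
  cases x nil fun ctx x => cases x nil fun l x => cases x nil fun as bs =>
  cases ctx nil fun _ ctx' => cases ctx' nil fun p _ =>
  letC (call2 Fn.rep l e) fun z =>
  pair
    (call Fn.pmul (pair k (pair e (pair (call2 Fn.rep p w) (pair q (pair ctx
      (pair (call2 Fn.horner z as) (call2 Fn.horner z bs))))))))
    (call Fn.fwd (pair cnt (pair k (pair (call2 Fn.append e w) (pair w (pair q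
      (pair ctx (pair l (pair as bs)))))))))

/-- Interpolation. -/
def inter : Term := fn6 fun cnt g h dg dh cs => cases cnt nil fun _ cnt =>
  call2 Fn.append (call2 Fn.rotR g (call2 Fn.horner h cs))
    (call6 Fn.inter cnt (call2 Fn.append g dg) (call2 Fn.append h dh) dg dh cs)

/-- Multiplication of bivariate polynomials modulo `x ^ N - 1` and
`y ^ (p ^ k) - x ^ (- e * p ^ k)`. -/
def pmul : Term := fn fun x =>
  cases x nil fun k x => cases x nil fun e x => cases x nil fun w x => cases x nil fun q x =>
  cases x nil fun ctx x => cases x nil fun as bs =>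
  cases ctx nil fun h ctx' => cases ctx' nil fun p ctx' => cases ctx' nil fun pinv n =>
  cases k
    (cases as nil fun a _ => cases bs nil fun b _ =>
      letC (call5 Fn.mulK h p pinv a b) fun m =>
      pair (call2 Fn.smul q (call2 Fn.add (call2 Fn.take n m) (call2 Fn.drop n m))) nil)
    fun _ k =>
      letC (call2 Fn.pow k p) fun l =>
      letC (call Fn.fwd (pair p (pair k (pair e (pair w (pair (Code.mul q pinv) (pair ctx (pair l
        (pair (call3 Fn.chunk p l as) (call3 Fn.chunk p l bs)))))))))) fun cs =>
      call6 Fn.inter p nil nil (call2 Fn.rep (tl n) (call2 Fn.rep l e))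
        (call2 Fn.rep (tl n) (call2 Fn.rep l w)) cs

/-- The product of two polynomials of length at most `p ^ (k + 4)`. -/
def mulK : Term := fn5 fun k p pinv a b => cases k
  (call2 Fn.pad (call2 Fn.append a b) (call2 Fn.naive a b)) fun _ _ =>
  letC (call Fn.half k) fun h =>
  letC (call2 Fn.pow (succ (succ h)) p) fun s =>
  letC (call2 Fn.rep p s) fun r =>
  letC (call2 Fn.rep p r) fun n =>
  letC (call Fn.pmul (pair (succ (succ (succ (succ h)))) (pair nil (pair (succ nil) (pair one
    (pair (pair h (pair p (pair pinv n))) (pair (call4 Fn.rows n s n a)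
      (call4 Fn.rows n s n b))))))))
    fun c =>
  call2 Fn.pad (call2 Fn.append a b) (call4 Fn.recomb p r s c)

/-- Reduction of the polynomials of a list modulo `1 + x ^ r + ... + x ^ ((p - 1) * r)`, and
their sum with successive shifts by `|s|`. -/
def recomb : Term := fn4 fun p r s cs => cases cs nil fun c cs =>
  call2 Fn.add
    (call2 Fn.add c (call2 Fn.smul (Code.sub zero one) (call2 Fn.rep p
      (call2 Fn.drop (call2 Fn.rep (tl p) r) c))))
    (call2 Fn.append (call2 Fn.pad s nil) (call4 Fn.recomb p r s cs))

/-- The product of two polynomials. -/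
def mul : Term := fn2 fun a b => ifZero (Code.add one one)
  (letC (succ (succ (succ nil))) fun p =>
    call5 Fn.mulK (call2 Fn.clog p (call2 Fn.append a b)) p
      (inv (Code.add (Code.add one one) one)) a b)
  (letC (succ (succ nil)) fun p =>
    call5 Fn.mulK (call2 Fn.clog p (call2 Fn.append a b)) p (inv (Code.add one one)) a b)

/-- `∑ i, Q i * f (γ ^ i * x)` where `gs` lists the powers of `γ`. -/
def contrib : Term := fn3 fun qs f gs => cases qs nil fun q qs =>
  call2 Fn.add (call2 Fn.mul q f) (call3 Fn.contrib qs (call2 Fn.pmulL f gs) gs)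

def takeAll : Term := fn2 fun n qs => cases qs nil fun q qs =>
  pair (call2 Fn.take n q) (call2 Fn.takeAll n qs)

/-- The solution of a triangular system by divide and conquer. -/
def solve : Term := fn6 fun k qs us ws gs acc => cases k
  (cases ws nil fun w _ => pair (Code.add (hd us) (Code.mul w (hd acc))) nil) fun _ k =>
  letC (call2 Fn.pow k (succ (succ nil))) fun h =>
  letC (call6 Fn.solve k qs us (call2 Fn.take h ws) gs acc) fun f =>
  letC (call2 Fn.drop h (call3 Fn.contrib (call2 Fn.takeAll (call2 Fn.append h h) qs) f gs))
    fun c =>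
  call2 Fn.append f (call6 Fn.solve k qs (call2 Fn.drop h us) (call2 Fn.drop h ws)
    (call2 Fn.drop h gs) (call2 Fn.add c (call2 Fn.drop h acc)))

/-- The value of a polynomial at `x`. -/
def evalAt : Term := fn2 fun a x => cases a zero fun c a =>
  Code.add c (Code.mul x (call2 Fn.evalAt a x))

/-- `-1 / b (g)` for all entries `g` of `gs`, with `1 / 0 = 0`. -/
def weights : Term := fn2 fun b gs => cases gs nil fun g gs =>
  letC (call2 Fn.evalAt b g) fun x =>
  pair (ifZero x zero (Code.sub zero (inv x))) (call2 Fn.weights b gs)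

def consZero : Term := fn fun a => cases a nil fun x a => pair (pair zero x) (call Fn.consZero a)

/-- The unit vectors of the positions at which `ws` is zero. -/
def units : Term := fn fun ws => cases ws nil fun w ws =>
  letC (call Fn.consZero (call Fn.units ws)) fun us =>
  ifZero w (pair (pair one nil) us) us

/-- `nil` if all the lists of `qs` have head `0`. -/
def headsZero : Term := fn fun qs => cases qs nil fun q qs =>
  ifZero (hd q) (call Fn.headsZero qs) (succ nil)

def tails : Term := fn fun qs => cases qs nil fun q qs => pair (tl q) (call Fn.tails qs)

def heads : Term := fn fun qs => cases qs nil fun q qs => pair (hd q) (call Fn.heads qs)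

/-- Removal of the common factors `x` of the polynomials `qs`. -/
def norm : Term := fn2 fun qt qs => cases qs nil fun q _ => cases q nil fun _ _ =>
  cases (call Fn.headsZero qs)
    (call2 Fn.norm (tl qt) (call Fn.tails qs))
    (fun _ _ => pair qt qs)

/-- `c, c * g, c * g ^ 2, ...` -/
def powers : Term := fn3 fun n g c => cases n nil fun _ n =>
  pair c (call3 Fn.powers n g (Code.mul c g))

/-- The solution of a triangular system, with its residual in front.  `ctx` holds the number of
residual entries, the recursion depth, the normalized polynomials, the original ones, the weights
and the powers of `γ`. -/
def vec : Term := fn5 fun ctx h us acc e =>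
  cases ctx nil fun r ctx => cases ctx nil fun k ctx => cases ctx nil fun qv ctx =>
  cases ctx nil fun qs ctx => cases ctx nil fun ws gs =>
  letC (call6 Fn.solve k qv us ws gs acc) fun f =>
  call2 Fn.append (call2 Fn.pad r (call2 Fn.add e (call3 Fn.contrib qs f gs))) (pair h f)

def gens : Term := fn2 fun ctx us => cases us nil fun u us =>
  pair (call5 Fn.vec ctx zero u nil nil) (call2 Fn.gens ctx us)

/-- Subtraction of a multiple of a vector with head `1 / c` and tail `t` from the given vectors,
such that their heads become zero; the heads are removed. -/
def reduce : Term := fn3 fun c t vs => cases vs nil fun v vs =>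
  pair (call2 Fn.add (tl v) (call2 Fn.smul (Code.sub zero (Code.mul c (hd v))) t))
    (call3 Fn.reduce c t vs)

/-- A basis of the vectors with head zero, with the heads removed. -/
def elim : Term := fn fun vs => cases vs nil fun v vs =>
  ifZero (hd v) (pair (tl v) (call Fn.elim vs)) (call3 Fn.reduce (inv (hd v)) (tl v) vs)

def elimN : Term := fn2 fun n vs => cases n vs fun _ n => call2 Fn.elimN n (call Fn.elim vs)

/-- The tail of the first vector with nonzero head, scaled. -/
def pivot : Term := fn fun vs => cases vs nil fun v vs =>
  ifZero (hd v) (call Fn.pivot vs) (succ (call2 Fn.smul (inv (hd v)) (tl v)))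

def addAll : Term := fn2 fun a bs => cases bs nil fun b bs =>
  pair (call2 Fn.add a b) (call2 Fn.addAll a bs)

def main : Term := fn3 fun g d qs => cases qs nil fun qt qs =>
  letC (call3 Fn.powers (succ d) g one) fun gs =>
  cases (call2 Fn.norm qt qs) nil fun qtv qv =>
  letC (call2 Fn.weights (call Fn.heads qv) gs) fun ws =>
  letC (pair (call2 Fn.append qt d) (pair (call2 Fn.clog (succ (succ nil)) ws) (pair qv
    (pair qs (pair ws gs))))) fun ctx =>
  letC (pair (call5 Fn.vec ctx one nil qtv qt) (call2 Fn.gens ctx (call Fn.units ws))) fun vs =>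
  letC (call2 Fn.elimN (call2 Fn.append qt d) vs) fun vs =>
  cases (call Fn.pivot vs) nil fun _ p => pair p (call2 Fn.addAll p (call Fn.elim vs))

end Body

/-- The solver. -/
def solver : Program :=
  [Body.main, Body.append, Body.take, Body.drop, Body.rot, Body.rep, Body.pow, Body.half,
    Body.thin, Body.clog, Body.pad, Body.add, Body.smul, Body.pmulL, Body.naive, Body.addR,
    Body.rotR, Body.horner, Body.chunk, Body.rows, Body.fwd, Body.inter, Body.pmul, Body.mulK,
    Body.recomb, Body.mul, Body.contrib, Body.takeAll, Body.solve, Body.evalAt, Body.weights,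
    Body.consZero, Body.units, Body.headsZero, Body.tails, Body.heads, Body.norm, Body.powers,
    Body.vec, Body.gens, Body.reduce, Body.elim, Body.elimN, Body.pivot, Body.addAll]

attribute [simp ↓] wp_letIn wp_call wp_nil wp_pair wp_split wp_zero wp_one wp_add wp_sub
  wp_mul wp_inv wp_ifZero

attribute [simp] Code.letC Code.cases Code.call Code.nil Code.pair Code.zero Code.one Code.add
  Code.sub Code.mul Code.inv Code.ifZero Code.hd Code.tl Code.succ Code.fn Code.fn2 Code.fn3
  Code.fn4 Code.fn5 Code.fn6 Code.call2 Code.call3 Code.call4 Code.call5 Code.call6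

/-! ### Functions on lists -/

section List

variable {F : Type*} [Field F] {Q : Val F → ℕ → Prop}

/-- The functions of the solver, by number. -/
theorem wpCall_solver (k : ℕ) {body : Term} {u : Val F} (h : solver[k]? = some body) :
    wpCall solver k u Q ↔ wp solver [u] body Q := by
  simp [wpCall, h]

@[simp ↓] theorem wp_var_zero {P : Program} {v : Val F} {env : List (Val F)} :
    wp P (v :: env) (.var 0) Q ↔ Q v 0 := by
  simp [wp_var]

@[simp ↓] theorem wp_var_succ {P : Program} {v : Val F} {env : List (Val F)} {i : ℕ} :
    wp P (v :: env) (.var (i + 1)) Q ↔ wp P env (.var i) Q := by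
  simp [wp_var]

-- Rearranging data performs no field operation, so list functions have exact cost 0 and their
-- specifications can be equivalences usable by simp.
@[simp ↓] theorem wpCall_append (a b : List (Val F)) :
    wpCall solver Fn.append (.pair (.ofList a) (.ofList b)) Q ↔ Q (.ofList (a ++ b)) 0 := by
  induction a generalizing Q with
  | nil => rw [wpCall_solver Fn.append rfl]; simp [Body.append]
  | cons x a ih => rw [wpCall_solver Fn.append rfl]; simp [Body.append, ih]

@[simp ↓] theorem wpCall_take (n l : List (Val F)) :
    wpCall solver Fn.take (.pair (.ofList n) (.ofList l)) Q ↔ Q (.ofList (l.take n.length)) 0 := by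
  induction n generalizing Q l with
  | nil => rw [wpCall_solver Fn.take rfl]; simp [Body.take]
  | cons x a ih => rw [wpCall_solver Fn.take rfl]; cases l <;> simp [Body.take, ih]

@[simp ↓] theorem wpCall_drop (n l : List (Val F)) :
    wpCall solver Fn.drop (.pair (.ofList n) (.ofList l)) Q ↔ Q (.ofList (l.drop n.length)) 0 := by
  induction n generalizing Q l with
  | nil => rw [wpCall_solver Fn.drop rfl]; simp [Body.drop]
  | cons x a ih => rw [wpCall_solver Fn.drop rfl]; cases l <;> simp [Body.drop, ih]

/-- Needed because simp normalizes `Val.ofList [x]` to a pair, which hides the list from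
`wpCall_append`. -/
theorem wpCall_append_singleton (a : List (Val F)) (x : Val F) :
    wpCall solver Fn.append (.pair (.ofList a) (.pair x .nil)) Q ↔ Q (.ofList (a ++ [x])) 0 :=
  wpCall_append a [x]

@[simp ↓] theorem wpCall_rot (n l : List (Val F)) :
    wpCall solver Fn.rot (.pair (.ofList n) (.ofList l)) Q ↔
      Q (.ofList (l.rotate n.length)) 0 := by
  induction n generalizing Q l with
  | nil => rw [wpCall_solver Fn.rot rfl]; simp [Body.rot]
  | cons x a ih =>
    rw [wpCall_solver Fn.rot rfl]
    cases l <;> simp [Body.rot, ih, wpCall_append_singleton]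

/-- `n` copies of a list. -/
def rep {α : Type*} (n : ℕ) (l : List α) : List α := (List.replicate n l).flatten

@[simp] theorem rep_zero {α : Type*} (l : List α) : rep 0 l = [] := rfl

theorem rep_succ {α : Type*} (n : ℕ) (l : List α) : rep (n + 1) l = l ++ rep n l := by
  simp [rep, List.replicate_succ]

@[simp] theorem length_rep {α : Type*} (n : ℕ) (l : List α) : (rep n l).length = n * l.length := by
  simp [rep]

theorem map_rep {α β : Type*} (f : α → β) (n : ℕ) (l : List α) :
    (rep n l).map f = rep n (l.map f) := by
  simp [rep]

@[simp ↓] theorem wpCall_rep (n l : List (Val F)) :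
    wpCall solver Fn.rep (.pair (.ofList n) (.ofList l)) Q ↔ Q (.ofList (rep n.length l)) 0 := by
  induction n generalizing Q with
  | nil => rw [wpCall_solver Fn.rep rfl]; simp [Body.rep]
  | cons x a ih => rw [wpCall_solver Fn.rep rfl]; simp [Body.rep, ih, rep_succ]

/-- A unary representation of `|p| ^ k`. -/
def upow {α : Type*} (d : α) (p : List α) : ℕ → List α
  | 0 => [d]
  | k + 1 => rep p.length (upow d p k)

@[simp] theorem length_upow {α : Type*} (d : α) (p : List α) (k : ℕ) :
    (upow d p k).length = p.length ^ k := by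
  induction k with
  | zero => rfl
  | succ k ih => simp [upow, ih, pow_succ, mul_comm]

@[simp ↓] theorem wpCall_pow (k p : List (Val F)) :
    wpCall solver Fn.pow (.pair (.ofList k) (.ofList p)) Q ↔
      Q (.ofList (upow .nil p k.length)) 0 := by
  induction k generalizing Q with
  | nil => rw [wpCall_solver Fn.pow rfl]; simp [Body.pow, upow]
  | cons x a ih => rw [wpCall_solver Fn.pow rfl]; simp [Body.pow, ih, upow]

@[simp ↓] theorem wpCall_half (n : List (Val F)) :
    wpCall solver Fn.half (.ofList n) Q ↔ Q (.ofNat (n.length / 2)) 0 := by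
  induction h : n.length using Nat.strong_induction_on generalizing n Q with
  | _ _ ih =>
    subst h
    rw [wpCall_solver Fn.half rfl]
    match n with
    | [] => simp [Body.half, Val.ofNat]
    | [_] => simp [Body.half, Val.ofNat]
    | _ :: _ :: n =>
      have h : (n.length + 1 + 1) / 2 = n.length / 2 + 1 := by omega
      simp [Body.half, ih n.length (by simp) n rfl, Val.ofNat, List.replicate_succ, h]

/-- Every `p`-th entry of a list. -/
def thin {α : Type*} (p : ℕ) : List α → List α
  | [] => []
  | x :: l => x :: thin p (l.drop (p - 1))
  termination_by l => l.length
  decreasing_by simp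

/-- This ceiling is the argument in the recursion `Nat.clog_of_two_le`; keeping every `p`-th entry
therefore counts down the ceiling of the logarithm. -/
theorem length_thin {α : Type*} {p : ℕ} (hp : 0 < p) (l : List α) :
    (thin p l).length = (l.length + p - 1) / p := by
  induction h : l.length using Nat.strong_induction_on generalizing l with
  | _ _ ih =>
    subst h
    match l with
    | [] =>
      rw [thin, List.length_nil, Nat.zero_add]
      exact (Nat.div_eq_of_lt (by omega)).symm
    | x :: l =>
      rw [thin, List.length_cons, ih _ (by simp) _ rfl, List.length_drop, List.length_cons]
      rcases le_or_gt (p - 1) l.length with h | h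
      · rw [show l.length - (p - 1) + p - 1 = l.length by omega,
          show l.length + 1 + p - 1 = l.length + p by omega, Nat.add_div_right _ hp]
      · rw [show l.length - (p - 1) + p - 1 = p - 1 by omega, Nat.div_eq_of_lt (by omega)]
        exact (Nat.div_eq_of_lt_le (by omega) (by omega)).symm

theorem wpCall_drop_cons (x : Val F) (n l : List (Val F)) :
    wpCall solver Fn.drop (.pair (.pair x (.ofList n)) (.ofList l)) Q ↔
      Q (.ofList (l.drop (n.length + 1))) 0 :=
  wpCall_drop (x :: n) l

-- The first argument is written as a pair because it must be nonempty: with step 0 the call on a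
-- nonempty list would not terminate. For the same reason `wpCall_clog` asks for a base of length at
-- least 2.
@[simp ↓] theorem wpCall_thin (x : Val F) (p l : List (Val F)) :
    wpCall solver Fn.thin (.pair (.pair x (.ofList p)) (.ofList l)) Q ↔
      Q (.ofList (thin (p.length + 1) l)) 0 := by
  induction h : l.length using Nat.strong_induction_on generalizing l Q with
  | _ _ ih =>
    subst h
    rw [wpCall_solver Fn.thin rfl]
    match l with
    | [] => simp [Body.thin, thin]
    | y :: l =>
      have := fun Q => wpCall_drop_cons (Q := Q) x p (y :: l)
      simp only [Val.ofList_cons] at this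
      simp [Body.thin, thin, this, ih _ _ (l.drop p.length) rfl]

@[simp ↓] theorem wpCall_clog (x y : Val F) (p l : List (Val F)) :
    wpCall solver Fn.clog (.pair (.pair x (.pair y (.ofList p))) (.ofList l)) Q ↔
      Q (.ofNat (Nat.clog (p.length + 2) l.length)) 0 := by
  induction h : l.length using Nat.strong_induction_on generalizing l Q with
  | _ _ ih =>
    subst h
    rw [wpCall_solver Fn.clog rfl]
    match l with
    | [] => simp [Body.clog, Val.ofNat]
    | [_] => simp [Body.clog, Val.ofNat]
    | a :: b :: l =>
      have hl : (thin (p.length + 2) (a :: b :: l)).length < (a :: b :: l).length := by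
        rw [length_thin (by omega), Nat.div_lt_iff_lt_mul (by omega)]
        simp only [List.length_cons]
        have h := Nat.le_mul_of_pos_left p.length (show 0 < l.length + 1 + 1 by omega)
        rw [Nat.mul_add]
        generalize (l.length + 1 + 1) * p.length = y at h ⊢
        omega
      have h := fun Q => ih _ hl (Q := Q) _ rfl
      have h2 := fun Q => wpCall_thin (Q := Q) x (y :: p) (a :: b :: l)
      rw [Nat.clog_of_two_le (by omega) (by simp)]
      simp [length_thin] at h
      simp only [List.length_cons, Val.ofList_cons] at h2
      simp [Body.clog, Val.ofNat, List.replicate_succ, h, h2]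

end List

/-! ### Polynomials as coefficient lists -/

section Poly

variable {F : Type*}

/-- A list of field elements as a value. -/
def Val.poly (l : List F) : Val F := .ofList (l.map .elem)

/-- A list of coefficient lists as a value. -/
def Val.polys (l : List (List F)) : Val F := .ofList (l.map Val.poly)

@[simp] theorem Val.poly_nil : Val.poly ([] : List F) = .nil := rfl

@[simp] theorem Val.poly_cons (x : F) (l : List F) :
    Val.poly (x :: l) = .pair (.elem x) (.poly l) := rfl

@[simp] theorem Val.polys_nil : Val.polys ([] : List (List F)) = .nil := rfl

@[simp] theorem Val.polys_cons (x : List F) (l : List (List F)) :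
    Val.polys (x :: l) = .pair (.poly x) (.polys l) := rfl

variable [Field F] {Q : Val F → ℕ → Prop}

@[simp ↓] theorem wpCall_append_poly (a b : List F) :
    wpCall solver Fn.append (.pair (.poly a) (.poly b)) Q ↔ Q (.poly (a ++ b)) 0 := by
  simp [Val.poly]

@[simp ↓] theorem wpCall_take_poly (n : List (Val F)) (l : List F) :
    wpCall solver Fn.take (.pair (.ofList n) (.poly l)) Q ↔ Q (.poly (l.take n.length)) 0 := by
  simp [Val.poly]

@[simp ↓] theorem wpCall_drop_poly (n : List (Val F)) (l : List F) :
    wpCall solver Fn.drop (.pair (.ofList n) (.poly l)) Q ↔ Q (.poly (l.drop n.length)) 0 := by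
  simp [Val.poly]

@[simp ↓] theorem wpCall_rot_poly (n : List (Val F)) (l : List F) :
    wpCall solver Fn.rot (.pair (.ofList n) (.poly l)) Q ↔ Q (.poly (l.rotate n.length)) 0 := by
  simp [Val.poly, List.map_rotate]

@[simp ↓] theorem wpCall_rep_poly (n : List (Val F)) (l : List F) :
    wpCall solver Fn.rep (.pair (.ofList n) (.poly l)) Q ↔ Q (.poly (rep n.length l)) 0 := by
  simp [Val.poly, map_rep]

@[simp ↓] theorem wpCall_append_polys (a b : List (List F)) :
    wpCall solver Fn.append (.pair (.polys a) (.polys b)) Q ↔ Q (.polys (a ++ b)) 0 := by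
  simp [Val.polys]

@[simp ↓] theorem wpCall_take_polys (n : List (Val F)) (l : List (List F)) :
    wpCall solver Fn.take (.pair (.ofList n) (.polys l)) Q ↔ Q (.polys (l.take n.length)) 0 := by
  simp [Val.polys]

@[simp ↓] theorem wpCall_drop_polys (n : List (Val F)) (l : List (List F)) :
    wpCall solver Fn.drop (.pair (.ofList n) (.polys l)) Q ↔ Q (.polys (l.drop n.length)) 0 := by
  simp [Val.polys]

/-- The polynomial with the given coefficients. -/
noncomputable def polyOf : List F → F[X]
  | [] => 0
  | a :: l => C a + X * polyOf l

@[simp] theorem polyOf_nil : polyOf ([] : List F) = 0 := rfl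

@[simp] theorem polyOf_cons (a : F) (l : List F) : polyOf (a :: l) = C a + X * polyOf l := rfl

theorem coeff_polyOf (l : List F) (i : ℕ) : (polyOf l).coeff i = l.getD i 0 := by
  induction l generalizing i with
  | nil => simp
  | cons a l ih => cases i <;> simp [ih, coeff_C]

theorem coeff_polyOf_of_le {l : List F} {i : ℕ} (h : l.length ≤ i) : (polyOf l).coeff i = 0 := by
  simp [coeff_polyOf, List.getElem?_eq_none h]

theorem degree_polyOf_lt (l : List F) : (polyOf l).degree < l.length := by
  rw [degree_lt_iff_coeff_zero]
  exact fun m => coeff_polyOf_of_le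

theorem polyOf_append (a b : List F) : polyOf (a ++ b) = polyOf a + X ^ a.length * polyOf b := by
  induction a with
  | nil => simp
  | cons x a ih => simp [ih, pow_succ]; ring

/-- The sum of two coefficient lists. -/
def addL : List F → List F → List F
  | [], b => b
  | a, [] => a
  | x :: a, y :: b => (x + y) :: addL a b

@[simp] theorem addL_nil (a : List F) : addL a [] = a := by cases a <;> rfl

@[simp] theorem nil_addL (a : List F) : addL [] a = a := by cases a <;> rfl

@[simp] theorem length_addL (a b : List F) : (addL a b).length = max a.length b.length := by
  induction a generalizing b with
  | nil => simp
  | cons x a ih => cases b <;> simp [addL, ih]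

@[simp] theorem polyOf_addL (a b : List F) : polyOf (addL a b) = polyOf a + polyOf b := by
  induction a generalizing b with
  | nil => simp
  | cons x a ih =>
    cases b with
    | nil => simp
    | cons y b => simp [addL, ih]; ring

@[simp ↓] theorem wpCall_add (a b : List F) :
    wpCall solver Fn.add (.pair (.poly a) (.poly b)) Q ↔
      Q (.poly (addL a b)) (min a.length b.length) := by
  induction a generalizing b Q with
  | nil => rw [wpCall_solver Fn.add rfl]; simp [Body.add]
  | cons x a ih =>
    rw [wpCall_solver Fn.add rfl]
    cases b <;> simp [Body.add, ih, addL, add_comm]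

/-- A scalar multiple of a coefficient list. -/
def smulL (c : F) (a : List F) : List F := a.map (c * ·)

@[simp] theorem smulL_nil (c : F) : smulL c [] = [] := rfl

@[simp] theorem length_smulL (c : F) (a : List F) : (smulL c a).length = a.length := by
  simp [smulL]

@[simp] theorem polyOf_smulL (c : F) (a : List F) : polyOf (smulL c a) = C c * polyOf a := by
  induction a with
  | nil => simp
  | cons x a ih => simp only [smulL] at ih; simp [smulL, ih]; ring

@[simp ↓] theorem wpCall_smul (c : F) (a : List F) :
    wpCall solver Fn.smul (.pair (.elem c) (.poly a)) Q ↔ Q (.poly (smulL c a)) a.length := by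
  induction a generalizing Q with
  | nil => rw [wpCall_solver Fn.smul rfl]; simp [Body.smul, smulL]
  | cons x a ih => rw [wpCall_solver Fn.smul rfl]; simp [Body.smul, ih, smulL, add_comm]

@[simp ↓] theorem wpCall_pmulL (a b : List F) :
    wpCall solver Fn.pmulL (.pair (.poly a) (.poly b)) Q ↔
      Q (.poly (List.zipWith (· * ·) a b)) (min a.length b.length) := by
  induction a generalizing b Q with
  | nil => rw [wpCall_solver Fn.pmulL rfl]; simp [Body.pmulL]
  | cons x a ih =>
    rw [wpCall_solver Fn.pmulL rfl]
    cases b <;> simp [Body.pmulL, ih, add_comm]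

/-- The first `n` coefficients, padded with zeros. -/
def padL : ℕ → List F → List F
  | 0, _ => []
  | n + 1, [] => 0 :: padL n []
  | n + 1, x :: l => x :: padL n l

@[simp] theorem length_padL (n : ℕ) (l : List F) : (padL n l).length = n := by
  induction n generalizing l with
  | zero => rfl
  | succ n ih => cases l <;> simp [padL, ih]

@[simp] theorem polyOf_padL_nil (n : ℕ) : polyOf (padL n ([] : List F)) = 0 := by
  induction n with
  | zero => rfl
  | succ n ih => simp [padL, ih]

/-- `padL` also truncates. The hypothesis bounds the degree and not the length, so that superfluous
trailing zeros of a computed product may be cut off. -/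
theorem polyOf_padL {n : ℕ} {l : List F} (h : (polyOf l).degree < n) :
    polyOf (padL n l) = polyOf l := by
  rw [degree_lt_iff_coeff_zero] at h
  induction n generalizing l with
  | zero => ext i; simpa [padL] using (h i (Nat.zero_le i)).symm
  | succ n ih =>
    cases l with
    | nil => simp
    | cons x l =>
      simp only [padL, polyOf_cons]
      rw [ih fun m hm => by simpa using h (m + 1) (by omega)]

@[simp ↓] theorem wpCall_pad (n : List (Val F)) (l : List F) :
    wpCall solver Fn.pad (.pair (.ofList n) (.poly l)) Q ↔ Q (.poly (padL n.length l)) 0 := by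
  induction n generalizing l Q with
  | nil => rw [wpCall_solver Fn.pad rfl]; simp [Body.pad, padL]
  | cons x n ih =>
    have h := fun Q => ih (Q := Q) []
    rw [Val.poly_nil] at h
    rw [wpCall_solver Fn.pad rfl]
    cases l <;> simp [Body.pad, ih, padL, h]

@[simp ↓] theorem wpCall_pad_nil (n : List (Val F)) :
    wpCall solver Fn.pad (.pair (.ofList n) .nil) Q ↔ Q (.poly (padL n.length [])) 0 :=
  wpCall_pad n []

/-- The schoolbook product. -/
def naiveL : List F → List F → List F
  | [], _ => []
  | x :: a, b => addL (smulL x b) (0 :: naiveL a b)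

theorem polyOf_naiveL (a b : List F) : polyOf (naiveL a b) = polyOf a * polyOf b := by
  induction a with
  | nil => simp [naiveL]
  | cons x a ih => simp [naiveL, ih]; ring

theorem computes_naive (a b : List F) :
    Computes solver Fn.naive (.pair (.poly a) (.poly b)) (.poly (naiveL a b))
      (a.length * (2 * b.length)) := by
  rw [Computes]
  induction a with
  | nil => rw [wpCall_solver Fn.naive rfl]; simp [Body.naive, naiveL]
  | cons x a ih =>
    have h := fun l Q => wpCall_add (Q := Q) (smulL x b) (0 :: l)
    rw [wpCall_solver Fn.naive rfl]
    simp only [Val.poly_cons] at h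
    simp [Body.naive]
    refine Computes.wpCall ih fun c hc => ?_
    simp [h, naiveL]
    nlinarith [min_le_left b.length ((naiveL a b).length + 1)]

end Poly

/-! ### Bivariate polynomials as lists of coefficient lists -/

section Rows

variable {F : Type*}

/-- A list of lists of coefficient lists as a value. -/
def Val.blocks (l : List (List (List F))) : Val F := .ofList (l.map Val.polys)

@[simp] theorem Val.blocks_nil : Val.blocks ([] : List (List (List F))) = .nil := rfl

@[simp] theorem Val.blocks_cons (x : List (List F)) (l : List (List (List F))) :
    Val.blocks (x :: l) = .pair (.polys x) (.blocks l) := rfl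

/-- Division of a list into `c` blocks of length `n`. -/
def chunks {α : Type*} : ℕ → ℕ → List α → List (List α)
  | 0, _, _ => []
  | c + 1, n, l => l.take n :: chunks c n (l.drop n)

@[simp] theorem length_chunks {α : Type*} (c n : ℕ) (l : List α) : (chunks c n l).length = c := by
  induction c generalizing l with
  | zero => rfl
  | succ c ih => simp [chunks, ih]

theorem length_of_mem_chunks {α : Type*} {c n : ℕ} {l b : List α} (hl : l.length = c * n)
    (hb : b ∈ chunks c n l) : b.length = n := by
  induction c generalizing l with
  | zero => simp [chunks] at hb
  | succ c ih =>
    rw [Nat.succ_mul] at hl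
    rcases List.mem_cons.1 hb with rfl | hb
    · simp [hl]
    · exact ih (by simp [hl]) hb

theorem mem_of_mem_chunks {α : Type*} {c n : ℕ} {l b : List α} {x : α}
    (hb : b ∈ chunks c n l) (hx : x ∈ b) : x ∈ l := by
  induction c generalizing l with
  | zero => simp [chunks] at hb
  | succ c ih =>
    rcases List.mem_cons.1 hb with rfl | hb
    · exact List.mem_of_mem_take hx
    · exact List.mem_of_mem_drop (ih hb)

theorem flatten_chunks {α : Type*} {c n : ℕ} {l : List α} (hl : l.length = c * n) :
    (chunks c n l).flatten = l := by
  induction c generalizing l with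
  | zero => simpa [chunks] using hl
  | succ c ih =>
    rw [Nat.succ_mul] at hl
    rw [chunks, List.flatten_cons, ih (by simp [hl]), List.take_append_drop]

variable [Field F] {Q : Val F → ℕ → Prop}

@[simp ↓] theorem wpCall_chunk (c n : List (Val F)) (l : List (List F)) :
    wpCall solver Fn.chunk (.pair (.ofList c) (.pair (.ofList n) (.polys l))) Q ↔
      Q (.blocks (chunks c.length n.length l)) 0 := by
  induction c generalizing l Q with
  | nil => rw [wpCall_solver Fn.chunk rfl]; simp [Body.chunk, chunks]
  | cons x c ih => rw [wpCall_solver Fn.chunk rfl]; simp [Body.chunk, chunks, ih]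

/-- Division of a list into `c` blocks of length `s`, padded to length `n`. -/
def rowsL (s n : ℕ) : ℕ → List F → List (List F)
  | 0, _ => []
  | c + 1, l => padL n (l.take s) :: rowsL s n c (l.drop s)

@[simp ↓] theorem wpCall_rows (c s n : List (Val F)) (l : List F) :
    wpCall solver Fn.rows (.pair (.ofList c) (.pair (.ofList s) (.pair (.ofList n) (.poly l)))) Q ↔
      Q (.polys (rowsL s.length n.length c.length l)) 0 := by
  induction c generalizing l Q with
  | nil => rw [wpCall_solver Fn.rows rfl]; simp [Body.rows, rowsL]
  | cons x c ih => rw [wpCall_solver Fn.rows rfl]; simp [Body.rows, rowsL, ih]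

@[simp ↓] theorem wpCall_rotR (n : List (Val F)) (a : List (List F)) :
    wpCall solver Fn.rotR (.pair (.ofList n) (.polys a)) Q ↔
      Q (.polys (a.map (·.rotate n.length))) 0 := by
  induction a generalizing Q with
  | nil => rw [wpCall_solver Fn.rotR rfl]; simp [Body.rotR]
  | cons x a ih => rw [wpCall_solver Fn.rotR rfl]; simp [Body.rotR, ih]

/-- The sum of two bivariate polynomials. -/
def addR : List (List F) → List (List F) → List (List F)
  | [], b => b
  | a, [] => a
  | x :: a, y :: b => addL x y :: addR a b

@[simp] theorem addR_nil (a : List (List F)) : addR a [] = a := by cases a <;> rfl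

@[simp] theorem nil_addR (a : List (List F)) : addR [] a = a := by cases a <;> rfl

@[simp] theorem length_addR (a b : List (List F)) :
    (addR a b).length = max a.length b.length := by
  induction a generalizing b with
  | nil => simp
  | cons x a ih => cases b <;> simp [addR, ih]

theorem length_of_mem_addR {a b : List (List F)} {n : ℕ} (ha : ∀ x ∈ a, x.length = n)
    (hb : ∀ x ∈ b, x.length = n) : ∀ x ∈ addR a b, x.length = n := by
  induction a generalizing b with
  | nil => simpa
  | cons x a ih =>
    cases b with
    | nil => simpa using ha
    | cons y b =>
      simp only [List.mem_cons, forall_eq_or_imp] at ha hb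
      simpa [addR, ha.1, hb.1] using ih ha.2 hb.2

theorem computes_addR {a b : List (List F)} {n : ℕ} (ha : ∀ x ∈ a, x.length = n) :
    Computes solver Fn.addR (.pair (.polys a) (.polys b)) (.polys (addR a b)) (a.length * n) := by
  rw [Computes]
  induction a generalizing b with
  | nil => rw [wpCall_solver Fn.addR rfl]; simp [Body.addR]
  | cons x a ih =>
    rw [wpCall_solver Fn.addR rfl]
    simp only [List.mem_cons, forall_eq_or_imp] at ha
    cases b with
    | nil => simp [Body.addR]
    | cons y b =>
      simp [Body.addR]
      refine Computes.wpCall (ih ha.2) fun c hc => ?_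
      simp [addR, ha.1]
      linarith [min_le_left n y.length]

/-- Evaluation by the Horner scheme, at the element that acts as the cyclic shift. -/
def hornerR (z : ℕ) : List (List (List F)) → List (List F)
  | [] => []
  | a :: r => addR a ((hornerR z r).map (·.rotate z))

theorem length_of_mem_hornerR {z n : ℕ} {as : List (List (List F))}
    (h : ∀ a ∈ as, ∀ x ∈ a, x.length = n) : ∀ x ∈ hornerR z as, x.length = n := by
  induction as with
  | nil => simp [hornerR]
  | cons a as ih =>
    simp only [List.mem_cons, forall_eq_or_imp] at h
    exact length_of_mem_addR h.1 (by simpa using ih h.2)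

theorem length_hornerR_le {z l : ℕ} {as : List (List (List F))} (h : ∀ a ∈ as, a.length = l) :
    (hornerR z as).length ≤ l := by
  induction as with
  | nil => simp [hornerR]
  | cons a as ih =>
    simp only [List.mem_cons, forall_eq_or_imp] at h
    simpa [hornerR, h.1] using ih h.2

theorem length_hornerR {z l : ℕ} {as : List (List (List F))} (h : ∀ a ∈ as, a.length = l)
    (hne : as ≠ []) : (hornerR z as).length = l := by
  cases as with
  | nil => simp at hne
  | cons a as =>
    simp only [List.mem_cons, forall_eq_or_imp] at h
    simpa [hornerR, h.1] using length_hornerR_le h.2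

theorem computes_horner {z : List (Val F)} {as : List (List (List F))} {l n : ℕ}
    (hl : ∀ a ∈ as, a.length = l) (h : ∀ a ∈ as, ∀ x ∈ a, x.length = n) :
    Computes solver Fn.horner (.pair (.ofList z) (.blocks as)) (.polys (hornerR z.length as))
      (as.length * (l * n)) := by
  rw [Computes]
  induction as with
  | nil => rw [wpCall_solver Fn.horner rfl]; simp [Body.horner, hornerR]
  | cons a as ih =>
    simp only [List.mem_cons, forall_eq_or_imp] at h hl
    rw [wpCall_solver Fn.horner rfl]
    simp [Body.horner]
    refine Computes.wpCall (ih hl.2 h.2) fun c hc => ?_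
    simp
    refine Computes.wpCall (computes_addR h.1) fun c' hc' => ?_
    rw [hl.1] at hc'
    simp [hornerR, Nat.succ_mul]
    omega

/-- The interpolation step. -/
def interL (dg dh : ℕ) (cs : List (List (List F))) : ℕ → ℕ → ℕ → List (List F)
  | 0, _, _ => []
  | c + 1, g, h => (hornerR h cs).map (·.rotate g) ++ interL dg dh cs c (g + dg) (h + dh)

theorem computes_inter {cnt g h dg dh : List (Val F)} {cs : List (List (List F))} {l n : ℕ}
    (hl : ∀ a ∈ cs, a.length = l) (hn : ∀ a ∈ cs, ∀ x ∈ a, x.length = n) :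
    Computes solver Fn.inter (.pair (.ofList cnt) (.pair (.ofList g) (.pair (.ofList h)
      (.pair (.ofList dg) (.pair (.ofList dh) (.blocks cs))))))
      (.polys (interL dg.length dh.length cs cnt.length g.length h.length))
      (cnt.length * (cs.length * (l * n))) := by
  rw [Computes]
  induction cnt generalizing g h with
  | nil => rw [wpCall_solver Fn.inter rfl]; simp [Body.inter, interL]
  | cons a cnt ih =>
    rw [wpCall_solver Fn.inter rfl]
    simp [Body.inter]
    refine Computes.wpCall (computes_horner hl hn) fun c hc => ?_
    simp
    refine Computes.wpCall ih fun c' hc' => ?_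
    simp [interL, Nat.succ_mul]
    omega

theorem length_interL {dg dh l c g h : ℕ} {cs : List (List (List F))}
    (hl : ∀ a ∈ cs, a.length = l) (hne : cs ≠ []) :
    (interL dg dh cs c g h).length = c * l := by
  induction c generalizing g h with
  | zero => simp [interL]
  | succ c ih => simp [interL, ih, length_hornerR hl hne, Nat.succ_mul, add_comm]

theorem length_of_mem_interL {dg dh n c g h : ℕ} {cs : List (List (List F))}
    (hn : ∀ a ∈ cs, ∀ x ∈ a, x.length = n) : ∀ x ∈ interL dg dh cs c g h, x.length = n := by
  induction c generalizing g h with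
  | zero => simp [interL]
  | succ c ih =>
    intro x hx
    simp only [interL, List.mem_append, List.mem_map] at hx
    rcases hx with ⟨y, hy, rfl⟩ | hx
    · simpa using length_of_mem_hornerR hn y hy
    · exact ih x hx

/-! #### Evaluation -/

variable {K : Type*} [CommRing K] (φ : F →+* K) (ξ : K)

/-- A bivariate polynomial, evaluated in one of the variables. -/
noncomputable def polyY : List (List F) → K[X]
  | [] => 0
  | r :: rs => C ((polyOf r).eval₂ φ ξ) + X * polyY rs

@[simp] theorem polyY_nil : polyY φ ξ [] = 0 := rfl

@[simp] theorem polyY_cons (r : List F) (rs : List (List F)) :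
    polyY φ ξ (r :: rs) = C ((polyOf r).eval₂ φ ξ) + X * polyY φ ξ rs := rfl

theorem coeff_polyY (a : List (List F)) (i : ℕ) :
    (polyY φ ξ a).coeff i = (polyOf (a.getD i [])).eval₂ φ ξ := by
  induction a generalizing i with
  | nil => simp
  | cons r a ih => cases i <;> simp [ih, coeff_C]

theorem polyY_append (a b : List (List F)) :
    polyY φ ξ (a ++ b) = polyY φ ξ a + X ^ a.length * polyY φ ξ b := by
  induction a with
  | nil => simp
  | cons x a ih => simp [ih, pow_succ]; ring

theorem polyY_flatten {l : ℕ} {as : List (List (List F))} (h : ∀ a ∈ as, a.length = l) :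
    polyY φ ξ as.flatten =
      ∑ i ∈ Finset.range as.length, (X ^ l) ^ i * polyY φ ξ (as.getD i []) := by
  induction as with
  | nil => simp
  | cons a as ih =>
    simp only [List.mem_cons, forall_eq_or_imp] at h
    rw [List.flatten_cons, polyY_append, ih h.2, List.length_cons, Finset.sum_range_succ', h.1,
      Finset.mul_sum, add_comm]
    simp [pow_succ', mul_assoc]

@[simp] theorem polyY_addR (a b : List (List F)) :
    polyY φ ξ (addR a b) = polyY φ ξ a + polyY φ ξ b := by
  induction a generalizing b with
  | nil => simp
  | cons x a ih =>
    cases b with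
    | nil => simp
    | cons y b => simp [addR, ih]; ring

variable {φ ξ} {θ : K} {n : ℕ}

/-- A left shift moves the constant term to the top, which is division by `x` modulo `x ^ n - 1`.
Hence the shift acts as the inverse `θ` of the point `ξ`. -/
theorem eval_polyOf_rotate (h₁ : θ * ξ = 1) (hn : ξ ^ n = 1) {l : List F} (hl : l.length = n)
    (z : ℕ) : (polyOf (l.rotate z)).eval₂ φ ξ = θ ^ z * (polyOf l).eval₂ φ ξ := by
  induction z generalizing l with
  | zero => simp
  | succ z ih =>
    cases l with
    | nil => simp
    | cons a l =>
      rw [List.rotate_cons_succ, ih (by simpa using hl)]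
      simp only [List.length_cons] at hl
      rw [← hl] at hn
      simp only [polyOf_append, polyOf_cons, polyOf_nil, mul_zero, add_zero, eval₂_add, eval₂_mul,
        eval₂_C, eval₂_X_pow, eval₂_X]
      have : ξ ^ l.length = θ := by
        calc ξ ^ l.length = ξ ^ l.length * (θ * ξ) := by rw [h₁, mul_one]
          _ = θ * ξ ^ (l.length + 1) := by ring
          _ = θ := by rw [hn, mul_one]
      rw [this]
      linear_combination (-θ ^ z * (polyOf l).eval₂ φ ξ) * h₁

theorem polyY_map_rotate (h₁ : θ * ξ = 1) (hn : ξ ^ n = 1) {a : List (List F)}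
    (ha : ∀ x ∈ a, x.length = n) (z : ℕ) :
    polyY φ ξ (a.map (·.rotate z)) = C (θ ^ z) * polyY φ ξ a := by
  induction a with
  | nil => simp
  | cons x a ih =>
    simp only [List.mem_cons, forall_eq_or_imp] at ha
    rw [List.map_cons, polyY_cons, polyY_cons, ih ha.2, eval_polyOf_rotate h₁ hn ha.1, C_mul]
    ring

theorem polyY_hornerR (h₁ : θ * ξ = 1) (hn : ξ ^ n = 1) {as : List (List (List F))}
    (ha : ∀ a ∈ as, ∀ x ∈ a, x.length = n) (z : ℕ) :
    polyY φ ξ (hornerR z as) =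
      ∑ i ∈ Finset.range as.length, C (θ ^ z) ^ i * polyY φ ξ (as.getD i []) := by
  induction as with
  | nil => simp [hornerR]
  | cons a as ih =>
    simp only [List.mem_cons, forall_eq_or_imp] at ha
    rw [hornerR, polyY_addR, polyY_map_rotate h₁ hn (length_of_mem_hornerR ha.2), ih ha.2,
      List.length_cons, Finset.sum_range_succ', Finset.mul_sum, add_comm]
    simp [pow_succ', mul_assoc]

/-- Block `i` of the interpolation is an inverse Fourier sum: Horner evaluation at `θ ^ (h + i *
dh)` supplies the transform, the outer shift by `g + i * dg` the twist. -/
theorem polyY_interL (h₁ : θ * ξ = 1) (hn : ξ ^ n = 1) {cs : List (List (List F))} {l : ℕ}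
    (hl : ∀ a ∈ cs, a.length = l) (hne : cs ≠ [])
    (ha : ∀ a ∈ cs, ∀ x ∈ a, x.length = n) (dg dh c g h : ℕ) :
    polyY φ ξ (interL dg dh cs c g h) =
      ∑ i ∈ Finset.range c, (X ^ l) ^ i * (C (θ ^ (g + i * dg)) *
        ∑ j ∈ Finset.range cs.length, C (θ ^ (h + i * dh)) ^ j * polyY φ ξ (cs.getD j [])) := by
  induction c generalizing g h with
  | zero => simp [interL]
  | succ c ih =>
    rw [interL, polyY_append, polyY_map_rotate h₁ hn (length_of_mem_hornerR ha),
      polyY_hornerR h₁ hn ha, ih, Finset.sum_range_succ', List.length_map, length_hornerR hl hne,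
      add_comm, Finset.mul_sum]
    congr 1
    · refine Finset.sum_congr rfl fun i _ => ?_
      rw [show g + dg + i * dg = g + (i + 1) * dg by ring,
        show h + dh + i * dh = h + (i + 1) * dh by ring]
      ring
    · simp

end Rows

/-- The Chinese remainder theorem for `W ^ p - z ^ p`, the product of the `W - z * ζ ^ j`. -/
theorem pow_sub_pow_dvd_interpolation {R : Type*} [CommRing R] {p : ℕ} {W z y ζ η q s v : R}
    (hy : y * z = 1) (hζ : η * ζ = 1) (hη : η ^ p = 1)
    (hsum : ∀ i, 0 < i → i < p → ∑ j ∈ Finset.range p, (η ^ i) ^ j = 0) (hs : (p : R) * s = 1)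
    {c : ℕ → R} (hc : ∀ j < p, (W - z * ζ ^ j) ∣ c j - q * s * v) :
    (W ^ p - z ^ p) ∣
      (∑ i ∈ Finset.range p, W ^ i * (y ^ i * ∑ j ∈ Finset.range p, (η ^ i) ^ j * c j)) -
        q * v := by
  -- Interchange the sums: the inner sum over `j` vanishes by `hsum` unless `i = 0`, when it equals
  -- `p`.
  have hE : ∑ j ∈ Finset.range p, ∑ i ∈ Finset.range p, (W * y * η ^ j) ^ i = (p : R) := by
    rw [Finset.sum_comm]
    have : ∀ i ∈ Finset.range p, ∑ j ∈ Finset.range p, (W * y * η ^ j) ^ i =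
        if i = 0 then (p : R) else 0 := by
      intro i hi
      split_ifs with h
      · simp [h]
      · have := hsum i (Nat.pos_of_ne_zero h) (Finset.mem_range.1 hi)
        calc _ = (W * y) ^ i * ∑ j ∈ Finset.range p, (η ^ i) ^ j := by
              rw [Finset.mul_sum]
              exact Finset.sum_congr rfl fun j _ => by ring
          _ = 0 := by rw [this, mul_zero]
    rw [Finset.sum_congr rfl this, Finset.sum_ite_eq']
    rcases Nat.eq_zero_or_pos p with rfl | hp
    · simp
    · simp [hp]
  -- The factors `e_j = ∑ i, (W * y * η ^ j) ^ i` play the role of interpolation polynomials. Their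
  -- sum is `p`, so with `p * s = 1` the target `q * v` can be distributed over the terms.
  have : (∑ i ∈ Finset.range p, W ^ i * (y ^ i * ∑ j ∈ Finset.range p, (η ^ i) ^ j * c j)) -
      q * v = ∑ j ∈ Finset.range p, (∑ i ∈ Finset.range p, (W * y * η ^ j) ^ i) *
        (c j - q * s * v) := by
    simp only [mul_sub, Finset.sum_sub_distrib]
    rw [← Finset.sum_mul, hE, show (p : R) * (q * s * v) = q * v * (p * s) by ring, hs, mul_one]
    congr 1
    simp only [Finset.mul_sum, Finset.sum_mul]
    rw [Finset.sum_comm]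
    exact Finset.sum_congr rfl fun j _ => Finset.sum_congr rfl fun i _ => by ring
  rw [this]
  refine Finset.dvd_sum fun j hj => ?_
  obtain ⟨t, ht⟩ := hc j (Finset.mem_range.1 hj)
  have h₁ : (η * ζ) ^ j = 1 := by rw [hζ, one_pow]
  -- Up to a unit, `W - z * ζ ^ j` is `W * y * η ^ j - 1`, and its product with `e_j` is a
  -- telescoping geometric sum, a multiple of `W ^ p - z ^ p`.
  have h₂ : W - z * ζ ^ j = z * ζ ^ j * (W * y * η ^ j - 1) := by
    have : z * ζ ^ j * (W * y * η ^ j) = W * (y * z) * (η * ζ) ^ j := by ring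
    rw [mul_sub, this, hy, h₁]
    ring
  have h₃ : (W * y * η ^ j) ^ p - 1 = y ^ p * (W ^ p - z ^ p) := by
    have e₁ : (η ^ j) ^ p = 1 := by rw [← pow_mul, mul_comm, pow_mul, hη, one_pow]
    have e₂ : (y * z) ^ p = 1 := by rw [hy, one_pow]
    rw [mul_pow, e₁, mul_sub, ← mul_pow, ← mul_pow, e₂, mul_one, mul_comm y W]
  refine ⟨y ^ p * (z * ζ ^ j) * t, ?_⟩
  rw [ht, h₂]
  have := geom_sum_mul (W * y * η ^ j) p
  linear_combination (z * ζ ^ j * t) * (this.trans h₃)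

/-! ### Multiplication of bivariate polynomials -/

section Pmul

variable {F : Type*} [Field F] {Q : Val F → ℕ → Prop}

/-- The function `mulK` multiplies polynomials of length at most `n`, at a cost of at most `M`. -/
def MulSpec (h p : List (Val F)) (s : F) (n M : ℕ) : Prop :=
  ∀ a b : List F, a.length ≤ n → b.length ≤ n → ∃ m : List F, m.length = a.length + b.length ∧
    polyOf m = polyOf a * polyOf b ∧ Computes solver Fn.mulK (.pair (.ofList h) (.pair (.ofList p)
      (.pair (.elem s) (.pair (.poly a) (.poly b))))) (.poly m) M

/-- The parameters of `pmul` that do not change during the recursion. -/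
def pmulCtx (h p : List (Val F)) (s : F) (n : List (Val F)) : Val F :=
  .pair (.ofList h) (.pair (.ofList p) (.pair (.elem s) (.ofList n)))

/-- The cost of `pmul`. -/
def pmulCost (p n M : ℕ) : ℕ → ℕ
  | 0 => M + 2 * n
  | k + 1 => 1 + p * (pmulCost p n M k + 2 * (p * (p ^ k * n))) + p * (p * (p ^ k * n))

variable {K : Type*} [CommRing K] (φ : F →+* K) (ξ θ : K)

/-- Correctness of `pmul` at depth `k`. -/
def PmulSpec (h p : List (Val F)) (s : F) (n : List (Val F)) (M : ℕ) (k : List (Val F)) : Prop :=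
  ∀ (e w : List (Val F)) (q : F) (a b : List (List F)),
    w.length * p.length ^ k.length = n.length →
    a.length = p.length ^ k.length → b.length = p.length ^ k.length →
    (∀ x ∈ a, x.length = n.length) → (∀ x ∈ b, x.length = n.length) →
    ∃ c : List (List F), c.length = p.length ^ k.length ∧ (∀ x ∈ c, x.length = n.length) ∧
      (X ^ p.length ^ k.length - C (θ ^ (p.length ^ k.length * e.length))) ∣
        polyY φ ξ c - C (φ q) * (polyY φ ξ a * polyY φ ξ b) ∧
      Computes solver Fn.pmul (.pair (.ofList k) (.pair (.ofList e) (.pair (.ofList w)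
        (.pair (.elem q) (.pair (pmulCtx h p s n) (.pair (.polys a) (.polys b)))))))
        (.polys c) (pmulCost p.length n.length M k.length)

variable {φ ξ θ} {h p n : List (Val F)} {s : F} {M : ℕ}

/-- One layer of the transform. Call `j` works modulo `y ^ (p ^ k) - θ ^ (p ^ k * (e + j * w))`, the
`j`-th factor of the modulus one level up. Reduction modulo this factor is Horner evaluation of the
`p` blocks at the corresponding power of `θ`. The loop adds `w` to `e`, and the recursive call gets
`p * w` so that `w * p ^ k` remains `N`. -/
theorem exists_computes_fwd {k l w : List (Val F)} {q : F}
    {as bs : List (List (List F))} (hp : 0 < p.length)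
    (hk : PmulSpec φ ξ θ h p s n M k) (hl : l.length = p.length ^ k.length)
    (hw : w.length * p.length ^ (k.length + 1) = n.length)
    (hal : as.length = p.length) (hbl : bs.length = p.length)
    (ha : ∀ a ∈ as, a.length = p.length ^ k.length)
    (hb : ∀ a ∈ bs, a.length = p.length ^ k.length)
    (ha' : ∀ a ∈ as, ∀ x ∈ a, x.length = n.length)
    (hb' : ∀ a ∈ bs, ∀ x ∈ a, x.length = n.length) (cnt e : List (Val F)) :
    ∃ cs : List (List (List F)), cs.length = cnt.length ∧
      (∀ c ∈ cs, c.length = p.length ^ k.length) ∧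
      (∀ c ∈ cs, ∀ x ∈ c, x.length = n.length) ∧
      (∀ j < cnt.length,
        (X ^ l.length - C (θ ^ (l.length * (e.length + j * w.length)))) ∣
          polyY φ ξ (cs.getD j []) - C (φ q) *
            (polyY φ ξ (hornerR (l.length * (e.length + j * w.length)) as) *
              polyY φ ξ (hornerR (l.length * (e.length + j * w.length)) bs))) ∧
      Computes solver Fn.fwd (.pair (.ofList cnt) (.pair (.ofList k) (.pair (.ofList e)
        (.pair (.ofList w) (.pair (.elem q) (.pair (pmulCtx h p s n) (.pair (.ofList l)
          (.pair (.blocks as) (.blocks bs)))))))))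
        (.blocks cs) (cnt.length * (pmulCost p.length n.length M k.length +
          2 * (p.length * (p.length ^ k.length * n.length)))) := by
  induction cnt generalizing e with
  | nil =>
    refine ⟨[], rfl, by simp, by simp, by simp, ?_⟩
    rw [Computes, wpCall_solver Fn.fwd rfl]
    simp [Body.fwd]
  | cons x cnt ih =>
    obtain ⟨cs, h₁, h₂, h₃, h₄, h₅⟩ := ih (e ++ w)
    have hane : as ≠ [] := by rintro rfl; simp at hal; omega
    have hbne : bs ≠ [] := by rintro rfl; simp at hbl; omega
    obtain ⟨c, g₁, g₂, g₃, g₄⟩ := hk e (rep p.length w) q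
      (hornerR (l.length * e.length) as) (hornerR (l.length * e.length) bs)
      (by rw [length_rep, ← hw]; ring) (length_hornerR ha hane) (length_hornerR hb hbne)
      (length_of_mem_hornerR ha') (length_of_mem_hornerR hb')
    refine ⟨c :: cs, by simp [h₁], by simpa [g₁] using h₂, by simpa using ⟨g₂, h₃⟩, ?_, ?_⟩
    · rintro (_ | j) hj
      · simpa [hl] using g₃
      · have := h₄ j (by simpa using hj)
        rw [List.length_append, add_assoc] at this
        simpa [add_mul, add_comm, add_left_comm] using this
    · have hca := computes_horner (z := rep l.length e) ha ha'
      have hcb := computes_horner (z := rep l.length e) hb hb'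
      rw [length_rep] at hca hcb
      unfold pmulCtx at g₄ h₅
      rw [Computes, wpCall_solver Fn.fwd rfl]
      simp [Body.fwd, pmulCtx]
      refine Computes.wpCall hca fun c₁ hc₁ => ?_
      refine Computes.wpCall hcb fun c₂ hc₂ => ?_
      refine Computes.wpCall g₄ fun c₃ hc₃ => ?_
      refine Computes.wpCall h₅ fun c₄ hc₄ => ?_
      rw [hal] at hc₁
      rw [hbl] at hc₂
      refine ⟨⟨rfl, rfl⟩, ?_⟩
      rw [Nat.succ_mul]
      omega

theorem dvd_sum_pow_sub {R : Type*} [CommRing R] (x y : R) (f : ℕ → R) (n : ℕ) :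
    (x - y) ∣ (∑ i ∈ Finset.range n, x ^ i * f i) - ∑ i ∈ Finset.range n, y ^ i * f i := by
  rw [← Finset.sum_sub_distrib]
  refine Finset.dvd_sum fun i _ => ?_
  rw [← sub_mul]
  exact (sub_dvd_pow_sub_pow x y i).mul_right _

/-- At a leaf a single coefficient product is needed. Folding its upper part onto the lower one
reduces it modulo `x ^ N - 1`, which is invisible at `ξ` because `ξ ^ N = 1`. -/
theorem pmulSpec_nil (hM : MulSpec h p s n.length M) (hξ : ξ ^ n.length = 1) :
    PmulSpec φ ξ θ h p s n M [] := by
  intro e w q a b _ ha hb ha' hb'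
  obtain ⟨a, rfl⟩ := List.length_eq_one_iff.1 ha
  obtain ⟨b, rfl⟩ := List.length_eq_one_iff.1 hb
  simp only [List.mem_singleton, forall_eq] at ha' hb'
  obtain ⟨m, g₁, g₂, g₃⟩ := hM a b ha'.le hb'.le
  have g₄ : (m.take n.length).length = n.length := by simp; omega
  refine ⟨[smulL q (addL (m.take n.length) (m.drop n.length))], rfl, ?_, ?_, ?_⟩
  · simp; omega
  · have : (polyOf m).eval₂ φ ξ = (polyOf (m.take n.length)).eval₂ φ ξ +
        (polyOf (m.drop n.length)).eval₂ φ ξ := by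
      conv_lhs => rw [← List.take_append_drop n.length m, polyOf_append, g₄]
      rw [eval₂_add, eval₂_mul, eval₂_X_pow, hξ, one_mul]
    simp only [polyY_cons, polyY_nil, polyOf_smulL, polyOf_addL, eval₂_mul, eval₂_C, eval₂_add,
      ← this, g₂, C_mul]
    simp
  · rw [Computes, wpCall_solver Fn.pmul rfl]
    simp [Body.pmul, pmulCtx]
    refine Computes.wpCall g₃ fun c hc => ?_
    simp [pmulCost]
    omega

/-- `pow_sub_pow_dvd_interpolation` with `W = y ^ (p ^ k)` recovers the product modulo `W ^ p - z ^
p` from the products modulo the `p` factors. The factor `1 / p` of the inverse transform is already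
in the scalar `q * s` handed to the recursive calls. -/
theorem pow_sub_dvd_interL {k w e N p : ℕ} {q : F} {a b : List (List F)}
    {cs : List (List (List F))} (hp : 0 < p) (hn : 0 < N)
    (hs : (p : F) * s = 1) (h₁ : θ * ξ = 1) (hξ : ξ ^ N = 1)
    (hsum : ∀ r, r * p = N → ∀ i, 0 < i → i < p →
      ∑ j ∈ Finset.range p, ((θ ^ ((N - 1) * r)) ^ i) ^ j = 0)
    (hwL : p ^ k * w * p = N)
    (ha : a.length = p * p ^ k) (hb : b.length = p * p ^ k)
    (ha' : ∀ x ∈ a, x.length = N) (hb' : ∀ x ∈ b, x.length = N)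
    (g₁ : cs.length = p) (g₂ : ∀ c ∈ cs, c.length = p ^ k)
    (g₃ : ∀ c ∈ cs, ∀ x ∈ c, x.length = N)
    (g₄ : ∀ j < p, (X ^ p ^ k - C (θ ^ (p ^ k * (e + j * w)))) ∣
      polyY φ ξ (cs.getD j []) - C (φ (q * s)) *
        (polyY φ ξ (hornerR (p ^ k * (e + j * w)) (chunks p (p ^ k) a)) *
          polyY φ ξ (hornerR (p ^ k * (e + j * w)) (chunks p (p ^ k) b)))) :
    (X ^ p ^ (k + 1) - C (θ ^ (p ^ (k + 1) * e))) ∣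
      polyY φ ξ (interL ((N - 1) * (p ^ k * e)) ((N - 1) * (p ^ k * w)) cs p 0 0) -
        C (φ q) * (polyY φ ξ a * polyY φ ξ b) := by
  have hθ : θ ^ N = 1 := by
    have : (θ * ξ) ^ N = 1 := by rw [h₁, one_pow]
    rwa [mul_pow, hξ, mul_one] at this
  have hne : cs ≠ [] := by rintro rfl; simp at g₁; omega
  have e₁ : (X : K[X]) ^ p ^ (k + 1) - C (θ ^ (p ^ (k + 1) * e)) =
      (X ^ p ^ k) ^ p - C (θ ^ (p ^ k * e)) ^ p := by
    rw [← pow_mul, ← C_pow, ← pow_mul, pow_succ, mul_right_comm]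
  have e₂ : ∀ i A : ℕ, (C (θ ^ (0 + i * A)) : K[X]) = C (θ ^ A) ^ i := fun i A => by
    rw [zero_add, mul_comm, pow_mul, C_pow]
  rw [polyY_interL h₁ hξ g₂ hne g₃, g₁, e₁]
  simp only [e₂]
  -- Since `θ ^ N = 1`, the exponent factor `N - 1` inverts: `y` is the inverse of `z` and `η` that
  -- of `ζ`.
  have key := pow_sub_pow_dvd_interpolation (p := p)
    (W := (X : K[X]) ^ p ^ k)
    (z := C (θ ^ (p ^ k * e)))
    (y := C (θ ^ ((N - 1) * (p ^ k * e))))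
    (ζ := C (θ ^ (p ^ k * w)))
    (η := C (θ ^ ((N - 1) * (p ^ k * w))))
    (q := C (φ q)) (s := C (φ s)) (v := polyY φ ξ a * polyY φ ξ b)
    (c := fun j => polyY φ ξ (cs.getD j [])) ?_ ?_ ?_ ?_ ?_ ?_
  · exact key
  · rw [← C_mul, ← pow_add]
    have : (N - 1) * (p ^ k * e) + p ^ k * e =
        N * (p ^ k * e) := by
      rw [← Nat.succ_mul, Nat.succ_eq_add_one, Nat.sub_add_cancel hn]
    rw [this, pow_mul, hθ, one_pow, C_1]
  · rw [← C_mul, ← pow_add]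
    have : (N - 1) * (p ^ k * w) + p ^ k * w =
        N * (p ^ k * w) := by
      rw [← Nat.succ_mul, Nat.succ_eq_add_one, Nat.sub_add_cancel hn]
    rw [this, pow_mul, hθ, one_pow, C_1]
  · rw [← C_pow, ← pow_mul]
    have : (N - 1) * (p ^ k * w) * p =
        N * (N - 1) := by rw [mul_assoc, hwL, mul_comm]
    rw [this, pow_mul, hθ, one_pow, C_1]
  · intro i hi hip
    have := congrArg (C : K → K[X]) (hsum _ hwL i hi hip)
    rw [map_sum, C_0] at this
    rw [← this]
    exact Finset.sum_congr rfl fun j _ => by rw [← C_pow, ← C_pow]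
  · rw [show ((p : ℕ) : K[X]) = C (φ (p : F)) by simp, ← C_mul, ← map_mul, hs]
    simp
  · intro j hj
    have := g₄ j hj
    have hz : C (θ ^ (p ^ k * e)) *
        C (θ ^ (p ^ k * w)) ^ j =
        C (θ ^ (p ^ k * (e + j * w))) := by
      rw [← C_pow, ← C_mul, ← pow_mul, ← pow_add]
      congr 2
      ring
    rw [hz]
    -- Replacing `y ^ (p ^ k)` by the root of the factor in the block expansion of `f` gives exactly
    -- the Horner value.
    have hdvd : ∀ f : List (List F), f.length = p * p ^ k →
        (∀ x ∈ f, x.length = N) →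
        (X ^ p ^ k -
          C (θ ^ (p ^ k * (e + j * w)))) ∣
        polyY φ ξ f - polyY φ ξ (hornerR (p ^ k * (e + j * w))
          (chunks p (p ^ k) f)) := by
      intro f hf hf'
      rw [polyY_hornerR h₁ hξ (fun _ h x hx => hf' x (mem_of_mem_chunks h hx))]
      nth_rw 1 [← flatten_chunks hf]
      rw [polyY_flatten φ ξ (fun _ => length_of_mem_chunks hf)]
      exact dvd_sum_pow_sub _ _ _ _
    obtain ⟨u₁, hu₁⟩ := this
    obtain ⟨u₂, hu₂⟩ := hdvd a ha ha'
    obtain ⟨u₃, hu₃⟩ := hdvd b hb hb'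
    rw [sub_eq_iff_eq_add] at hu₁ hu₂ hu₃
    rw [hu₁]
    rw [hu₂, hu₃, map_mul, C_mul]
    generalize polyY φ ξ (hornerR _ (chunks _ _ a)) = A
    generalize polyY φ ξ (hornerR _ (chunks _ _ b)) = B
    refine ⟨u₁ - C (φ q) * C (φ s) * (u₂ * B + A * u₃ +
      (X ^ p ^ k -
        C (θ ^ (p ^ k * (e + j * w)))) * u₂ * u₃), ?_⟩
    ring

theorem pmulSpec (hM : MulSpec h p s n.length M) (hp : 0 < p.length) (hn : 0 < n.length)
    (hs : (p.length : F) * s = 1) (h₁ : θ * ξ = 1) (hξ : ξ ^ n.length = 1)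
    (hsum : ∀ r, r * p.length = n.length → ∀ i, 0 < i → i < p.length →
      ∑ j ∈ Finset.range p.length, ((θ ^ ((n.length - 1) * r)) ^ i) ^ j = 0)
    (k : List (Val F)) : PmulSpec φ ξ θ h p s n M k := by
  induction k with
  | nil => exact pmulSpec_nil hM hξ
  | cons x k ih =>
    intro e w q a b hw ha hb ha' hb'
    simp only [List.length_cons, pow_succ'] at ha hb
    rw [List.length_cons] at hw
    have hwL : p.length ^ k.length * w.length * p.length = n.length := by rw [← hw]; ring
    obtain ⟨cs, g₁, g₂, g₃, g₄, g₅⟩ := exists_computes_fwd (q := q * s) (l := upow .nil p k.length)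
      hp ih (by simp) hw (length_chunks p.length (p.length ^ k.length) a)
      (length_chunks p.length (p.length ^ k.length) b) (fun _ => length_of_mem_chunks ha)
      (fun _ => length_of_mem_chunks hb)
      (fun _ h x hx => ha' x (mem_of_mem_chunks h hx))
      (fun _ h x hx => hb' x (mem_of_mem_chunks h hx)) p e
    have hne : cs ≠ [] := by rintro rfl; simp at g₁; omega
    have hpow : p.length ^ (x :: k).length = p.length * p.length ^ k.length := by
      simp [pow_succ']
    have hin := computes_inter (cnt := p) (g := []) (h := [])
      (dg := rep (n.length - 1) (rep (p.length ^ k.length) e))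
      (dh := rep (n.length - 1) (rep (p.length ^ k.length) w)) g₂ g₃
    refine ⟨_, ?_, ?_, ?_, (?_ : Computes _ _ _ (.polys (interL
      ((n.length - 1) * (p.length ^ k.length * e.length))
      ((n.length - 1) * (p.length ^ k.length * w.length)) cs p.length 0 0)) _)⟩
    · rw [length_interL g₂ hne, hpow]
    · exact length_of_mem_interL g₃
    · rw [hpow, ← pow_succ']
      rw [length_upow] at g₄
      exact pow_sub_dvd_interL hp hn hs h₁ hξ hsum hwL ha hb ha' hb' g₁ g₂ g₃ g₄
    · have h₀ : n = n.head (by rintro rfl; simp at hn) :: n.tail := by simp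
      obtain ⟨y, n, rfl⟩ : ∃ y t, n = y :: t := ⟨_, _, h₀⟩
      unfold pmulCtx at g₅
      rw [Computes, wpCall_solver Fn.pmul rfl]
      simp at g₅ hin
      simp [Body.pmul, pmulCtx]
      refine Computes.wpCall g₅ fun c₁ hc₁ => ?_
      refine Computes.wpCall hin fun c₂ hc₂ => ?_
      simp [pmulCost]
      rw [g₁] at hc₂
      omega

end Pmul

/-! ### Multiplication of polynomials -/

section Recomb

variable {F : Type*} [Field F] {Q : Val F → ℕ → Prop}

/-- Reduction modulo `1 + x ^ r + ... + x ^ ((p - 1) * r)`. -/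
def redL (p r : ℕ) (c : List F) : List F :=
  addL c (smulL (0 - 1) (rep p (c.drop ((p - 1) * r))))

/-- The sum of the reduced polynomials of a list with successive shifts by `s`. -/
def recombL (p r s : ℕ) : List (List F) → List F
  | [] => []
  | c :: cs => addL (redL p r c) (padL s [] ++ recombL p r s cs)

theorem length_redL {p r : ℕ} {c : List F} (hp : 0 < p) (hc : c.length = p * r) :
    (redL p r c).length = c.length := by
  obtain ⟨p, rfl⟩ := Nat.exists_eq_succ_of_ne_zero hp.ne'
  rw [Nat.succ_mul] at hc
  simp [redL, hc, Nat.succ_mul]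

theorem computes_recomb {x : Val F} {p r s : List (Val F)} {cs : List (List F)} {n : ℕ}
    (hn : n = (x :: p).length * r.length) (hc : ∀ c ∈ cs, c.length = n) :
    Computes solver Fn.recomb (.pair (.ofList (x :: p)) (.pair (.ofList r) (.pair (.ofList s)
      (.polys cs)))) (.poly (recombL (x :: p).length r.length s.length cs))
      (cs.length * (3 * n + 1)) := by
  rw [Computes]
  induction cs with
  | nil => rw [wpCall_solver Fn.recomb rfl]; simp [Body.recomb, recombL]
  | cons c cs ih =>
    simp only [List.mem_cons, forall_eq_or_imp] at hc
    have hl := length_redL (by simp) (hc.1.trans hn)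
    have hrep := fun Q l => wpCall_rep_poly (Q := Q) (x :: p) l
    rw [wpCall_solver Fn.recomb rfl]
    simp only [Val.ofList_cons] at ih hrep ⊢
    simp [Body.recomb, hrep]
    refine Computes.wpCall (ih hc.2) fun c₁ h₁ => ?_
    have e₁ : p.length * r.length + r.length = n := by rw [hn, List.length_cons, Nat.succ_mul]
    have e₂ : n - p.length * r.length = r.length := by omega
    have e₃ : (cs.length + 1) * (3 * n + 1) = cs.length * (3 * n + 1) + (3 * n + 1) :=
      Nat.succ_mul _ _
    have e₄ : (p.length + 1) * r.length = n := hn.symm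
    rw [hc.1, redL] at hl
    simp only [redL, recombL, List.length_cons, Nat.add_sub_cancel] at hl ⊢
    simp [hc.1, e₂, e₃, e₄] at hl ⊢
    omega

theorem polyOf_rep (p : ℕ) (l : List F) :
    polyOf (rep p l) = (∑ i ∈ Finset.range p, (X ^ l.length) ^ i) * polyOf l := by
  induction p with
  | zero => simp
  | succ p ih =>
    rw [rep_succ, polyOf_append, ih, Finset.sum_range_succ']
    simp only [pow_succ, ← Finset.sum_mul]
    ring

/-- The list of `p` copies of the top block represents `1 + X ^ r + ... + X ^ ((p - 1) * r)` times
that block; subtracting it stays in the same residue class. -/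
theorem polyOf_redL {p r : ℕ} {c : List F} (hp : 0 < p) (hc : c.length = p * r) :
    polyOf (redL p r c) = polyOf c -
      (∑ i ∈ Finset.range p, (X ^ r) ^ i) * polyOf (c.drop ((p - 1) * r)) := by
  have : p * r - (p - 1) * r = r := by
    rw [← Nat.sub_mul, Nat.sub_sub_self hp, Nat.succ_eq_add_one, zero_add, one_mul]
  simp [redL, polyOf_rep, hc, this]
  ring

/-- The last copy cancels the top block of `c`, and all other copies end below degree `(p - 1) * r`.
So `redL` gives the reduced representative. -/
theorem coeff_polyOf_redL {p r : ℕ} {c : List F} (hp : 0 < p) (hc : c.length = p * r) {i : ℕ}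
    (hi : (p - 1) * r ≤ i) : (polyOf (redL p r c)).coeff i = 0 := by
  obtain ⟨p, rfl⟩ := Nat.exists_eq_succ_of_ne_zero hp.ne'
  simp only [Nat.succ_eq_add_one, Nat.add_sub_cancel] at hi
  have e : polyOf c = polyOf (c.take (p * r)) + X ^ (p * r) * polyOf (c.drop (p * r)) := by
    conv_lhs => rw [← List.take_append_drop (p * r) c, polyOf_append]
    rw [List.length_take, hc, min_eq_left (Nat.mul_le_mul_right _ (Nat.le_succ _))]
  have hl : (c.drop (p * r)).length = r := by simp [hc, Nat.succ_mul]
  rw [polyOf_redL hp hc, Nat.succ_eq_add_one, Nat.add_sub_cancel, e, Finset.sum_range_succ, add_mul,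
    ← pow_mul X, mul_comm r, add_sub_add_right_eq_sub, coeff_sub, Finset.sum_mul,
    finsetSum_coeff, coeff_polyOf_of_le (by simp [hi]), zero_sub, neg_eq_zero]
  refine Finset.sum_eq_zero fun j hj => ?_
  rw [← pow_mul, coeff_X_pow_mul', ]
  have h₁ : (j + 1) * r ≤ p * r := Nat.mul_le_mul_right _ (Finset.mem_range.1 hj)
  rw [Nat.succ_mul, mul_comm] at h₁
  rw [if_pos (by omega), coeff_polyOf_of_le (by omega)]

/-- Recombination undoes the division into rows: it substitutes `y = X ^ s`. -/
theorem polyOf_recombL (p r s : ℕ) (cs : List (List F)) :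
    polyOf (recombL p r s cs) = (polyY C X (cs.map (redL p r))).eval (X ^ s) := by
  induction cs with
  | nil => simp [recombL]
  | cons c cs ih => simp [recombL, polyOf_append, ih, eval₂_C_X]

@[simp] theorem length_rowsL (s n c : ℕ) (l : List F) : (rowsL s n c l).length = c := by
  induction c generalizing l with
  | zero => rfl
  | succ c ih => simp [rowsL, ih]

theorem length_of_mem_rowsL {s n c : ℕ} {l : List F} : ∀ x ∈ rowsL s n c l, x.length = n := by
  induction c generalizing l with
  | zero => simp [rowsL]
  | succ c ih => simpa [rowsL] using ih

theorem polyOf_padL_take {s n : ℕ} (hs : s ≤ n) (l : List F) :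
    polyOf (padL n (l.take s)) = polyOf (l.take s) :=
  polyOf_padL ((degree_polyOf_lt _).trans_le (by
    exact_mod_cast (List.length_take_le s l).trans hs))

theorem eval_polyY_rowsL {s n c : ℕ} (hs : s ≤ n) {l : List F} (hl : l.length ≤ c * s) :
    (polyY C X (rowsL s n c l)).eval (X ^ s) = polyOf l := by
  induction c generalizing l with
  | zero =>
    obtain rfl := List.length_eq_zero_iff.1 (by omega : l.length = 0)
    simp [rowsL]
  | succ c ih =>
    rw [Nat.succ_mul] at hl
    simp only [rowsL, polyY_cons, eval_add, eval_C, eval_mul, eval_X, eval₂_C_X]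
    rw [ih (by simp; omega), polyOf_padL_take hs]
    conv_rhs => rw [← List.take_append_drop s l, polyOf_append]
    rcases le_or_gt s l.length with h | h
    · rw [List.length_take, min_eq_left h]
    · rw [List.drop_eq_nil_of_le h.le]
      simp

theorem coeff_polyY_rowsL {s n c : ℕ} (hs : s ≤ n) {l : List F} (i : ℕ) :
    ((polyY C X (rowsL s n c l)).coeff i).degree < s ∧
      (l.length ≤ i * s → (polyY C X (rowsL s n c l)).coeff i = 0) := by
  induction c generalizing l i with
  | zero => simp [rowsL, bot_lt_iff_ne_bot]
  | succ c ih =>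
    cases i with
    | zero =>
      simp only [rowsL, polyY_cons, coeff_add, coeff_C_zero, eval₂_C_X, mul_coeff_zero,
        coeff_X_zero, zero_mul, add_zero]
      rw [polyOf_padL_take hs]
      refine ⟨(degree_polyOf_lt _).trans_le (by exact_mod_cast List.length_take_le s l), ?_⟩
      intro h
      obtain rfl := List.length_eq_zero_iff.1 (by omega : l.length = 0)
      simp
    | succ i =>
      simp only [rowsL, polyY_cons, coeff_add, coeff_C_succ, zero_add, coeff_X_mul]
      refine ⟨(ih i).1, fun h => (ih i).2 ?_⟩
      rw [Nat.succ_mul] at h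
      simp; omega

theorem map_polyY {K L : Type*} [CommRing K] [CommRing L] (φ : F →+* K) (ξ : K) (ψ : K →+* L)
    (a : List (List F)) : (polyY φ ξ a).map ψ = polyY (ψ.comp φ) (ψ ξ) a := by
  induction a with
  | nil => simp
  | cons x a ih =>
    rw [polyY_cons, polyY_cons, Polynomial.map_add, Polynomial.map_mul, map_C, map_X, ih,
      hom_eval₂]

theorem degree_mul_lt_of_degree_lt {R : Type*} [CommRing R] {f g : R[X]} {a b : ℕ}
    (hf : f.degree < a) (hg : g.degree < b) : (f * g).degree < (a + b : ℕ) := by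
  rw [degree_lt_iff_coeff_zero] at *
  intro m hm
  rw [coeff_mul]
  refine Finset.sum_eq_zero fun x hx => ?_
  have hx := Finset.HasAntidiagonal.mem_antidiagonal.1 hx
  rcases le_or_gt a x.1 with h | h
  · rw [hf _ h, zero_mul]
  · rw [hg _ (by omega), mul_zero]

/-- The bivariate product modulo `1 + x ^ r + ... + x ^ ((p - 1) * r)` and `y ^ N - 1` determines
the product of two polynomials. -/
theorem polyOf_recombL_eq {p r s N : ℕ} {a b : List F} {c : List (List F)} (hp : 2 ≤ p)
    (hs : 0 < s) (hr : r = p * s) (hN : N = p * r) (ha : a.length ≤ r * s) (hb : b.length ≤ r * s)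
    (hc : c.length = N) (hc' : ∀ x ∈ c, x.length = N)
    (h : (X ^ N - 1 : (AdjoinRoot (∑ i ∈ Finset.range p, (X ^ r) ^ i : F[X]))[X]) ∣
      polyY (AdjoinRoot.of (∑ i ∈ Finset.range p, (X ^ r) ^ i : F[X])) (AdjoinRoot.root _) c -
        polyY (AdjoinRoot.of _) (AdjoinRoot.root _) (rowsL s N N a) *
          polyY (AdjoinRoot.of _) (AdjoinRoot.root _) (rowsL s N N b)) :
    polyOf (recombL p r s c) = polyOf a * polyOf b := by
  set Φ : F[X] := ∑ i ∈ Finset.range p, (X ^ r) ^ i with hΦ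
  have hr0 : 0 < r := by subst hr; positivity
  have h2r : r + r ≤ N := by rw [hN]; nlinarith
  have hsr : s ≤ r := by rw [hr]; nlinarith
  have hsN : s ≤ N := by omega
  have hNs : r * s ≤ N * s := Nat.mul_le_mul_right _ (by omega)
  rw [polyOf_recombL, ← eval_polyY_rowsL hsN (ha.trans hNs), ← eval_polyY_rowsL hsN (hb.trans hNs),
    ← eval_mul]
  congr 1
  have hmap : ∀ d : List (List F), polyY (AdjoinRoot.of Φ) (AdjoinRoot.root Φ) d =
      (polyY C X d).map (AdjoinRoot.mk Φ) := fun d => by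
    rw [map_polyY]
    rfl
  have hdeg : ∀ l : List F, l.length ≤ r * s → (polyY C X (rowsL s N N l)).degree < r := by
    intro l hl
    rw [degree_lt_iff_coeff_zero]
    exact fun i hi => (coeff_polyY_rowsL hsN i).2 (hl.trans (Nat.mul_le_mul_right _ hi))
  set A := polyY C X (rowsL s N N a)
  set B := polyY C X (rowsL s N N b)
  have hABd : (A * B).degree < N := (degree_mul_lt_of_degree_lt (hdeg a ha) (hdeg b hb)).trans_le
    (by exact_mod_cast h2r)
  rw [hmap, hmap, hmap, ← Polynomial.map_mul, ← Polynomial.map_sub] at h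
  -- Both `c` and `A * B` have `y`-degree below `N`, so divisibility of the difference by the monic
  -- `y ^ N - 1` forces it to vanish modulo `Φ`.
  have hz : (polyY C X c - A * B).map (AdjoinRoot.mk Φ) = 0 := by
    by_contra hne
    -- In the zero ring the claim is trivial; the degree argument needs a nontrivial ring.
    rcases subsingleton_or_nontrivial (AdjoinRoot Φ) with hK | hK
    · exact hne (Subsingleton.elim _ _)
    have hN0 : N ≠ 0 := by omega
    refine (monic_X_pow_sub_C (1 : AdjoinRoot Φ) hN0).not_dvd_of_degree_lt hne ?_ (by simpa using h)
    rw [degree_X_pow_sub_C (by omega)]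
    refine degree_map_le.trans_lt ((degree_sub_le _ _).trans_lt (max_lt ?_ hABd))
    rw [degree_lt_iff_coeff_zero]
    intro i hi
    rw [coeff_polyY, List.getD_eq_default _ _ (by omega)]
    simp
  have hΦd : Φ.degree = ((p - 1) * r : ℕ) := by
    have h1 : Φ = X ^ ((p - 1) * r) + ∑ i ∈ Finset.range (p - 1), (X ^ r) ^ i := by
      rw [hΦ]
      conv_lhs => rw [show p = p - 1 + 1 by omega, Finset.sum_range_succ, ← pow_mul, mul_comm r,
        add_comm]
    rw [h1, degree_add_eq_left_of_degree_lt, degree_X_pow]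
    rw [degree_X_pow]
    refine (degree_sum_le _ _).trans_lt ((Finset.sup_lt_iff ?_).2 ?_)
    · exact WithBot.bot_lt_coe _
    · intro i hi
      rw [← pow_mul, degree_X_pow, mul_comm]
      exact_mod_cast Nat.mul_lt_mul_of_pos_right (Finset.mem_range.1 hi) hr0
  have hp0 : 0 < p := by omega
  rw [← sub_eq_zero]
  ext1 i
  rw [coeff_zero]
  have hdvd : Φ ∣ (polyY C X (c.map (redL p r)) - A * B).coeff i := by
    have h1 := congrArg (coeff · i) hz
    simp only [coeff_map, coeff_zero, AdjoinRoot.mk_eq_zero] at h1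
    rw [coeff_sub, coeff_polyY, eval₂_C_X] at h1 ⊢
    rcases lt_or_ge i c.length with hi | hi
    · have hlen := (hc' _ (List.getElem_mem hi)).trans hN
      rw [List.getD_eq_getElem _ _ (by simpa using hi), List.getElem_map,
        polyOf_redL hp0 hlen]
      rw [List.getD_eq_getElem _ _ hi] at h1
      rw [sub_right_comm]
      exact dvd_sub h1 (dvd_mul_right _ _)
    · rw [List.getD_eq_default _ _ (by simpa using hi)]
      rwa [List.getD_eq_default _ _ hi] at h1
  -- Each coefficient of the difference is a multiple of `Φ` of smaller degree: reduced rows end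
  -- below `(p - 1) * r`, and coefficients of the product have degree below `2 * s`.
  refine eq_zero_of_dvd_of_degree_lt hdvd ?_
  rw [hΦd, coeff_sub]
  refine (degree_sub_le _ _).trans_lt (max_lt ?_ ?_)
  · rw [coeff_polyY, eval₂_C_X, degree_lt_iff_coeff_zero]
    intro m hm
    rcases lt_or_ge i c.length with hi | hi
    · rw [List.getD_eq_getElem _ _ (by simpa using hi), List.getElem_map]
      exact coeff_polyOf_redL hp0 ((hc' _ (List.getElem_mem hi)).trans hN) hm
    · rw [List.getD_eq_default _ _ (by simpa using hi)]
      simp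
  · rw [coeff_mul]
    refine (degree_sum_le _ _).trans_lt ((Finset.sup_lt_iff (WithBot.bot_lt_coe _)).2 ?_)
    intro x _
    refine (degree_mul_lt_of_degree_lt (coeff_polyY_rowsL hsN x.1).1
      (coeff_polyY_rowsL hsN x.2).1).trans_le ?_
    -- Equality for `p = 2`. This is why rows have length `r / p`.
    have : s + s ≤ (p - 1) * r := by
      obtain ⟨q, rfl⟩ := Nat.exists_eq_add_of_le hp
      rw [hr, show 2 + q - 1 = q + 1 by omega]
      nlinarith [Nat.zero_le (q * q * s), Nat.zero_le (q * s)]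
    exact_mod_cast this

end Recomb
-- Correctness of the recursive multiplication.
section Mul

variable {F : Type*} [Field F] {Q : Val F → ℕ → Prop}

/-- The cost of `mulK`. -/
def mulCost (p : ℕ) : ℕ → ℕ
  | 0 => 2 * p ^ 8
  | k + 1 => pmulCost p (p ^ ((k + 1) / 2 + 4)) (mulCost p ((k + 1) / 2)) ((k + 1) / 2 + 4) +
      p ^ ((k + 1) / 2 + 4) * (3 * p ^ ((k + 1) / 2 + 4) + 1)
  decreasing_by all_goals omega

@[simp ↓] theorem wpCall_pad_poly (n l : List F) :
    wpCall solver Fn.pad (.pair (.poly n) (.poly l)) Q ↔ Q (.poly (padL n.length l)) 0 := by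
  have := wpCall_pad (Q := Q) (n.map Val.elem) l
  rwa [List.length_map] at this

theorem degree_polyOf_mul_lt (a b : List F) :
    (polyOf a * polyOf b).degree < (a.length + b.length : ℕ) :=
  degree_mul_lt_of_degree_lt (degree_polyOf_lt a) (degree_polyOf_lt b)

theorem mulSpec_nil (p : List (Val F)) (s : F) :
    MulSpec [] p s (p.length ^ 4) (mulCost p.length 0) := by
  intro a b ha hb
  refine ⟨padL (a.length + b.length) (naiveL a b), by simp, ?_, ?_⟩
  · rw [polyOf_padL, polyOf_naiveL]
    rw [polyOf_naiveL]
    exact degree_polyOf_mul_lt a b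
  · rw [Computes, wpCall_solver Fn.mulK rfl]
    simp [Body.mulK]
    refine Computes.wpCall (computes_naive a b) fun c hc => ?_
    simp [mulCost]
    calc c ≤ a.length * (2 * b.length) := hc
      _ ≤ p.length ^ 4 * (2 * p.length ^ 4) := by gcongr
      _ = 2 * p.length ^ 8 := by ring

/-- The cyclic shift in the quotient by `1 + x ^ r + ... + x ^ ((p - 1) * r)`. -/
theorem root_pow_eq_one (p r : ℕ) :
    (AdjoinRoot.root (∑ i ∈ Finset.range p, (X ^ r) ^ i : F[X])) ^ (p * r) = 1 := by
  have h := geom_sum_mul (X ^ r : F[X]) p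
  have h' := congrArg (AdjoinRoot.mk (∑ i ∈ Finset.range p, (X ^ r) ^ i : F[X])) h
  rw [map_mul, AdjoinRoot.mk_self, zero_mul, map_sub, map_one, ← pow_mul, map_pow,
    AdjoinRoot.mk_X, mul_comm r] at h'
  exact (sub_eq_zero.1 h'.symm)

/-- The two inversions cancel, so the base is `ξ ^ r`, a root of `1 + t + ... + t ^ (p - 1)`. The
quotient ring may have zero divisors, so orthogonality is checked for each `i`; with `p ≤ 3` only `i
= 2`, `p = 3` needs more than this relation. -/
theorem sum_root_pow_eq_zero {p r N : ℕ} (hp : p = 2 ∨ p = 3) (hN : N = p * r) (hN0 : 0 < N)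
    {i : ℕ} (hi : 0 < i) (hip : i < p) :
    ∑ j ∈ Finset.range p, ((((AdjoinRoot.root (∑ i ∈ Finset.range p, (X ^ r) ^ i : F[X])) ^
      (N - 1)) ^ ((N - 1) * r)) ^ i) ^ j = 0 := by
  have h₁ := root_pow_eq_one (F := F) p r
  have h₂ : ∑ i ∈ Finset.range p,
      ((AdjoinRoot.root (∑ i ∈ Finset.range p, (X ^ r) ^ i : F[X])) ^ r) ^ i = 0 := by
    have := AdjoinRoot.mk_self (f := (∑ i ∈ Finset.range p, (X ^ r) ^ i : F[X]))
    simpa [map_sum] using this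
  generalize AdjoinRoot.root (∑ i ∈ Finset.range p, (X ^ r) ^ i : F[X]) = ξ at h₁ h₂ ⊢
  rw [← hN] at h₁
  have h₃ : (ξ ^ (N - 1)) ^ ((N - 1) * r) = ξ ^ r := by
    obtain ⟨n, rfl⟩ := Nat.exists_eq_succ_of_ne_zero hN0.ne'
    rw [Nat.succ_eq_add_one] at *
    rw [Nat.add_sub_cancel, ← pow_mul]
    have : ξ ^ (n * (n * r)) * ξ ^ ((n + 1) * r) = ξ ^ r * (ξ ^ (n + 1)) ^ (n * r) := by
      rw [← pow_add, ← pow_mul, ← pow_add]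
      congr 1
      ring
    rwa [pow_mul ξ (n + 1) r, h₁, one_pow, one_pow, mul_one, mul_one] at this
  rw [h₃]
  have h₄ : (ξ ^ r) ^ p = 1 := by rw [← pow_mul, mul_comm, ← hN, h₁]
  generalize ξ ^ r = η at *
  rcases hp with rfl | rfl
  · obtain rfl : i = 1 := by omega
    simpa using h₂
  · obtain rfl | rfl : i = 1 ∨ i = 2 := by omega
    · simpa using h₂
    · simp only [Finset.sum_range_succ, Finset.sum_range_zero] at h₂ ⊢
      linear_combination h₂ + η * h₄

/-- With `h = k / 2` the sizes are `s = p ^ (h + 2)`, `r = p ^ (h + 3)` and `N = p ^ (h + 4)`, so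
the leaf products again have the form treated at level `h`. The offset 4 leaves room for padding
while `h < k` makes the recursion end. -/
theorem mulSpec {x y : Val F} {p : List (Val F)} {s : F}
    (hp : (x :: y :: p).length = 2 ∨ (x :: y :: p).length = 3)
    (hs : ((x :: y :: p).length : F) * s = 1) (k : List (Val F)) :
    MulSpec k (x :: y :: p) s ((x :: y :: p).length ^ (k.length + 4))
      (mulCost (x :: y :: p).length k.length) := by
  induction hk : k.length using Nat.strong_induction_on generalizing k with
  | _ _ ih =>
    subst hk
    cases k with
    | nil => exact mulSpec_nil _ s
    | cons z k =>
      generalize hP : x :: y :: p = P at *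
      have hP2 : 2 ≤ P.length := by omega
      set h := (z :: k).length / 2 with hh
      have hhk : h < (z :: k).length := Nat.div_lt_self (by simp) (by norm_num)
      set H : List (Val F) := List.replicate h .nil with hH
      have hHl : H.length = h := by simp [hH]
      set S : List (Val F) := upow .nil P (h + 2) with hS
      set R := rep P.length S with hR
      set N := rep P.length R with hN
      have hSl : S.length = P.length ^ (h + 2) := by simp [hS]
      have hRl : R.length = P.length * S.length := by simp [hR]
      have hNl : N.length = P.length * R.length := by simp [hN]
      have hS0 : 0 < S.length := by rw [hSl]; positivity
      have hR0 : 0 < R.length := by rw [hRl]; positivity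
      have hN0 : 0 < N.length := by rw [hNl]; positivity
      have hNp : N.length = P.length ^ (h + 4) := by rw [hNl, hRl, hSl]; ring
      intro a b ha hb
      have hM : MulSpec H P s N.length (mulCost P.length h) := by
        rw [hNp]
        exact ih h hhk H hHl
      -- The capacity `r * s = p ^ (2 * h + 5)` suffices because `k ≤ 2 * h + 1`, where `k` is the
      -- length of the whole list.
      have hle : P.length ^ ((z :: k).length + 4) ≤ R.length * S.length := by
        rw [hRl, hSl, show P.length * P.length ^ (h + 2) * P.length ^ (h + 2) =
          P.length ^ (2 * h + 5) by ring]
        exact Nat.pow_le_pow_right (by omega) (by omega)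
      have hξ := root_pow_eq_one (F := F) P.length R.length
      rw [← hNl] at hξ
      have hθ : AdjoinRoot.root (∑ i ∈ Finset.range P.length, (X ^ R.length) ^ i : F[X]) ^
          (N.length - 1) * AdjoinRoot.root _ = 1 := by
        rw [← pow_succ, Nat.sub_add_cancel hN0, hξ]
      -- At the top level `e = 0`, `w = 1` and `q = 1`, so the modulus is `y ^ N - 1`.
      obtain ⟨c, g₁, g₂, g₃, g₄⟩ := pmulSpec (φ := AdjoinRoot.of _) hM (by omega) hN0 hs hθ hξ
        (fun r hr i hi hip => by
          have hr : r = R.length := by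
            rw [hNl, mul_comm] at hr
            exact Nat.eq_of_mul_eq_mul_left (by omega) hr
          rw [hr]
          exact sum_root_pow_eq_zero hp hNl hN0 hi hip)
        (.nil :: .nil :: .nil :: .nil :: H) [] [.nil] 1
        (rowsL S.length N.length N.length a) (rowsL S.length N.length N.length b)
        (by simp [hNp, hHl]) (by simp [hNp, hHl]) (by simp [hNp, hHl])
        length_of_mem_rowsL length_of_mem_rowsL
      have hHl' : (Val.nil :: Val.nil :: Val.nil :: Val.nil :: H).length = h + 4 := by simp [hHl]
      rw [hHl', ← hNp] at g₁ g₃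
      have hrec := computes_recomb (x := x) (p := y :: p) (r := R) (s := S) (cs := c)
        (n := N.length) (by rw [hP, hNl]) g₂
      rw [hP, g₁] at hrec
      rw [hHl'] at g₄
      refine ⟨padL (a.length + b.length) (recombL P.length R.length S.length c), by simp, ?_, ?_⟩
      · have := polyOf_recombL_eq hP2 hS0 hRl hNl (ha.trans hle) (hb.trans hle) g₁ g₂
          (by simpa using g₃)
        rw [polyOf_padL, this]
        rw [this]
        exact degree_polyOf_mul_lt a b
      · have hhalf := fun Q => wpCall_half (Q := Q) (z :: k)
        have hpow := fun Q => wpCall_pow (Q := Q) (.nil :: .nil :: H) P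
        rw [← hh] at hhalf
        simp only [Val.ofList_cons, Val.ofNat, ← hH, List.length_cons, hHl] at hhalf hpow
        rw [← hS] at hpow
        simp only [pmulCtx, Val.ofList_cons, Val.ofList_nil] at g₄
        change Computes _ _ _ (.poly (padL (a.length + b.length) _)) _
        rw [Computes, wpCall_solver Fn.mulK rfl]
        simp [Body.mulK, hhalf, hpow]
        rw [← hR, ← hN, ← hRl, ← hNl]
        refine Computes.wpCall g₄ fun c₁ h₁ => ?_
        refine Computes.wpCall hrec fun c₂ h₂ => ?_
        simp
        rw [mulCost]
        simp only [List.length_cons] at hh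
        rw [← hh, ← hNp]
        omega

end Mul
-- The cost of multiplication is quasi-linear.
section MulCost

theorem pmulCost_le {p : ℕ} (hp : 0 < p) (n M k : ℕ) :
    pmulCost p n M k ≤ p ^ k * (M + 2 * n + k * (1 + 3 * p * n)) := by
  induction k with
  | zero => simp [pmulCost]
  | succ k ih =>
    rw [pmulCost]
    have h₁ : 1 ≤ p ^ (k + 1) := Nat.one_le_pow _ _ hp
    calc 1 + p * (pmulCost p n M k + 2 * (p * (p ^ k * n))) + p * (p * (p ^ k * n))
        ≤ p ^ (k + 1) + p * (p ^ k * (M + 2 * n + k * (1 + 3 * p * n)) +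
          2 * (p * (p ^ k * n))) + p * (p * (p ^ k * n)) := by gcongr
      _ = p ^ (k + 1) * (M + 2 * n + (k + 1) * (1 + 3 * p * n)) := by ring

/-- Each halving of the exponent loses a constant factor of at most `3 ^ 4 = 81` through padding.
The power 12 absorbs it: the depth parameter shrinks by a factor `2 / 3`, and `81 * (2 / 3) ^ 12 <
1`. -/
theorem mulCost_le {p : ℕ} (hp : 0 < p) (hp3 : p ≤ 3) (k : ℕ) :
    mulCost p k ≤ 200 * (p ^ (k + 4) * (k + 1) ^ 12) := by
  induction k using Nat.strong_induction_on with
  | _ k ih =>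
    have hp4 : p ^ 4 ≤ 81 := (Nat.pow_le_pow_left hp3 4).trans (by norm_num)
    cases k with
    | zero =>
      simp only [mulCost]
      calc 2 * p ^ 8 = 2 * p ^ 4 * p ^ 4 := by ring
        _ ≤ 2 * 81 * p ^ 4 := by gcongr
        _ ≤ 200 * (p ^ (0 + 4) * (0 + 1) ^ 12) := by simp; omega
    | succ k =>
      rw [mulCost]
      have ih := ih ((k + 1) / 2) (by omega)
      set h := (k + 1) / 2 with hh
      set n := p ^ (h + 4) with hn
      have hn1 : 1 ≤ n := Nat.one_le_pow _ _ hp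
      have h₁ : (3 * (h + 1)) ^ 12 ≤ (2 * (k + 2)) ^ 12 := Nat.pow_le_pow_left (by omega) 12
      rw [mul_pow, mul_pow] at h₁
      have h₂ : n * n ≤ 81 * p ^ (k + 1 + 4) := by
        calc n * n = p ^ 4 * p ^ (2 * h + 4) := by rw [hn]; ring
          _ ≤ 81 * p ^ (k + 1 + 4) := by
            gcongr
            omega
      have h₃ : h + 1 ≤ k + 2 := by omega
      have h₄ : 2 ^ 11 * (k + 2) ≤ (k + 2) ^ 12 := by
        rw [pow_succ (k + 2)]
        gcongr
        omega
      calc _ ≤ n * (200 * (n * (h + 1) ^ 12) + 2 * n + (h + 4) * (1 + 3 * 3 * n)) +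
            n * (3 * n + 1) := by
            refine Nat.add_le_add_right ((pmulCost_le hp _ _ _).trans ?_) _
            gcongr
        _ ≤ n * (200 * (n * (h + 1) ^ 12) + 2 * n + (h + 4) * (n + 3 * 3 * n)) +
            n * (3 * n + n) := by gcongr
        _ = n * n * (200 * (h + 1) ^ 12 + (10 * (h + 1) + 36)) := by ring
        _ ≤ 81 * p ^ (k + 1 + 4) * (200 * (h + 1) ^ 12 + (10 * (k + 2) + 36 * (k + 2))) := by
            gcongr
            omega
        _ = p ^ (k + 1 + 4) * (81 * (200 * (h + 1) ^ 12 + 46 * (k + 2))) := by ring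
        _ ≤ p ^ (k + 1 + 4) * (200 * (k + 2) ^ 12) := Nat.mul_le_mul_left _ (by omega)
        _ = 200 * (p ^ (k + 1 + 4) * (k + 1 + 1) ^ 12) := by ring

/-- The cost of the multiplication of two polynomials of total length `n`. -/
def mulBound (n : ℕ) : ℕ := 10 ^ 11 * ((n + 1) * Nat.log 2 (n + 2) ^ 12)

theorem mulBound_mono : Monotone mulBound := fun a b h => by
  unfold mulBound
  gcongr

/-- The summand 6 covers the operations of `mul` itself: forming `1 + 1`, testing it, and inverting
the radix. -/
theorem mulCost_clog_le {p : ℕ} (hp : 2 ≤ p) (hp3 : p ≤ 3) (n : ℕ) :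
    mulCost p (Nat.clog p n) + 6 ≤ mulBound n := by
  have h₁ : p ^ Nat.clog p n ≤ 3 * (n + 1) := by
    rcases Nat.lt_or_ge 1 n with h | h
    · have h₀ := Nat.pow_pred_clog_lt_self (b := p) (by omega) h
      have h₂ : 0 < Nat.clog p n := Nat.clog_pos (by omega) h
      obtain ⟨c, hc⟩ := Nat.exists_eq_succ_of_ne_zero h₂.ne'
      rw [hc] at h₀ ⊢
      rw [Nat.pred_succ] at h₀
      rw [pow_succ, mul_comm]
      exact Nat.mul_le_mul hp3 (by omega)
    · rw [Nat.clog_of_right_le_one h, pow_zero]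
      omega
  have h₂ : Nat.clog p n ≤ Nat.log 2 (n + 2) + 1 := by
    refine (Nat.clog_anti_left (by norm_num) hp).trans ?_
    refine (Nat.clog_le_iff_le_pow (by norm_num)).2 ?_
    have := Nat.lt_pow_succ_log_self (b := 2) (by norm_num) (n + 2)
    omega
  have h₃ : 1 ≤ Nat.log 2 (n + 2) := Nat.log_pos (by norm_num) (by omega)
  have h₄ : 1 ≤ Nat.log 2 (n + 2) ^ 12 := Nat.one_le_pow _ _ h₃
  calc mulCost p (Nat.clog p n) + 6
      ≤ 200 * (p ^ (Nat.clog p n + 4) * (Nat.clog p n + 1) ^ 12) + 6 := by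
        gcongr
        exact mulCost_le (by omega) hp3 _
    _ = 200 * (p ^ Nat.clog p n * p ^ 4 * (Nat.clog p n + 1) ^ 12) + 6 := by ring
    _ ≤ 200 * (3 * (n + 1) * 3 ^ 4 * (3 * Nat.log 2 (n + 2)) ^ 12) +
        6 * ((n + 1) * Nat.log 2 (n + 2) ^ 12) := by
        gcongr
        · omega
        · nlinarith
    _ = (200 * 3 * 3 ^ 4 * 3 ^ 12 + 6) * ((n + 1) * Nat.log 2 (n + 2) ^ 12) := by ring
    _ ≤ mulBound n := by
        rw [mulBound]
        gcongr
        norm_num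

variable {F : Type*} [Field F] {Q : Val F → ℕ → Prop}

@[simp ↓] theorem wpCall_clog_two (l : List F) :
    wpCall solver Fn.clog (.pair (.pair .nil (.pair .nil .nil)) (.poly l)) Q ↔
      Q (.ofNat (Nat.clog 2 l.length)) 0 := by
  have := wpCall_clog (Q := Q) .nil .nil [] (l.map Val.elem)
  rwa [List.length_map] at this

@[simp ↓] theorem wpCall_clog_three (l : List F) :
    wpCall solver Fn.clog (.pair (.pair .nil (.pair .nil (.pair .nil .nil))) (.poly l)) Q ↔
      Q (.ofNat (Nat.clog 3 l.length)) 0 := by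
  have := wpCall_clog (Q := Q) .nil .nil [.nil] (l.map Val.elem)
  rwa [List.length_map] at this

/-- The radix must be invertible: 2 serves outside characteristic 2, and in characteristic 2 one has
`1 + 1 + 1 = 1`. The recursion depth is taken from the total length of the factors. -/
theorem exists_computes_mul (a b : List F) : ∃ m : List F, m.length = a.length + b.length ∧
    polyOf m = polyOf a * polyOf b ∧
    Computes solver Fn.mul (.pair (.poly a) (.poly b)) (.poly m)
      (mulBound (a.length + b.length)) := by
  have hle : ∀ p, 2 ≤ p → a.length + b.length ≤ p ^ (Nat.clog p (a.length + b.length) + 4) :=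
    fun p hp => (Nat.le_pow_clog (by omega) _).trans (Nat.pow_le_pow_right (by omega) (by omega))
  by_cases h2 : (1 + 1 : F) = 0
  · have h3 : (1 + 1 + 1 : F) = 1 := by rw [h2, zero_add]
    have hle := hle 3 (by norm_num)
    obtain ⟨m, h₁, h₂, h₃⟩ := mulSpec (F := F) (x := .nil) (y := .nil) (p := [.nil])
      (s := (1 + 1 + 1)⁻¹) (Or.inr rfl) (by simp [h3]; linear_combination h2)
      (List.replicate (Nat.clog 3 (a.length + b.length)) .nil) a b
      (by simp; omega) (by simp; omega)
    refine ⟨m, h₁, h₂, ?_⟩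
    have hb := mulCost_clog_le (p := 3) (by norm_num) (by norm_num) (a.length + b.length)
    simp only [Val.ofList_cons, Val.ofList_nil, List.length_cons, List.length_nil,
      List.length_replicate, h2, zero_add] at h₃
    rw [Computes, wpCall_solver Fn.mul rfl]
    simp [Body.mul, h2, Val.ofNat] at h₃ ⊢
    refine Computes.wpCall h₃ fun c hc => ?_
    simp
    omega
  · have hle := hle 2 (by norm_num)
    obtain ⟨m, h₁, h₂, h₃⟩ := mulSpec (F := F) (x := .nil) (y := .nil) (p := [])
      (s := (1 + 1)⁻¹) (Or.inl rfl)
      (by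
        rw [show (([Val.nil, Val.nil] : List (Val F)).length : F) = 1 + 1 by norm_num]
        exact mul_inv_cancel₀ h2)
      (List.replicate (Nat.clog 2 (a.length + b.length)) .nil) a b
      (by simp; omega) (by simp; omega)
    refine ⟨m, h₁, h₂, ?_⟩
    have hb := mulCost_clog_le (p := 2) (by norm_num) (by norm_num) (a.length + b.length)
    simp only [Val.ofList_cons, Val.ofList_nil, List.length_cons, List.length_nil,
      List.length_replicate] at h₃
    rw [Computes, wpCall_solver Fn.mul rfl]
    simp [Body.mul, h2, Val.ofNat] at h₃ ⊢
    refine Computes.wpCall h₃ fun c hc => ?_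
    simp
    omega

end MulCost
/-! ### The triangular system -/

section Solve

variable {F : Type*} [Field F] {Q : Val F → ℕ → Prop}

/-- The polynomial `∑ i, Q i * f (g ^ i)`, with the coefficients of `f` scaled by the powers of
the entries of `gs`. -/
noncomputable def contribP (gs : List F) : List (List F) → List F → F[X]
  | [], _ => 0
  | q :: qs, f => polyOf q * polyOf f + contribP gs qs (List.zipWith (· * ·) f gs)

/-- The value at `g` of the polynomial of the `l`-th coefficients. -/
def kern (l : ℕ) (g : F) : List (List F) → F
  | [] => 0
  | q :: qs => q.getD l 0 + g * kern l g qs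

theorem getD_zipWith_mul (f g : List F) (j : ℕ) :
    (List.zipWith (· * ·) f g).getD j 0 = f.getD j 0 * g.getD j 0 := by
  induction f generalizing g j with
  | nil => simp
  | cons x f ih =>
    cases g with
    | nil => simp
    | cons y g =>
      cases j with
      | zero => simp
      | succ j => simpa using ih g j

/-- In the `i`-th summand `f_j` is scaled by the `i`-th power of `gs_j`; collecting these powers
gives the kernel at `gs_j`. -/
theorem coeff_contribP (gs : List F) (qs : List (List F)) (f : List F) (n : ℕ) :
    (contribP gs qs f).coeff n =
      ∑ j ∈ Finset.range (n + 1), f.getD j 0 * kern (n - j) (gs.getD j 0) qs := by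
  induction qs generalizing f with
  | nil => simp [contribP, kern]
  | cons q qs ih =>
    rw [contribP, coeff_add, ih, mul_comm (polyOf q), coeff_mul,
      Finset.Nat.sum_antidiagonal_eq_sum_range_succ_mk, ← Finset.sum_add_distrib]
    refine Finset.sum_congr rfl fun j _ => ?_
    rw [coeff_polyOf, coeff_polyOf, getD_zipWith_mul, kern]
    ring

theorem exists_computes_contrib {gs : List F} {qs : List (List F)} {f : List F} {n : ℕ}
    (h : ∀ q ∈ qs, q.length + f.length ≤ n) (hf : f.length ≤ n) :
    ∃ c : List F, c.length ≤ n ∧ polyOf c = contribP gs qs f ∧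
      Computes solver Fn.contrib (.pair (.polys qs) (.pair (.poly f) (.poly gs))) (.poly c)
        (qs.length * (mulBound n + 2 * n)) := by
  induction qs generalizing f with
  | nil =>
    refine ⟨[], by simp, by simp [contribP], ?_⟩
    rw [Computes, wpCall_solver Fn.contrib rfl]
    simp [Body.contrib]
  | cons q qs ih =>
    simp only [List.mem_cons, forall_eq_or_imp] at h
    have hl : (List.zipWith (· * ·) f gs).length ≤ f.length := by simp
    obtain ⟨m, h₁, h₂, h₃⟩ := exists_computes_mul q f
    obtain ⟨c, h₄, h₅, h₆⟩ := ih (f := List.zipWith (· * ·) f gs)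
      (fun q hq => by have := h.2 q hq; omega) (hl.trans hf)
    refine ⟨addL m c, by simp; omega, by simp [contribP, h₂, h₅], ?_⟩
    have hm := mulBound_mono h.1
    rw [Computes, wpCall_solver Fn.contrib rfl]
    simp [Body.contrib]
    refine Computes.wpCall h₃ fun c₁ hc₁ => ?_
    refine Computes.wpCall h₆ fun c₂ hc₂ => ?_
    simp
    rw [add_one_mul]
    omega

@[simp ↓] theorem wpCall_takeAll (n : List (Val F)) (qs : List (List F)) :
    wpCall solver Fn.takeAll (.pair (.ofList n) (.polys qs)) Q ↔
      Q (.polys (qs.map (·.take n.length))) 0 := by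
  induction qs generalizing Q with
  | nil => rw [wpCall_solver Fn.takeAll rfl]; simp [Body.takeAll]
  | cons q qs ih => rw [wpCall_solver Fn.takeAll rfl]; simp [Body.takeAll, ih]

/-- Within a block of size `n` only lags below `n` occur, so the `Q_i` may be truncated. This makes
the product cost depend on the block and not on `D`. -/
theorem kern_map_take {l n : ℕ} (h : l < n) (g : F) (qs : List (List F)) :
    kern l g (qs.map (·.take n)) = kern l g qs := by
  induction qs with
  | nil => rfl
  | cons q qs ih =>
    simp only [List.map_cons, kern, ih]
    simp [h]

/-- The cost of the solution of a triangular system of size `2 ^ k`. -/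
def solveCost (q : ℕ) : ℕ → ℕ
  | 0 => 2
  | k + 1 => 2 * solveCost q k + q * (mulBound (3 * 2 ^ k) + 6 * 2 ^ k) + 3 * 2 ^ k

theorem getD_drop (n : ℕ) (l : List F) (j : ℕ) : (l.drop n).getD j 0 = l.getD (n + j) 0 := by
  simp

theorem getD_take {n j : ℕ} (h : j < n) (l : List F) : (l.take n).getD j 0 = l.getD j 0 := by
  simp [h]

/-- Entry `j` depends only on earlier entries, through `∑ i < j, f_i * kern (j - i) (gs_i)`. Split
at `h = 2 ^ k`: the part of this sum over `i < h` is, for all `j` in the second half at once, a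
window of coefficients of `contribP`. It is added to `acc` before the second half is solved. -/
theorem exists_computes_solve (k : List (Val F)) (qs : List (List F)) (us ws gs acc : List F)
    (hw : ws.length ≤ 2 ^ k.length) :
    ∃ f : List F, f.length = ws.length ∧
      (∀ j < ws.length, f.getD j 0 = us.getD j 0 + ws.getD j 0 * (acc.getD j 0 +
        ∑ i ∈ Finset.range j, f.getD i 0 * kern (j - i) (gs.getD i 0) qs)) ∧
      Computes solver Fn.solve (.pair (.ofList k) (.pair (.polys qs) (.pair (.poly us)
        (.pair (.poly ws) (.pair (.poly gs) (.poly acc)))))) (.poly f)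
        (solveCost qs.length k.length) := by
  induction k generalizing us ws gs acc with
  | nil =>
    match ws, hw with
    | [], _ =>
      refine ⟨[], rfl, by simp, ?_⟩
      rw [Computes, wpCall_solver Fn.solve rfl]
      simp [Body.solve]
    | [w], _ =>
      refine ⟨[us.getD 0 0 + w * acc.getD 0 0], rfl, ?_, ?_⟩
      · intro j hj
        obtain rfl : j = 0 := by simpa using hj
        simp
      · rw [Computes, wpCall_solver Fn.solve rfl]
        cases us <;> cases acc <;> simp [Body.solve, solveCost]
  | cons x k ih =>
    set h := 2 ^ k.length with hh
    have hk : 2 ^ (x :: k).length = h + h := by simp [hh, pow_succ]; ring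
    rw [hk] at hw
    obtain ⟨f, f₁, f₂, f₃⟩ := ih us (ws.take h) gs acc (by simp)
    have hfl : f.length ≤ h := by rw [f₁]; simp
    -- Truncated factors have length at most `2 * h` and `f` at most `h`, whence `3 * h`.
    obtain ⟨c, c₁, c₂, c₃⟩ := exists_computes_contrib (gs := gs)
      (qs := qs.map (·.take (h + h))) (f := f) (n := 3 * h)
      (by
        intro q hq
        obtain ⟨q, _, rfl⟩ := List.mem_map.1 hq
        have := List.length_take_le (h + h) q
        omega)
      (by omega)
    obtain ⟨g, g₁, g₂, g₃⟩ := ih (us.drop h) (ws.drop h) (gs.drop h)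
      (addL (c.drop h) (acc.drop h)) (by simp; omega)
    have hc : ∀ l (q : List F), (addL (c.drop h) (acc.drop h)).getD l 0 =
        c.getD (h + l) 0 + acc.getD (h + l) 0 := fun l q => by
      rw [← coeff_polyOf, polyOf_addL, coeff_add, coeff_polyOf, coeff_polyOf, getD_drop, getD_drop]
    refine ⟨f ++ g, by simp [f₁, g₁]; omega, ?_, ?_⟩
    · intro j hj
      rcases lt_or_ge j h with hjh | hjh
      · have hjf : j < f.length := by rw [f₁]; simp; omega
        rw [List.getD_append _ _ _ _ hjf, f₂ j (by rwa [← f₁]), getD_take hjh]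
        congr 3
        refine Finset.sum_congr rfl fun i hi => ?_
        rw [Finset.mem_range] at hi
        rw [List.getD_append _ _ _ _ (by omega)]
      -- An index at or beyond `h` exists only if `ws` is longer than `h`, so the first half is
      -- full.
      · have hfh : f.length = h := by rw [f₁]; simp; omega
        obtain ⟨j, rfl⟩ := Nat.exists_eq_add_of_le hjh
        have e₁ : ∀ i, (f ++ g).getD (h + i) 0 = g.getD i 0 := fun i => by
          rw [List.getD_append_right _ _ _ _ (by omega), hfh, Nat.add_sub_cancel_left]
        have e₂ : c.getD (h + j) 0 = ∑ i ∈ Finset.range h,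
            (f ++ g).getD i 0 * kern (h + j - i) (gs.getD i 0) qs := by
          rw [← coeff_polyOf, c₂, coeff_contribP, show h + j + 1 = h + (j + 1) by ring,
            Finset.sum_range_add, Finset.sum_eq_zero (s := Finset.range (j + 1)), add_zero]
          · refine Finset.sum_congr rfl fun i hi => ?_
            rw [Finset.mem_range] at hi
            rw [List.getD_append _ _ _ _ (by omega), kern_map_take (by omega)]
          · intro i _
            rw [List.getD_eq_default _ _ (by omega), zero_mul]
        rw [e₁, g₂ j (by simp; omega), getD_drop, getD_drop, hc j [], e₂, Finset.sum_range_add]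
        have e₃ : ∀ i, h + j - (h + i) = j - i := fun i => by omega
        simp only [e₁, e₃, getD_drop]
        ring
    · have hpow := fun Q => wpCall_pow (Q := Q) k [Val.nil, Val.nil]
      simp only [Val.ofList_cons, Val.ofList_nil] at hpow
      rw [Computes, wpCall_solver Fn.solve rfl]
      simp [Body.solve, hpow]
      simp only [← hh]
      refine Computes.wpCall f₃ fun b₁ hb₁ => ?_
      refine Computes.wpCall c₃ fun b₂ hb₂ => ?_
      simp
      simp only [← hh]
      refine Computes.wpCall g₃ fun b₃ hb₃ => ?_
      simp [solveCost]
      rw [List.length_map] at hb₂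
      simp only [← hh]
      have e : 2 * (3 * h) = 6 * h := by ring
      rw [e] at hb₂
      omega

end Solve
-- Normalization, weights and free positions.
section Prepare

variable {F : Type*} [Field F] {Q : Val F → ℕ → Prop}

theorem wpCall_evalAt (a : List F) (x : F) :
    wpCall solver Fn.evalAt (.pair (.poly a) (.elem x)) Q ↔
      Q (.elem ((polyOf a).eval x)) (2 * a.length) := by
  induction a generalizing Q with
  | nil => rw [wpCall_solver Fn.evalAt rfl]; simp [Body.evalAt]
  | cons c a ih =>
    rw [wpCall_solver Fn.evalAt rfl]
    simp [Body.evalAt, ih, mul_add]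

/-- The convention `0⁻¹ = 0` agrees with the branch of the program that outputs zero; a zero weight
thus marks a root. -/
theorem computes_weights (b gs : List F) :
    Computes solver Fn.weights (.pair (.poly b) (.poly gs))
      (.poly (gs.map fun g => -((polyOf b).eval g)⁻¹)) (gs.length * (2 * b.length + 3)) := by
  rw [Computes]
  induction gs with
  | nil => rw [wpCall_solver Fn.weights rfl]; simp [Body.weights]
  | cons g gs ih =>
    rw [wpCall_solver Fn.weights rfl]
    simp [Body.weights, wpCall_evalAt]
    constructor
    · intro h
      refine Computes.wpCall ih fun c hc => ?_
      simp [h, add_one_mul]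
      omega
    · intro h
      refine ⟨h, Computes.wpCall ih fun c hc => ?_⟩
      simp [add_one_mul]
      omega

open scoped Classical in
/-- The positions at which a list is zero. -/
noncomputable def zeros : List F → List ℕ
  | [] => []
  | w :: ws => if w = 0 then 0 :: (zeros ws).map Nat.succ else (zeros ws).map Nat.succ

theorem mem_zeros {ws : List F} {j : ℕ} : j ∈ zeros ws ↔ j < ws.length ∧ ws.getD j 0 = 0 := by
  induction ws generalizing j with
  | nil => simp [zeros]
  | cons w ws ih => cases j <;> by_cases h : w = 0 <;> simp [zeros, h, ih]

theorem nodup_zeros (ws : List F) : (zeros ws).Nodup := by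
  induction ws with
  | nil => simp [zeros]
  | cons w ws ih =>
    have := ih.map Nat.succ_injective
    by_cases h : w = 0 <;> simp [zeros, h, this]

/-- The `j`-th unit vector. -/
def unitL (F : Type*) [Field F] (j : ℕ) : List F := List.replicate j 0 ++ [1]

theorem getD_unitL (i j : ℕ) : (unitL F i).getD j 0 = if j = i then 1 else 0 := by
  induction i generalizing j with
  | zero => cases j <;> simp [unitL]
  | succ i ih =>
    cases j with
    | zero => simp [unitL, List.replicate_succ]
    | succ j => simpa [unitL, List.replicate_succ] using ih j

theorem wpCall_consZero (us : List (List F)) :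
    wpCall solver Fn.consZero (.polys us) Q ↔ Q (.polys (us.map (0 :: ·))) 0 := by
  induction us generalizing Q with
  | nil => rw [wpCall_solver Fn.consZero rfl]; simp [Body.consZero]
  | cons u us ih => rw [wpCall_solver Fn.consZero rfl]; simp [Body.consZero, ih]

theorem wpCall_units (ws : List F) :
    wpCall solver Fn.units (.poly ws) Q ↔ Q (.polys ((zeros ws).map (unitL F))) ws.length := by
  induction ws generalizing Q with
  | nil => rw [wpCall_solver Fn.units rfl]; simp [Body.units, zeros]
  | cons w ws ih =>
    rw [wpCall_solver Fn.units rfl]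
    have : (zeros ws).map ((fun x => 0 :: x) ∘ unitL F) = (zeros ws).map (unitL F ∘ Nat.succ) :=
      List.map_congr_left fun i _ => by simp [unitL, List.replicate_succ]
    by_cases h : w = 0 <;>
      simp [Body.units, zeros, h, ih, wpCall_consZero, this, unitL]

theorem computes_headsZero (qs : List (List F)) :
    ∃ v : Val F, (v = .nil ∧ (∀ q ∈ qs, q.getD 0 0 = 0) ∨
      (∃ x y, v = .pair x y) ∧ ∃ q ∈ qs, q.getD 0 0 ≠ 0) ∧
      Computes solver Fn.headsZero (.polys qs) v qs.length := by
  induction qs with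
  | nil =>
    refine ⟨.nil, by simp, ?_⟩
    rw [Computes, wpCall_solver Fn.headsZero rfl]
    simp [Body.headsZero]
  | cons q qs ih =>
    obtain ⟨v, hv, h⟩ := ih
    by_cases hq : q.getD 0 0 = 0
    · refine ⟨v, ?_, ?_⟩
      · rcases hv with ⟨hv, h'⟩ | ⟨hv, q', h₁, h₂⟩
        · exact Or.inl ⟨hv, by simpa using ⟨by simpa using hq, by simpa using h'⟩⟩
        · exact Or.inr ⟨hv, q', by simp [h₁], h₂⟩
      · rw [Computes, wpCall_solver Fn.headsZero rfl]
        cases q with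
        | nil =>
          simp [Body.headsZero]
          exact Computes.wpCall h fun c hc => ⟨rfl, by omega⟩
        | cons a q =>
          simp at hq
          simp [Body.headsZero, hq]
          exact Computes.wpCall h fun c hc => ⟨rfl, by omega⟩
    · refine ⟨.pair .nil .nil, Or.inr ⟨⟨_, _, rfl⟩, q, by simp, hq⟩, ?_⟩
      rw [Computes, wpCall_solver Fn.headsZero rfl]
      cases q with
      | nil => simp at hq
      | cons a q =>
        simp at hq
        simp [Body.headsZero, hq]

theorem wpCall_tails (qs : List (List F)) :
    wpCall solver Fn.tails (.polys qs) Q ↔ Q (.polys (qs.map (·.drop 1))) 0 := by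
  induction qs generalizing Q with
  | nil => rw [wpCall_solver Fn.tails rfl]; simp [Body.tails]
  | cons q qs ih =>
    rw [wpCall_solver Fn.tails rfl]
    cases q <;> simp [Body.tails, ih]

theorem wpCall_heads (qs : List (List F)) :
    wpCall solver Fn.heads (.polys qs) Q ↔ Q (.poly (qs.map (·.getD 0 0))) 0 := by
  induction qs generalizing Q with
  | nil => rw [wpCall_solver Fn.heads rfl]; simp [Body.heads]
  | cons q qs ih =>
    rw [wpCall_solver Fn.heads rfl]
    cases q <;> simp [Body.heads, ih]

/-- Common factors `x` are stripped one per round, so `v` is the first index where some list has a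
nonzero entry. Running out of entries means that all the polynomials vanish. `qt` is shifted along
without a test; its lower entries reappear in the residual. -/
theorem computes_norm (n : ℕ) (qt : List F) (qs : List (List F)) (hne : qs ≠ [])
    (hn : ∀ q ∈ qs, q.length = n) :
    (∃ v, (∀ q ∈ qs, ∀ l < v, q.getD l 0 = 0) ∧ (∃ q ∈ qs, q.getD v 0 ≠ 0) ∧
      Computes solver Fn.norm (.pair (.poly qt) (.polys qs))
        (.pair (.poly (qt.drop v)) (.polys (qs.map (·.drop v)))) (n * qs.length)) ∨
    ((∀ q ∈ qs, polyOf q = 0) ∧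
      Computes solver Fn.norm (.pair (.poly qt) (.polys qs)) .nil (n * qs.length)) := by
  induction n generalizing qt qs with
  | zero =>
    refine Or.inr ⟨fun q hq => by rw [List.length_eq_zero_iff.1 (hn q hq), polyOf_nil], ?_⟩
    cases qs with
    | nil => simp at hne
    | cons q qs =>
      obtain rfl := List.length_eq_zero_iff.1 (hn q (by simp))
      rw [Computes, wpCall_solver Fn.norm rfl]
      simp [Body.norm]
  | succ n ih =>
    obtain ⟨a, q, qs', rfl⟩ : ∃ a q qs', qs = (a :: q) :: qs' := by
      match qs, hne, hn with
      | [] :: _, _, hn => simp at hn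
      | (a :: q) :: qs, _, _ => exact ⟨a, q, qs, rfl⟩
    obtain ⟨v, hv, h⟩ := computes_headsZero ((a :: q) :: qs')
    rcases hv with ⟨rfl, h0⟩ | ⟨⟨x, y, rfl⟩, hq⟩
    · have key : ∀ v c, Computes solver Fn.norm (.pair (.poly (qt.drop 1))
            (.polys (((a :: q) :: qs').map (·.drop 1)))) v c →
          Computes solver Fn.norm (.pair (.poly qt) (.polys ((a :: q) :: qs'))) v
            (c + ((a :: q) :: qs').length) := by
        intro v c hc
        have ht := fun Q => wpCall_tails (Q := Q) ((a :: q) :: qs')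
        simp only [Val.polys_cons, Val.poly_cons] at h ht ⊢
        rw [Computes, wpCall_solver Fn.norm rfl]
        simp [Body.norm]
        refine Computes.wpCall h fun c₁ h₁ => ?_
        cases qt with
        | nil =>
          simp [ht]
          simp at hc
          refine Computes.wpCall hc fun c₂ h₂ => ?_
          simp at h₁ ⊢
          omega
        | cons b qt =>
          simp [ht]
          simp at hc
          refine Computes.wpCall hc fun c₂ h₂ => ?_
          simp at h₁ ⊢
          omega
      have hl : ((((a :: q) :: qs').map (·.drop 1))).length = ((a :: q) :: qs').length := by simp
      rcases ih (qt.drop 1) (((a :: q) :: qs').map (·.drop 1)) (by simp) (by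
        intro q' hq'
        obtain ⟨q'', h'', rfl⟩ := List.mem_map.1 hq'
        simp [hn q'' h'']) with ⟨v, h₁, h₂, h₃⟩ | ⟨h₁, h₂⟩
      · refine Or.inl ⟨v + 1, ?_, ?_, ?_⟩
        · intro q' hq' l hl
          cases l with
          | zero => exact h0 q' hq'
          | succ l =>
            have := h₁ _ (List.mem_map_of_mem hq') l (by omega)
            rwa [getD_drop, add_comm] at this
        · obtain ⟨q', hq', h'⟩ := h₂
          obtain ⟨q'', h'', rfl⟩ := List.mem_map.1 hq'
          rw [getD_drop, add_comm] at h'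
          exact ⟨q'', h'', h'⟩
        · have := key _ _ h₃
          rw [hl, ← add_one_mul, List.drop_drop, List.map_map, add_comm 1 v] at this
          convert this using 5
          simp
      · refine Or.inr ⟨?_, ?_⟩
        · intro q' hq'
          have h₃ := h₁ _ (List.mem_map_of_mem hq')
          have h₄ := h0 q' hq'
          cases q' with
          | nil => rfl
          | cons b q' =>
            simp at h₃ h₄
            simp [h₃, h₄]
        · have := key _ _ h₂
          rwa [hl, ← add_one_mul] at this
    · refine Or.inl ⟨0, by simp, hq, ?_⟩
      rw [Computes, wpCall_solver Fn.norm rfl]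
      simp only [Val.polys_cons, Val.poly_cons] at h
      simp [Body.norm]
      refine Computes.wpCall h fun c₁ h₁ => ?_
      simp at h₁ ⊢
      nlinarith [Nat.zero_le (n * (qs'.length + 1))]

theorem computes_powers (n : List (Val F)) (g c : F) :
    Computes solver Fn.powers (.pair (.ofList n) (.pair (.elem g) (.elem c)))
      (.poly ((List.range n.length).map fun i => c * g ^ i)) n.length := by
  rw [Computes]
  induction n generalizing c with
  | nil => rw [wpCall_solver Fn.powers rfl]; simp [Body.powers]
  | cons x n ih =>
    rw [wpCall_solver Fn.powers rfl]
    simp [Body.powers]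
    refine Computes.wpCall (ih (c * g)) fun c₁ h₁ => ?_
    simp [List.range_succ_eq_map, pow_succ', mul_assoc, Function.comp_def]
    omega

end Prepare
/-! ### Elimination -/

section Elim

variable {F : Type*} [Field F] {Q : Val F → ℕ → Prop}

/-- A linear combination of polynomials given by coefficient lists. -/
noncomputable def comb : (ℕ → F) → List (List F) → F[X]
  | _, [] => 0
  | c, v :: vs => C (c 0) * polyOf v + comb (fun i => c (i + 1)) vs

/-- The sequence `c` with `a` in front. -/
def consFn (a : F) (c : ℕ → F) : ℕ → F
  | 0 => a
  | i + 1 => c i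

theorem comb_consFn (a : F) (c : ℕ → F) (v : List F) (vs : List (List F)) :
    comb (consFn a c) (v :: vs) = C a * polyOf v + comb c vs := rfl

theorem comb_eq_sum (c : ℕ → F) (vs : List (List F)) :
    comb c vs = ∑ i ∈ Finset.range vs.length, C (c i) * polyOf (vs.getD i []) := by
  induction vs generalizing c with
  | nil => simp [comb]
  | cons v vs ih => rw [comb, ih, List.length_cons, Finset.sum_range_succ', add_comm]; simp

/-- Linear independence of polynomials given by coefficient lists. -/
def Indep (vs : List (List F)) : Prop := ∀ c, comb c vs = 0 → ∀ i < vs.length, c i = 0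

theorem polyOf_eq_head_add (v : List F) : polyOf v = C (v.getD 0 0) + X * polyOf v.tail := by
  cases v <;> simp

/-- Removal of the heads of the vectors `vs`, after the subtraction of multiples of a vector with
head `1 / c` and tail `t`. -/
def reduceL (c : F) (t : List F) (vs : List (List F)) : List (List F) :=
  vs.map fun v => addL v.tail (smulL (0 - c * v.getD 0 0) t)

theorem computes_reduce {c : F} {t : List F} {vs : List (List F)} {n : ℕ} (ht : t.length ≤ n) :
    Computes solver Fn.reduce (.pair (.elem c) (.pair (.poly t) (.polys vs)))
      (.polys (reduceL c t vs)) (vs.length * (2 + 2 * n)) := by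
  rw [Computes]
  induction vs with
  | nil => rw [wpCall_solver Fn.reduce rfl]; simp [Body.reduce, reduceL]
  | cons v vs ih =>
    have h := fun (Q : Val F → ℕ → Prop) (a : List F) => wpCall_add (Q := Q) [] a
    rw [Val.poly_nil] at h
    rw [wpCall_solver Fn.reduce rfl]
    cases v with
    | nil =>
      simp [Body.reduce, h]
      refine Computes.wpCall ih fun c₁ h₁ => ?_
      simp [reduceL, add_one_mul]
      omega
    | cons a v =>
      simp [Body.reduce]
      refine Computes.wpCall ih fun c₁ h₁ => ?_
      simp [reduceL, add_one_mul]
      omega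

open scoped Classical in
/-- A basis of the vectors with head zero, with the heads removed. -/
noncomputable def elimL : List (List F) → List (List F)
  | [] => []
  | v :: vs => if v.getD 0 0 = 0 then v.tail :: elimL vs else reduceL (v.getD 0 0)⁻¹ v.tail vs

theorem length_elimL_le (vs : List (List F)) : (elimL vs).length ≤ vs.length := by
  induction vs with
  | nil => simp [elimL]
  | cons v vs ih =>
    rw [elimL]
    split_ifs
    · simpa using ih
    · simp [reduceL]

theorem length_of_mem_elimL {vs : List (List F)} {n : ℕ} (h : ∀ v ∈ vs, v.length = n + 1) :
    ∀ v ∈ elimL vs, v.length = n := by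
  induction vs with
  | nil => simp [elimL]
  | cons v vs ih =>
    simp only [List.mem_cons, forall_eq_or_imp] at h
    rw [elimL]
    split_ifs
    · simpa [h.1] using ih h.2
    · intro w hw
      obtain ⟨w', hw', rfl⟩ := List.mem_map.1 hw
      simp [h.1, h.2 w' hw']

/-- The bound is stated for amortization: a round that finds no pivot only tests heads, and an
expensive round shortens the list. -/
theorem computes_elim {vs : List (List F)} {n : ℕ} (h : ∀ v ∈ vs, v.length ≤ n + 1) :
    ∃ c, Computes solver Fn.elim (.polys vs) (.polys (elimL vs)) c ∧
      (c ≤ vs.length ∨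
        c ≤ vs.length + 1 + vs.length * (2 + 2 * n) ∧ (elimL vs).length + 1 ≤ vs.length) := by
  induction vs with
  | nil =>
    refine ⟨0, ?_, Or.inl le_rfl⟩
    rw [Computes, wpCall_solver Fn.elim rfl]
    simp [Body.elim, elimL]
  | cons v vs ih =>
    simp only [List.mem_cons, forall_eq_or_imp] at h
    obtain ⟨c, h₁, h₂⟩ := ih h.2
    by_cases hv : v.getD 0 0 = 0
    · refine ⟨c + 1, ?_, ?_⟩
      · rw [Computes, wpCall_solver Fn.elim rfl, elimL, if_pos hv]
        cases v with
        | nil =>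
          simp [Body.elim]
          exact Computes.wpCall h₁ fun c hc => ⟨rfl, by omega⟩
        | cons a v =>
          simp at hv
          simp [Body.elim, hv]
          exact Computes.wpCall h₁ fun c hc => ⟨rfl, by omega⟩
      · rw [elimL, if_pos hv]
        simp only [List.length_cons, add_one_mul]
        omega
    · refine ⟨vs.length * (2 + 2 * n) + 2, ?_, Or.inr ⟨?_, ?_⟩⟩
      · rw [Computes, wpCall_solver Fn.elim rfl, elimL, if_neg hv]
        cases v with
        | nil => simp at hv
        | cons a v =>
          simp at hv h
          simp [Body.elim, hv]
          exact Computes.wpCall (computes_reduce h.1) fun c hc => ⟨rfl, by omega⟩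
      · simp only [List.length_cons, add_one_mul]
        omega
      · rw [elimL, if_neg hv]
        simp [reduceL]

theorem X_mul_comb_reduceL {v : List F} (hv : v.getD 0 0 ≠ 0) (vs : List (List F)) (c : ℕ → F) :
    ∃ l : F, X * comb c (reduceL (v.getD 0 0)⁻¹ v.tail vs) = comb c vs - C l * polyOf v := by
  induction vs generalizing c with
  | nil => exact ⟨0, by simp [reduceL, comb]⟩
  | cons w vs ih =>
    obtain ⟨l, hl⟩ := ih fun i => c (i + 1)
    refine ⟨l + c 0 * ((v.getD 0 0)⁻¹ * w.getD 0 0), ?_⟩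
    rw [reduceL] at hl
    have e₁ := polyOf_eq_head_add v
    have e₂ := polyOf_eq_head_add w
    have e₃ : C (v.getD 0 0)⁻¹ * C (v.getD 0 0) = (1 : F[X]) := by
      rw [← C_mul, inv_mul_cancel₀ hv, C_1]
    simp only [reduceL, List.map_cons, comb, polyOf_addL, polyOf_smulL, mul_add, hl, C_add, C_mul,
      C_sub, C_0]
    linear_combination (-C (c 0)) * e₂ + C (c 0) * C (v.getD 0 0)⁻¹ * C (w.getD 0 0) * e₁ +
      C (c 0) * C (w.getD 0 0) * e₃

/-- Elimination keeps the combinations with constant term zero and divides them by `X`. In the pivot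
case the multiple of the pivot is forced by the constant term. -/
theorem exists_comb_elimL_iff (vs : List (List F)) (x : F[X]) :
    (∃ c, comb c (elimL vs) = x) ↔ ∃ c, comb c vs = X * x := by
  induction vs generalizing x with
  | nil => simp [elimL, comb, eq_comm (a := (0 : F[X])), X_ne_zero]
  | cons v vs ih =>
    rw [elimL]
    have hv := polyOf_eq_head_add v
    split_ifs with h
    · rw [h, C_0, zero_add] at hv
      constructor
      · rintro ⟨c, rfl⟩
        obtain ⟨c', hc'⟩ := (ih _).1 ⟨fun i => c (i + 1), rfl⟩
        refine ⟨consFn (c 0) c', ?_⟩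
        rw [comb_consFn, hc', hv, comb]
        ring
      · rintro ⟨c, hc⟩
        obtain ⟨c', hc'⟩ := (ih (x - C (c 0) * polyOf v.tail)).2 ⟨fun i => c (i + 1), by
          rw [comb, hv] at hc
          linear_combination hc⟩
        refine ⟨consFn (c 0) c', ?_⟩
        simp only [comb_consFn, hc']
        ring
    · constructor
      · rintro ⟨c, rfl⟩
        obtain ⟨l, hl⟩ := X_mul_comb_reduceL h vs c
        refine ⟨consFn (-l) c, ?_⟩
        simp only [comb_consFn, hl, C_neg]
        ring
      · rintro ⟨c, hc⟩
        obtain ⟨l, hl⟩ := X_mul_comb_reduceL h vs fun i => c (i + 1)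
        refine ⟨fun i => c (i + 1), ?_⟩
        rw [comb] at hc
        have h₁ : X * (comb (fun i => c (i + 1)) (reduceL (v.getD 0 0)⁻¹ v.tail vs) - x) =
            -C (c 0 + l) * polyOf v := by
          rw [C_add]
          linear_combination hl + hc
        -- The left side has no constant term, while `v` has a nonzero one; so the leftover multiple
        -- of `v` is zero.
        have h₂ := congrArg (coeff · 0) h₁
        simp only [mul_coeff_zero, coeff_X_zero, zero_mul, coeff_neg, coeff_C_zero,
          coeff_polyOf] at h₂
        have h₃ : c 0 + l = 0 := by
          rcases mul_eq_zero.1 h₂.symm with h | h'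
          · exact neg_eq_zero.1 h
          · exact absurd h' h
        rw [h₃, C_0, neg_zero, zero_mul] at h₁
        exact sub_eq_zero.1 ((mul_eq_zero.1 h₁).resolve_left X_ne_zero)

/-- A relation among the new vectors, multiplied by `X`, lifts to a relation among the old ones with
the same coefficients on the vectors retained after a pivot. When the first head is zero, the
relation first forces that vector's coefficient to vanish, and induction handles the rest. -/
theorem indep_elimL {vs : List (List F)} (h : Indep vs) : Indep (elimL vs) := by
  induction vs with
  | nil => simpa [elimL] using h
  | cons v vs ih =>
    rw [elimL]
    have hv := polyOf_eq_head_add v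
    split_ifs with h0
    · rw [h0, C_0, zero_add] at hv
      have hvs : Indep vs := fun c hc i hi => by
        have := h (consFn 0 c) (by simp [comb_consFn, hc]) (i + 1) (by simpa using hi)
        exact this
      intro c hc
      rw [comb] at hc
      obtain ⟨c', hc'⟩ := (exists_comb_elimL_iff vs (-(C (c 0) * polyOf v.tail))).1
        ⟨fun i => c (i + 1), by linear_combination hc⟩
      have h₁ : c 0 = 0 := h (consFn (c 0) c') (by
        simp only [comb_consFn, hc', hv]
        ring) 0 (by simp)
      rw [h₁, C_0, zero_mul, zero_add] at hc
      intro i hi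
      cases i with
      | zero => exact h₁
      | succ i => exact ih hvs _ hc i (by simpa using hi)
    · intro c hc i hi
      obtain ⟨l, hl⟩ := X_mul_comb_reduceL h0 vs c
      rw [hc, mul_zero] at hl
      exact h (consFn (-l) c) (by
        simp only [comb_consFn, C_neg]
        linear_combination -hl) (i + 1) (by simpa [reduceL] using hi)

/-- Repeated elimination. -/
noncomputable def elimNL : ℕ → List (List F) → List (List F)
  | 0, vs => vs
  | n + 1, vs => elimNL n (elimL vs)

theorem exists_comb_elimNL_iff (n : ℕ) (vs : List (List F)) (x : F[X]) :
    (∃ c, comb c (elimNL n vs) = x) ↔ ∃ c, comb c vs = X ^ n * x := by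
  induction n generalizing vs with
  | zero => simp [elimNL]
  | succ n ih => rw [elimNL, ih, exists_comb_elimL_iff, pow_succ', mul_assoc]

theorem indep_elimNL (n : ℕ) {vs : List (List F)} (h : Indep vs) : Indep (elimNL n vs) := by
  induction n generalizing vs with
  | zero => exact h
  | succ n ih => exact ih (indep_elimL h)

theorem length_of_mem_elimNL {n l : ℕ} {vs : List (List F)} (h : ∀ v ∈ vs, v.length = n + l) :
    ∀ v ∈ elimNL n vs, v.length = l := by
  induction n generalizing vs with
  | zero => simpa [elimNL] using h
  | succ n ih => exact ih (length_of_mem_elimL fun v hv => by rw [h v hv]; ring)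

theorem length_elimNL_le (n : ℕ) (vs : List (List F)) : (elimNL n vs).length ≤ vs.length := by
  induction n generalizing vs with
  | zero => exact le_rfl
  | succ n ih => exact (ih _).trans (length_elimL_le vs)

theorem computes_elimN {n : List (Val F)} {vs : List (List F)} {l : ℕ}
    (h : ∀ v ∈ vs, v.length = n.length + l) :
    Computes solver Fn.elimN (.pair (.ofList n) (.polys vs)) (.polys (elimNL n.length vs))
      (n.length * vs.length + vs.length * (1 + vs.length * (2 + 2 * (n.length + l)))) := by
  -- The vectors get shorter in each round; a fixed bound `K` for the cost per reduced vector makes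
  -- the induction uniform.
  suffices ∀ K, 2 + 2 * (n.length + l) ≤ K →
      Computes solver Fn.elimN (.pair (.ofList n) (.polys vs)) (.polys (elimNL n.length vs))
        (n.length * vs.length + vs.length * (1 + vs.length * K)) from this _ le_rfl
  intro K hK
  induction n generalizing vs with
  | nil => rw [Computes, wpCall_solver Fn.elimN rfl]; simp [Body.elimN, elimNL]
  | cons x n ih =>
    simp only [List.length_cons] at h hK ⊢
    obtain ⟨c, h₁, h₂⟩ := computes_elim (n := n.length + l) fun v hv => (by
      rw [h v hv]; omega : v.length ≤ n.length + l + 1)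
    have h₃ := ih (vs := elimL vs) (length_of_mem_elimL fun v hv => by rw [h v hv]; ring)
      (by omega)
    rw [Computes, wpCall_solver Fn.elimN rfl]
    simp [Body.elimN]
    refine Computes.wpCall h₁ fun c₁ hc₁ => Computes.wpCall h₃ fun c₂ hc₂ => ⟨rfl, ?_⟩
    have h₄ := length_elimL_le vs
    rcases h₂ with h₂ | ⟨h₂, h₅⟩
    · calc c₁ + c₂ ≤ vs.length + (n.length * vs.length + vs.length * (1 + vs.length * K)) := by
            refine Nat.add_le_add (by omega) (hc₂.trans ?_)
            gcongr
        _ = _ := by ring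
    -- At most `q` of the `q + 1` vectors survive a pivot, and the lost one pays for the reduction.
    · obtain ⟨q, hq⟩ := Nat.exists_eq_add_of_le' (Nat.one_le_of_lt h₅)
      have h₆ : (elimL vs).length ≤ q := by omega
      calc c₁ + c₂ ≤ (vs.length + 1 + vs.length * K) + (n.length * q + q * (1 + q * K)) := by
            refine Nat.add_le_add (hc₁.trans (h₂.trans ?_)) (hc₂.trans ?_)
            · gcongr
              omega
            · gcongr
        _ ≤ _ := by
            rw [hq]
            nlinarith [Nat.zero_le (n.length), Nat.zero_le (q * K)]

open scoped Classical in
/-- The tail of the first vector with nonzero head, scaled. -/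
noncomputable def pivotL : List (List F) → Option (List F)
  | [] => none
  | v :: vs => if v.getD 0 0 = 0 then pivotL vs else some (smulL (v.getD 0 0)⁻¹ v.tail)

theorem computes_pivot {vs : List (List F)} {n : ℕ} (h : ∀ v ∈ vs, v.length ≤ n + 1) :
    Computes solver Fn.pivot (.polys vs)
      ((pivotL vs).elim .nil fun p => .pair .nil (.poly p)) (vs.length + n + 1) := by
  rw [Computes]
  induction vs with
  | nil => rw [wpCall_solver Fn.pivot rfl]; simp [Body.pivot, pivotL]
  | cons v vs ih =>
    simp only [List.mem_cons, forall_eq_or_imp] at h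
    rw [wpCall_solver Fn.pivot rfl, pivotL]
    cases v with
    | nil =>
      simp [Body.pivot]
      exact Computes.wpCall (ih h.2) fun c hc => ⟨rfl, by omega⟩
    | cons a v =>
      by_cases ha : a = 0
      · simp [Body.pivot, ha]
        exact Computes.wpCall (ih h.2) fun c hc => ⟨rfl, by omega⟩
      · simp [Body.pivot, ha]
        simp at h
        omega

theorem pivotL_eq_none {vs : List (List F)} (h : pivotL vs = none) (c : ℕ → F) :
    (comb c vs).coeff 0 = 0 := by
  induction vs generalizing c with
  | nil => simp [comb]
  | cons v vs ih =>
    rw [pivotL] at h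
    split_ifs at h with hv
    rw [comb, coeff_add, coeff_C_mul, coeff_polyOf, hv, mul_zero, zero_add, ih h]

theorem pivotL_eq_some {vs : List (List F)} {p : List F} (h : pivotL vs = some p) :
    ∃ c, comb c vs = 1 + X * polyOf p := by
  induction vs with
  | nil => simp [pivotL] at h
  | cons v vs ih =>
    rw [pivotL] at h
    split_ifs at h with hv
    · obtain ⟨c, hc⟩ := ih h
      exact ⟨consFn 0 c, by simp [comb_consFn, hc]⟩
    · obtain rfl := Option.some.inj h
      have h0 : ∀ vs : List (List F), comb (fun _ => (0 : F)) vs = 0 := fun vs => by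
        rw [comb_eq_sum]
        simp
      refine ⟨consFn (v.getD 0 0)⁻¹ fun _ => 0, ?_⟩
      simp only [comb_consFn, h0, polyOf_smulL]
      rw [polyOf_eq_head_add v, mul_add, ← C_mul, inv_mul_cancel₀ hv, C_1]
      ring

theorem length_pivotL {vs : List (List F)} {p : List F} {n : ℕ} (h : pivotL vs = some p)
    (hn : ∀ v ∈ vs, v.length = n + 1) : p.length = n := by
  induction vs with
  | nil => simp [pivotL] at h
  | cons v vs ih =>
    simp only [List.mem_cons, forall_eq_or_imp] at hn
    rw [pivotL] at h
    split_ifs at h with hv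
    · exact ih h hn.2
    · obtain rfl := Option.some.inj h
      simp [hn.1]

theorem computes_addAll (a : List F) (bs : List (List F)) :
    Computes solver Fn.addAll (.pair (.poly a) (.polys bs)) (.polys (bs.map (addL a)))
      (bs.length * a.length) := by
  rw [Computes]
  induction bs with
  | nil => rw [wpCall_solver Fn.addAll rfl]; simp [Body.addAll]
  | cons b bs ih =>
    rw [wpCall_solver Fn.addAll rfl]
    simp [Body.addAll]
    refine Computes.wpCall ih fun c hc => ?_
    simp [add_one_mul]
    omega

end Elim
-- Generators: residual, flag, solution.
section Vectors

variable {F : Type*} [Field F] {Q : Val F → ℕ → Prop}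

theorem wpCall_append_poly_cons (a b : List F) (h : F) :
    wpCall solver Fn.append (.pair (.poly a) (.pair (.elem h) (.poly b))) Q ↔
      Q (.poly (a ++ h :: b)) 0 :=
  wpCall_append_poly a (h :: b)

/-- The parameters of the triangular system, as a value. -/
def Val.context (r k : List (Val F)) (qv qs : List (List F)) (ws gs : List F) : Val F :=
  .pair (.ofList r) (.pair (.ofList k) (.pair (.polys qv) (.pair (.polys qs)
    (.pair (.poly ws) (.poly gs)))))

/-- The cost of the computation of a solution with its residual. -/
def vecCost (q k n : ℕ) : ℕ := solveCost q k + q * (mulBound n + 2 * n) + n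

/-- The degree bound `hr` ensures that padding the residual to `r.length` entries loses nothing, so
the whole vector encodes `residual + X ^ R * (h + X * f)`. -/
theorem exists_computes_vec {r k : List (Val F)} {qv qs : List (List F)} {ws gs : List F}
    {n : ℕ} (hw : ws.length ≤ 2 ^ k.length) (hl : qv.length = qs.length)
    (hq : ∀ q ∈ qs, q.length + ws.length ≤ n) (hwn : ws.length ≤ n) (h : F) (us acc e : List F)
    (hr : ∀ f : List F, f.length = ws.length →
      (polyOf e + contribP gs qs f).degree < r.length) :
    ∃ f v : List F, f.length = ws.length ∧
      (∀ j < ws.length, f.getD j 0 = us.getD j 0 + ws.getD j 0 * (acc.getD j 0 +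
        ∑ i ∈ Finset.range j, f.getD i 0 * kern (j - i) (gs.getD i 0) qv)) ∧
      v.length = r.length + (ws.length + 1) ∧
      polyOf v = polyOf e + contribP gs qs f + X ^ r.length * (C h + X * polyOf f) ∧
      Computes solver Fn.vec (.pair (.context r k qv qs ws gs) (.pair (.elem h) (.pair (.poly us)
        (.pair (.poly acc) (.poly e))))) (.poly v) (vecCost qs.length k.length n + e.length) := by
  obtain ⟨f, f₁, f₂, f₃⟩ := exists_computes_solve k qv us ws gs acc hw
  obtain ⟨c, c₁, c₂, c₃⟩ := exists_computes_contrib (gs := gs) (qs := qs) (f := f) (n := n)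
    (by rwa [f₁]) (by rwa [f₁])
  refine ⟨f, padL r.length (addL e c) ++ h :: f, f₁, f₂, by simp [f₁], ?_, ?_⟩
  · rw [polyOf_append, length_padL, polyOf_padL (by rw [polyOf_addL, c₂]; exact hr f f₁),
      polyOf_addL, c₂, polyOf_cons]
  · rw [Computes, wpCall_solver Fn.vec rfl]
    simp [Body.vec, Val.context]
    refine Computes.wpCall f₃ fun b₁ hb₁ => Computes.wpCall c₃ fun b₂ hb₂ => ?_
    simp [wpCall_append_poly_cons, vecCost]
    rw [hl] at hb₁
    omega

theorem exists_computes_gens {r k : List (Val F)} {qv qs : List (List F)} {ws gs : List F}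
    {n : ℕ} (hw : ws.length ≤ 2 ^ k.length) (hl : qv.length = qs.length)
    (hq : ∀ q ∈ qs, q.length + ws.length ≤ n) (hwn : ws.length ≤ n)
    (hr : ∀ f : List F, f.length = ws.length → (contribP gs qs f).degree < r.length)
    (us : List (List F)) :
    ∃ vs : List (List F), List.Forall₂ (fun u v => ∃ f : List F, f.length = ws.length ∧
      (∀ j < ws.length, f.getD j 0 = u.getD j 0 + ws.getD j 0 *
        ∑ i ∈ Finset.range j, f.getD i 0 * kern (j - i) (gs.getD i 0) qv) ∧
      v.length = r.length + (ws.length + 1) ∧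
      polyOf v = contribP gs qs f + X ^ r.length * (X * polyOf f)) us vs ∧
      Computes solver Fn.gens (.pair (.context r k qv qs ws gs) (.polys us)) (.polys vs)
        (us.length * vecCost qs.length k.length n) := by
  induction us with
  | nil =>
    refine ⟨[], .nil, ?_⟩
    rw [Computes, wpCall_solver Fn.gens rfl]
    simp [Body.gens]
  | cons u us ih =>
    obtain ⟨vs, h₁, h₂⟩ := ih
    obtain ⟨f, v, f₁, f₂, v₁, v₂, v₃⟩ := exists_computes_vec hw hl hq hwn 0 u [] [] (by simpa)
    refine ⟨v :: vs, .cons ⟨f, f₁, by simpa using f₂, v₁, by simpa using v₂⟩ h₁, ?_⟩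
    rw [Computes, wpCall_solver Fn.gens rfl]
    simp [Body.gens]
    refine Computes.wpCall v₃ fun b₁ hb₁ => Computes.wpCall h₂ fun b₂ hb₂ => ?_
    simp [add_one_mul] at hb₁ ⊢
    omega

end Vectors

/-! ### The solutions of the functional equation -/

section Functional

variable {F : Type*} [Field F]

/-- The unique polynomial of degree less than `N` with the given recursive coefficients. -/
def IsRecSol (N : ℕ) (w : ℕ → F) (κ : ℕ → ℕ → F) (a u f : F[X]) : Prop :=
  f.degree < N ∧ ∀ j < N, f.coeff j = u.coeff j + w j * (a.coeff j +
    ∑ i ∈ Finset.range j, f.coeff i * κ i j)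

namespace IsRecSol

variable {N : ℕ} {w : ℕ → F} {κ : ℕ → ℕ → F} {a a' u u' f f' : F[X]}

theorem add (h : IsRecSol N w κ a u f) (h' : IsRecSol N w κ a' u' f') :
    IsRecSol N w κ (a + a') (u + u') (f + f') := by
  refine ⟨(degree_add_le _ _).trans_lt (max_lt h.1 h'.1), fun j hj => ?_⟩
  simp only [coeff_add, add_mul, Finset.sum_add_distrib]
  rw [h.2 j hj, h'.2 j hj]
  ring

theorem C_mul (h : IsRecSol N w κ a u f) (c : F) :
    IsRecSol N w κ (C c * a) (C c * u) (C c * f) := by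
  refine ⟨by rw [← smul_eq_C_mul]; exact (degree_smul_le _ _).trans_lt h.1, fun j hj => ?_⟩
  simp only [coeff_C_mul, mul_assoc, ← Finset.mul_sum]
  rw [h.2 j hj]
  ring

theorem zero : IsRecSol N w κ 0 0 0 := ⟨by simp, by simp⟩

theorem unique (h : IsRecSol N w κ a u f) (h' : IsRecSol N w κ a u f') : f = f' := by
  ext j
  rcases lt_or_ge j N with hj | hj
  · induction j using Nat.strong_induction_on with
    | _ j ih =>
      have : ∀ i ∈ Finset.range j, f.coeff i * κ i j = f'.coeff i * κ i j := fun i hi => by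
        rw [Finset.mem_range] at hi
        rw [ih i hi (hi.trans hj)]
      rw [h.2 j hj, h'.2 j hj, Finset.sum_congr rfl this]
  · rw [coeff_eq_zero_of_degree_lt (h.1.trans_le (by exact_mod_cast hj)),
      coeff_eq_zero_of_degree_lt (h'.1.trans_le (by exact_mod_cast hj))]

theorem eq_zero_of_eq_zero (h : IsRecSol N w κ 0 u 0) {j : ℕ} (hj : j < N) : u.coeff j = 0 := by
  have := h.2 j hj
  simpa using this.symm

end IsRecSol

/-- The linear part `∑ i, Q i * f (γ ^ i * x)` of the functional equation. -/
noncomputable def shiftMap {m : ℕ} (γ : F) (Q : Fin (m + 1) → F[X]) : F[X] →ₗ[F] F[X] where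
  toFun f := ∑ i, Q i * f.comp (C (γ ^ (i : ℕ)) * X)
  map_add' f g := by simp [mul_add, Finset.sum_add_distrib]
  map_smul' c f := by simp [Finset.smul_sum]

variable {m : ℕ} {γ : F} {d D : ℕ} {Qt : F[X]} {Q : Fin (m + 1) → F[X]}

theorem mem_functionalSolutions {f : F[X]} :
    f ∈ functionalSolutions γ d (affinePoly Qt Q) ↔
      f.degree < (d + 1 : ℕ) ∧ Qt + shiftMap γ Q f = 0 := by
  rw [functionalSolutions, Set.mem_ofPred_eq, natDegree_le_iff_coeff_eq_zero,
    degree_lt_iff_coeff_zero]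
  simp [affinePoly, shiftMap]

end Functional
-- The functional equation in coefficients and its generators.
section Functional

variable {F : Type*} [Field F] {m : ℕ} {γ : F} {d D : ℕ} {Qt : F[X]} {Q : Fin (m + 1) → F[X]}

/-- The list of the first `n + 1` coefficients. -/
def coeffL (n : ℕ) (p : F[X]) : List F := (List.range (n + 1)).map p.coeff

@[simp] theorem length_coeffL (n : ℕ) (p : F[X]) : (coeffL n p).length = n + 1 := by
  simp [coeffL]

theorem getD_coeffL {n : ℕ} {p : F[X]} (h : p.natDegree ≤ n) (j : ℕ) :
    (coeffL n p).getD j 0 = p.coeff j := by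
  rcases lt_or_ge j (n + 1) with hj | hj
  · simp [coeffL, hj]
  · rw [List.getD_eq_default _ _ (by simpa), coeff_eq_zero_of_natDegree_lt (by omega)]

theorem polyOf_coeffL {n : ℕ} {p : F[X]} (h : p.natDegree ≤ n) : polyOf (coeffL n p) = p := by
  ext j
  rw [coeff_polyOf, getD_coeffL h]

/-- The value at `g` of the polynomial of the `l`-th coefficients. -/
def kernel (Q : Fin (m + 1) → F[X]) (l : ℕ) (g : F) : F := ∑ i, (Q i).coeff l * g ^ (i : ℕ)

theorem kern_ofFn {n : ℕ} (q : Fin n → List F) (l : ℕ) (g : F) :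
    kern l g (List.ofFn q) = ∑ i, (q i).getD l 0 * g ^ (i : ℕ) := by
  induction n with
  | zero => simp [kern]
  | succ n ih =>
    rw [List.ofFn_succ, kern, ih, Fin.sum_univ_succ, Finset.mul_sum]
    simp [pow_succ]
    exact Finset.sum_congr rfl fun i _ => by ring

theorem kern_coeffL (hQ : ∀ i, (Q i).natDegree ≤ D) (l : ℕ) (g : F) :
    kern l g (List.ofFn fun i => coeffL D (Q i)) = kernel Q l g := by
  rw [kern_ofFn, kernel]
  simp only [getD_coeffL (hQ _)]

theorem kern_map_drop (v l : ℕ) (g : F) (qs : List (List F)) :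
    kern l g (qs.map (·.drop v)) = kern (v + l) g qs := by
  induction qs with
  | nil => rfl
  | cons q qs ih => simp only [List.map_cons, kern, ih, getD_drop]

theorem eval_polyOf_map_getD (v : ℕ) (g : F) (qs : List (List F)) :
    (polyOf (qs.map (·.getD v 0))).eval g = kern v g qs := by
  induction qs with
  | nil => simp [kern]
  | cons q qs ih => simp only [List.map_cons, kern, polyOf_cons, eval_add, eval_C, eval_mul,
      eval_X, ih]

theorem coeff_shiftMap (f : F[X]) (n : ℕ) : (shiftMap γ Q f).coeff n =
    ∑ j ∈ Finset.range (n + 1), f.coeff j * kernel Q (n - j) (γ ^ j) := by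
  simp only [shiftMap, LinearMap.coe_mk, AddHom.coe_mk, finsetSum_coeff, mul_comm (Q _),
    coeff_mul, Finset.Nat.sum_antidiagonal_eq_sum_range_succ_mk, comp_C_mul_X_coeff]
  rw [Finset.sum_comm]
  refine Finset.sum_congr rfl fun j _ => ?_
  rw [kernel, Finset.mul_sum]
  refine Finset.sum_congr rfl fun i _ => ?_
  rw [← pow_mul, ← pow_mul]
  ring

theorem contribP_eq_shiftMap (hQ : ∀ i, (Q i).natDegree ≤ D) {N : ℕ} {f : List F}
    (hf : f.length ≤ N) :
    contribP ((List.range N).map fun i => γ ^ i) (List.ofFn fun i => coeffL D (Q i)) f =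
      shiftMap γ Q (polyOf f) := by
  ext n
  rw [coeff_contribP, coeff_shiftMap]
  refine Finset.sum_congr rfl fun j _ => ?_
  rw [coeff_polyOf, kern_coeffL hQ]
  rcases lt_or_ge j N with hj | hj
  · simp [hj]
  · rw [List.getD_eq_default _ _ (hf.trans hj), zero_mul, zero_mul]

theorem degree_shiftMap_lt (hQ : ∀ i, (Q i).natDegree ≤ D) {f : F[X]}
    (hf : f.degree < (d + 1 : ℕ)) : (shiftMap γ Q f).degree < (D + d + 1 : ℕ) := by
  rw [degree_lt_iff_coeff_zero]
  intro n hn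
  rw [coeff_shiftMap]
  refine Finset.sum_eq_zero fun j _ => ?_
  rcases le_or_gt (d + 1) j with h | h
  · rw [(degree_lt_iff_coeff_zero _ _).1 hf j h, zero_mul]
  · rw [kernel, Finset.sum_eq_zero, mul_zero]
    exact fun i _ => by rw [coeff_eq_zero_of_natDegree_lt ((hQ i).trans_lt (by omega)), zero_mul]

/-- The recursion satisfied by the solutions. -/
theorem isRecSol_of_shiftMap_eq {v N : ℕ} {a u f : F[X]} {h : F}
    (hv : ∀ i, ∀ l < v, (Q i).coeff l = 0) (ha : ∀ j, a.coeff j = Qt.coeff (v + j))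
    (hu : ∀ j < N, kernel Q v (γ ^ j) = 0 → u.coeff j = f.coeff j)
    (hu' : ∀ j < N, kernel Q v (γ ^ j) ≠ 0 → u.coeff j = 0)
    (hf : f.degree < N) (hs : C h * Qt + shiftMap γ Q f = 0) :
    IsRecSol N (fun j => -(kernel Q v (γ ^ j))⁻¹) (fun i j => kernel Q (v + (j - i)) (γ ^ i))
      (C h * a) u f := by
  refine ⟨hf, fun j hj => ?_⟩
  have h₁ := congrArg (coeff · (v + j)) hs
  simp only [coeff_add, coeff_C_mul, coeff_shiftMap, coeff_zero] at h₁
  -- Split off the last `v` summands: there the kernel index is below `v`, so they vanish. The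
  -- summand at `j` then carries the weight's denominator.
  rw [show v + j + 1 = j + 1 + v by ring, Finset.sum_range_add,
    Finset.sum_eq_zero (s := Finset.range v), add_zero, Finset.sum_range_succ,
    Nat.add_sub_cancel] at h₁
  · have h₂ : ∀ i ∈ Finset.range j, f.coeff i * kernel Q (v + j - i) (γ ^ i) =
        f.coeff i * kernel Q (v + (j - i)) (γ ^ i) := fun i hi => by
      rw [Finset.mem_range] at hi
      rw [Nat.add_sub_assoc hi.le]
    rw [Finset.sum_congr rfl h₂] at h₁
    rw [coeff_C_mul, ha]
    beta_reduce
    by_cases hk : kernel Q v (γ ^ j) = 0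
    · simp [hu j hj hk, hk]
    · rw [hu' j hj hk]
      field_simp
      linear_combination h₁
  · intro i hi
    rw [Finset.mem_range] at hi
    rw [kernel, Finset.sum_eq_zero, mul_zero]
    exact fun t _ => by rw [hv t _ (by omega), zero_mul]

theorem polyOf_unitL (j : ℕ) : polyOf (unitL F j) = X ^ j := by
  ext i
  rw [coeff_polyOf, getD_unitL, coeff_X_pow]

theorem coeff_comb_units {Z : List ℕ} (hZ : Z.Nodup) (a : ℕ → F) (j : ℕ) :
    (comb (fun t => a (Z.getD t 0)) (Z.map (unitL F))).coeff j = if j ∈ Z then a j else 0 := by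
  induction Z with
  | nil => simp [comb]
  | cons z Z ih =>
    rw [List.nodup_cons] at hZ
    simp only [List.map_cons, comb, List.getD_cons_zero, List.getD_cons_succ, coeff_add, ih hZ.2,
      coeff_C_mul, polyOf_unitL, coeff_X_pow, List.mem_cons]
    by_cases h : j = z
    · subst h
      simp [hZ.1]
    · simp [h]

theorem coeff_comb_units_getD {Z : List ℕ} (hZ : Z.Nodup) (c : ℕ → F) {t : ℕ}
    (ht : t < Z.length) : (comb c (Z.map (unitL F))).coeff (Z.getD t 0) = c t := by
  induction Z generalizing c t with
  | nil => simp at ht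
  | cons z Z ih =>
    rw [List.nodup_cons] at hZ
    simp only [List.map_cons, comb, coeff_add, coeff_C_mul, polyOf_unitL, coeff_X_pow]
    cases t with
    | zero =>
      have : (comb (fun i => c (i + 1)) (Z.map (unitL F))).coeff z = 0 := by
        rw [comb_eq_sum, finsetSum_coeff]
        refine Finset.sum_eq_zero fun i hi => ?_
        rw [Finset.mem_range, List.length_map] at hi
        have : z ≠ Z[i] := fun h => hZ.1 (h ▸ List.getElem_mem hi)
        simp [hi, polyOf_unitL, coeff_X_pow, this]
      simp [this]
    | succ t =>
      rw [List.length_cons, add_lt_add_iff_right] at ht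
      have : Z.getD t 0 ≠ z := fun h => hZ.1 (by
        rw [← h, List.getD_eq_getElem _ _ ht]
        exact List.getElem_mem ht)
      rw [List.getD_cons_succ, if_neg this, mul_zero, zero_add, ih hZ.2 _ ht]

theorem map_C_mul (T : F[X] →ₗ[F] F[X]) (c : F) (f : F[X]) : T (C c * f) = C c * T f := by
  rw [← smul_eq_C_mul, map_smul, smul_eq_C_mul]

theorem exists_isRecSol_comb {N R : ℕ} {w : ℕ → F} {κ : ℕ → ℕ → F} {T : F[X] →ₗ[F] F[X]}
    {us vs : List (List F)}
    (h : List.Forall₂ (fun u v => ∃ f, IsRecSol N w κ 0 (polyOf u) f ∧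
      polyOf v = T f + X ^ R * (X * f)) us vs) (c : ℕ → F) :
    ∃ f, IsRecSol N w κ 0 (comb c us) f ∧ comb c vs = T f + X ^ R * (X * f) := by
  induction h generalizing c with
  | nil => exact ⟨0, IsRecSol.zero, by simp [comb]⟩
  | cons h _ ih =>
    obtain ⟨f, h₁, h₂⟩ := h
    obtain ⟨g, h₃, h₄⟩ := ih fun i => c (i + 1)
    refine ⟨C (c 0) * f + g, ?_, ?_⟩
    · have := (h₁.C_mul (c 0)).add h₃
      rwa [mul_zero, add_zero] at this
    · rw [comb, h₂, h₄, map_add, map_C_mul]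
      ring

theorem eq_zero_of_degree_lt_of_eq_X_pow_mul {R : ℕ} {p y : F[X]} (hp : p.degree < R)
    (h : p = X ^ R * y) : p = 0 :=
  eq_zero_of_dvd_of_degree_lt ⟨y, h⟩ (by rwa [degree_X_pow])

section Generators

variable {v R : ℕ} {a f₀ : F[X]} {v₀ : List F} {vs : List (List F)} {Z : List ℕ}

/-- A combination of the generators has a residual of degree less than `R`. If the whole combination
is divisible by `X ^ R`, then so is the residual, which must therefore be zero. -/
theorem exists_comb_eq
    (hR : ∀ f : F[X], f.degree < (d + 1 : ℕ) → (shiftMap γ Q f).degree < R)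
    (hQt : Qt.degree < R)
    (h₀ : IsRecSol (d + 1) (fun j => -(kernel Q v (γ ^ j))⁻¹)
      (fun i j => kernel Q (v + (j - i)) (γ ^ i)) a 0 f₀)
    (hv₀ : polyOf v₀ = Qt + shiftMap γ Q f₀ + X ^ R * (1 + X * f₀))
    (hvs : List.Forall₂ (fun u w => ∃ f, IsRecSol (d + 1) (fun j => -(kernel Q v (γ ^ j))⁻¹)
      (fun i j => kernel Q (v + (j - i)) (γ ^ i)) 0 (polyOf u) f ∧
      polyOf w = shiftMap γ Q f + X ^ R * (X * f)) (Z.map (unitL F)) vs)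
    (c : ℕ → F) (x : F[X]) (hx : comb c (v₀ :: vs) = X ^ R * x) :
    ∃ f f', IsRecSol (d + 1) (fun j => -(kernel Q v (γ ^ j))⁻¹)
        (fun i j => kernel Q (v + (j - i)) (γ ^ i)) 0
        (comb (fun i => c (i + 1)) (Z.map (unitL F))) f' ∧
      f = C (c 0) * f₀ + f' ∧ x = C (c 0) + X * f ∧ f.degree < (d + 1 : ℕ) ∧
      C (c 0) * Qt + shiftMap γ Q f = 0 := by
  obtain ⟨f', h₁, h₂⟩ := exists_isRecSol_comb hvs fun i => c (i + 1)
  have hf : (C (c 0) * f₀ + f').degree < (d + 1 : ℕ) := ((h₀.C_mul (c 0)).add h₁).1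
  have e : shiftMap γ Q (C (c 0) * f₀ + f') = C (c 0) * shiftMap γ Q f₀ + shiftMap γ Q f' := by
    rw [map_add, map_C_mul]
  have h₃ : C (c 0) * Qt + shiftMap γ Q (C (c 0) * f₀ + f') =
      X ^ R * (x - (C (c 0) + X * (C (c 0) * f₀ + f'))) := by
    rw [comb, hv₀, h₂] at hx
    rw [e]
    linear_combination hx
  have h₄ : C (c 0) * Qt + shiftMap γ Q (C (c 0) * f₀ + f') = 0 := by
    refine eq_zero_of_degree_lt_of_eq_X_pow_mul ?_ h₃
    refine (degree_add_le _ _).trans_lt (max_lt ?_ (hR _ hf))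
    rw [← smul_eq_C_mul]
    exact (degree_smul_le _ _).trans_lt hQt
  rw [h₄] at h₃
  exact ⟨_, f', h₁, rfl, sub_eq_zero.1
    ((mul_eq_zero.1 h₃.symm).resolve_left (pow_ne_zero _ X_ne_zero)), hf, h₄⟩

/-- Conversely a solution satisfies the recursion, so it is determined by `h` and its coefficients
at the exceptional positions `Z`; these are the coordinates with respect to the generators. -/
theorem exists_comb_iff
    (hR : ∀ f : F[X], f.degree < (d + 1 : ℕ) → (shiftMap γ Q f).degree < R)
    (hQt : Qt.degree < R) (hv : ∀ i, ∀ l < v, (Q i).coeff l = 0)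
    (ha : ∀ j, a.coeff j = Qt.coeff (v + j))
    (hZ : ∀ j, j ∈ Z ↔ j < d + 1 ∧ kernel Q v (γ ^ j) = 0) (hZ' : Z.Nodup)
    (h₀ : IsRecSol (d + 1) (fun j => -(kernel Q v (γ ^ j))⁻¹)
      (fun i j => kernel Q (v + (j - i)) (γ ^ i)) a 0 f₀)
    (hv₀ : polyOf v₀ = Qt + shiftMap γ Q f₀ + X ^ R * (1 + X * f₀))
    (hvs : List.Forall₂ (fun u w => ∃ f, IsRecSol (d + 1) (fun j => -(kernel Q v (γ ^ j))⁻¹)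
      (fun i j => kernel Q (v + (j - i)) (γ ^ i)) 0 (polyOf u) f ∧
      polyOf w = shiftMap γ Q f + X ^ R * (X * f)) (Z.map (unitL F)) vs) (x : F[X]) :
    (∃ c, comb c (v₀ :: vs) = X ^ R * x) ↔ ∃ (h : F) (f : F[X]), x = C h + X * f ∧
      f.degree < (d + 1 : ℕ) ∧ C h * Qt + shiftMap γ Q f = 0 := by
  constructor
  · rintro ⟨c, hc⟩
    obtain ⟨f, _, _, _, h₁, h₂, h₃⟩ := exists_comb_eq hR hQt h₀ hv₀ hvs c x hc
    exact ⟨_, f, h₁, h₂, h₃⟩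
  · rintro ⟨h, f, rfl, hf, hs⟩
    obtain ⟨f', h₁, h₂⟩ := exists_isRecSol_comb hvs fun t => f.coeff (Z.getD t 0)
    have h₃ := isRecSol_of_shiftMap_eq hv ha
      (u := 0 + comb (fun t => f.coeff (Z.getD t 0)) (Z.map (unitL F))) (fun j hj hk => by
        rw [zero_add, coeff_comb_units hZ', if_pos ((hZ j).2 ⟨hj, hk⟩)])
      (fun j hj hk => by
        rw [zero_add, coeff_comb_units hZ', if_neg fun h => hk ((hZ j).1 h).2]) hf hs
    have h₄ := (h₀.C_mul h).add h₁
    rw [mul_zero, add_zero] at h₄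
    -- The given solution and the combination obey one recursion with the same data.
    obtain rfl := h₃.unique h₄
    refine ⟨consFn h fun t => (C h * f₀ + f').coeff (Z.getD t 0), ?_⟩
    rw [comb_consFn, hv₀, h₂]
    rw [map_add, map_C_mul] at hs
    linear_combination hs

/-- The coordinates can be read off the combination: `h` is the coefficient at the flag, and the
others are the coefficients of `f` at the positions `Z`. -/
theorem indep_generators
    (hR : ∀ f : F[X], f.degree < (d + 1 : ℕ) → (shiftMap γ Q f).degree < R)
    (hQt : Qt.degree < R)
    (hZ : ∀ j ∈ Z, j < d + 1) (hZ' : Z.Nodup)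
    (h₀ : IsRecSol (d + 1) (fun j => -(kernel Q v (γ ^ j))⁻¹)
      (fun i j => kernel Q (v + (j - i)) (γ ^ i)) a 0 f₀)
    (hv₀ : polyOf v₀ = Qt + shiftMap γ Q f₀ + X ^ R * (1 + X * f₀))
    (hvs : List.Forall₂ (fun u w => ∃ f, IsRecSol (d + 1) (fun j => -(kernel Q v (γ ^ j))⁻¹)
      (fun i j => kernel Q (v + (j - i)) (γ ^ i)) 0 (polyOf u) f ∧
      polyOf w = shiftMap γ Q f + X ^ R * (X * f)) (Z.map (unitL F)) vs) :
    Indep (v₀ :: vs) := by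
  intro c hc i hi
  obtain ⟨f, f', h₁, h₂, h₃, -, -⟩ :=
    exists_comb_eq hR hQt h₀ hv₀ hvs c 0 (by rw [hc, mul_zero])
  have hc0 : c 0 = 0 := by
    have := congrArg (coeff · 0) h₃
    simpa using this.symm
  rw [hc0, C_0, zero_add, zero_eq_mul] at h₃
  obtain rfl := h₃.resolve_left X_ne_zero
  rw [hc0, C_0, zero_mul, zero_add] at h₂
  subst h₂
  cases i with
  | zero => exact hc0
  | succ i =>
    have hl := hvs.length_eq
    rw [List.length_map] at hl
    have hi : i < Z.length := by simpa [hl] using hi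
    rw [← coeff_comb_units_getD hZ' (fun i => c (i + 1)) hi]
    refine h₁.eq_zero_of_eq_zero (hZ _ ?_)
    rw [List.getD_eq_getElem _ _ hi]
    exact List.getElem_mem hi

end Generators

end Functional
-- From linear bases to affine bases.
section Basis

variable {F : Type*} [Field F] {S : Set F[X]}

theorem isAffineBasisOf_empty (b : Fin 0 → F[X]) : IsAffineBasisOf b ∅ := by
  refine ⟨affineIndependent_of_subsingleton F b, ?_⟩
  rw [Set.range_eq_empty, AffineSubspace.span_empty, AffineSubspace.bot_coe]

theorem isAffineBasisOf_of_linearIndependent {n : ℕ} {b : Fin (n + 1) → F[X]} {e : Fin n → F[X]}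
    (hb : ∀ i, b i.succ = b 0 + e i) (he : LinearIndependent F e)
    (hS : ∀ f, f ∈ S ↔ f - b 0 ∈ Submodule.span F (Set.range e)) : IsAffineBasisOf b S := by
  constructor
  · rw [affineIndependent_iff_of_fintype]
    intro w hw h
    rw [Finset.weightedVSub_eq_linear_combination _ hw, Fin.sum_univ_succ] at h
    rw [Fin.sum_univ_succ] at hw
    simp only [hb, smul_add, Finset.sum_add_distrib, ← Finset.sum_smul] at h
    rw [← add_assoc, ← add_smul, hw, zero_smul, zero_add] at h
    have h' := Fintype.linearIndependent_iff.1 he _ h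
    simp only [h', Finset.sum_const_zero, add_zero] at hw
    exact Fin.cases hw h'
  · suffices h : affineSpan F (Set.range b) =
        AffineSubspace.mk' (b 0) (Submodule.span F (Set.range e)) by
      ext f
      rw [h, hS, SetLike.mem_coe, AffineSubspace.mem_mk', vsub_eq_sub]
    refine le_antisymm (affineSpan_le.2 ?_) fun f hf => ?_
    · rintro _ ⟨i, rfl⟩
      rw [SetLike.mem_coe, AffineSubspace.mem_mk', vsub_eq_sub]
      refine Fin.cases (by simp) (fun i => ?_) i
      rw [hb, add_sub_cancel_left]
      exact Submodule.subset_span ⟨i, rfl⟩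
    · rw [AffineSubspace.mem_mk', vsub_eq_sub] at hf
      have h0 : b 0 ∈ affineSpan F (Set.range b) := subset_affineSpan F _ ⟨0, rfl⟩
      have hle : Submodule.span F (Set.range e) ≤ (affineSpan F (Set.range b)).direction := by
        rw [Submodule.span_le]
        rintro _ ⟨i, rfl⟩
        rw [direction_affineSpan]
        have := vsub_mem_vectorSpan F (Set.mem_range_self (f := b) i.succ) (Set.mem_range_self 0)
        rwa [vsub_eq_sub, hb, add_sub_cancel_left] at this
      have := AffineSubspace.vadd_mem_of_mem_direction (hle hf) h0
      rwa [vadd_eq_add, sub_add_cancel] at this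

theorem comb_eq_sum_fin {n : ℕ} {vs : List (List F)} (hn : n = vs.length) (c : ℕ → F) :
    comb c vs = ∑ i : Fin n, c i • polyOf (vs.getD i []) := by
  rw [comb_eq_sum, Finset.sum_range, hn]
  simp only [smul_eq_C_mul]

theorem Indep.linearIndependent {n : ℕ} {vs : List (List F)} (h : Indep vs)
    (hn : n = vs.length) : LinearIndependent F fun i : Fin n => polyOf (vs.getD i []) := by
  rw [Fintype.linearIndependent_iff]
  intro g hg i
  have := h (fun i => if hi : i < n then g ⟨i, hi⟩ else 0) (by
    rw [comb_eq_sum_fin hn, ← hg]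
    simp) i (by omega)
  simpa using this

theorem mem_span_iff_exists_comb {n : ℕ} {vs : List (List F)} (hn : n = vs.length) (x : F[X]) :
    x ∈ Submodule.span F (Set.range fun i : Fin n => polyOf (vs.getD i [])) ↔
      ∃ c, comb c vs = x := by
  rw [Submodule.mem_span_range_iff_exists_fun]
  constructor
  · rintro ⟨g, hg⟩
    refine ⟨fun i => if hi : i < n then g ⟨i, hi⟩ else 0, ?_⟩
    rw [comb_eq_sum_fin hn, ← hg]
    simp
  · rintro ⟨c, hc⟩
    exact ⟨fun i => c i, by rw [← hc, comb_eq_sum_fin hn]⟩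

theorem isAffineBasisOf_addL {p : List F} {vs : List (List F)} (h : Indep vs)
    (hS : ∀ f, f ∈ S ↔ ∃ c, comb c vs = f - polyOf p) :
    IsAffineBasisOf (fun i : Fin (p :: vs.map (addL p)).length =>
      polyOf ((p :: vs.map (addL p)).get i)) S := by
  have hn : (vs.map (addL p)).length = vs.length := List.length_map _
  refine isAffineBasisOf_of_linearIndependent (n := (vs.map (addL p)).length) (fun i => ?_)
    (h.linearIndependent hn) fun f => by rw [mem_span_iff_exists_comb hn, hS]; rfl
  have hi : (i : ℕ) < vs.length := by have := i.2; omega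
  simp [hi]

/-- A nonzero head makes elimination consume a vector. This saves the one that turns `m + 1`
generators into dimension `m`. -/
theorem length_elimL_lt {vs : List (List F)} {p : List F} (h : pivotL vs = some p) :
    (elimL vs).length < vs.length := by
  induction vs with
  | nil => simp [pivotL] at h
  | cons v vs ih =>
    rw [pivotL] at h
    rw [elimL]
    split_ifs at h ⊢ with hv
    · simpa using ih h
    · simp [reduceL]

end Basis

/-! ### Reading the solution set off the eliminated vectors. -/

section Solutions

variable {F : Type*} [Field F] {m d R : ℕ} {γ : F} {Qt : F[X]} {Q : Fin (m + 1) → F[X]}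
  {vs : List (List F)}

/-- A solution would be a combination with flag 1, but without a pivot every combination has flag 0.
-/
theorem functionalSolutions_eq_empty
    (h : ∀ x, (∃ c, comb c vs = X ^ R * x) ↔ ∃ (h : F) (f : F[X]), x = C h + X * f ∧
      f.degree < (d + 1 : ℕ) ∧ C h * Qt + shiftMap γ Q f = 0)
    (hp : pivotL (elimNL R vs) = none) :
    functionalSolutions γ d (affinePoly Qt Q) = ∅ := by
  rw [Set.eq_empty_iff_forall_notMem]
  intro f hf
  rw [mem_functionalSolutions] at hf
  obtain ⟨c, hc⟩ := (exists_comb_elimNL_iff R vs _).2 ((h _).2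
    ⟨1, f, rfl, hf.1, by rw [C_1, one_mul, hf.2]⟩)
  have := pivotL_eq_none hp c
  rw [hc] at this
  simp at this

/-- The scaled pivot has flag 1, so `p` is a particular solution; flag 0 combinations are the
homogeneous solutions, that is, the differences from `p`. -/
theorem isAffineBasisOf_functionalSolutions
    (h : ∀ x, (∃ c, comb c vs = X ^ R * x) ↔ ∃ (h : F) (f : F[X]), x = C h + X * f ∧
      f.degree < (d + 1 : ℕ) ∧ C h * Qt + shiftMap γ Q f = 0)
    (hi : Indep vs) {p : List F} (hp : pivotL (elimNL R vs) = some p) :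
    IsAffineBasisOf (fun i : Fin (p :: (elimL (elimNL R vs)).map (addL p)).length =>
      polyOf ((p :: (elimL (elimNL R vs)).map (addL p)).get i))
      (functionalSolutions γ d (affinePoly Qt Q)) := by
  refine isAffineBasisOf_addL (indep_elimL (indep_elimNL R hi)) fun f => ?_
  obtain ⟨h', p', h₁, h₂, h₃⟩ := (h _).1 ((exists_comb_elimNL_iff R vs _).1 (pivotL_eq_some hp))
  have h₄ : h' = 1 := by
    have := congrArg (coeff · 0) h₁
    simpa using this.symm
  rw [h₄, C_1, add_right_inj, mul_right_inj' X_ne_zero] at h₁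
  rw [← h₁, h₄, C_1, one_mul] at h₃
  rw [← h₁] at h₂
  rw [exists_comb_elimL_iff, exists_comb_elimNL_iff, h, mem_functionalSolutions]
  constructor
  · rintro ⟨hf, hs⟩
    refine ⟨0, f - polyOf p, by simp, (degree_sub_le _ _).trans_lt (max_lt hf h₂), ?_⟩
    rw [map_sub, C_0]
    linear_combination hs - h₃
  · rintro ⟨a, g, e, hg, hs⟩
    have ha : a = 0 := by
      have := congrArg (coeff · 0) e
      simpa using this.symm
    rw [ha, C_0, zero_add, mul_right_inj' X_ne_zero] at e
    obtain rfl : f = polyOf p + g := by rw [← e]; ring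
    refine ⟨(degree_add_le _ _).trans_lt (max_lt h₂ hg), ?_⟩
    rw [ha, C_0] at hs
    rw [map_add]
    linear_combination hs + h₃

end Solutions
-- The number of generators and their computation.
section Main

variable {F : Type*} [Field F] {m d D : ℕ} {γ : F} {Qt : F[X]} {Q : Fin (m + 1) → F[X]}

theorem wpCall_append_ofNat {P : Val F → ℕ → Prop} (l : List F) (n : ℕ) :
    wpCall solver Fn.append (.pair (.poly l) (.ofNat n)) P ↔
      P (.ofList (l.map .elem ++ List.replicate n .nil)) 0 := by
  rw [Val.poly, Val.ofNat, wpCall_append]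

theorem exists_of_forall₂_of_mem {α β : Type*} {P : α → β → Prop} {l : List α} {l' : List β}
    (h : List.Forall₂ P l l') {b : β} (hb : b ∈ l') : ∃ a, P a b := by
  induction h with
  | nil => simp at hb
  | cons h _ ih =>
    rcases List.mem_cons.1 hb with rfl | hb
    · exact ⟨_, h⟩
    · exact ih hb

/-- The weights of the recursion satisfied by the solutions. -/
def weightL (γ : F) (d : ℕ) (Q : Fin (m + 1) → F[X]) (v : ℕ) : List F :=
  (List.range (d + 1)).map fun j => -(kernel Q v (γ ^ j))⁻¹

theorem map_range_eq_weightL (hQ : ∀ i, (Q i).natDegree ≤ D) (v : ℕ) :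
    (((List.range (d + 1)).map fun i => γ ^ i).map fun g => -((polyOf
      (((List.ofFn fun i => coeffL D (Q i)).map (·.drop v)).map (·.getD 0 0))).eval g)⁻¹) =
      weightL γ d Q v := by
  rw [weightL, List.map_map]
  refine List.map_congr_left fun j _ => ?_
  rw [Function.comp_apply, eval_polyOf_map_getD, kern_map_drop, kern_coeffL hQ, add_zero]

theorem getD_weightL {v j : ℕ} (hj : j < d + 1) :
    (weightL γ d Q v).getD j 0 = -(kernel Q v (γ ^ j))⁻¹ := by
  simp [weightL, hj]

theorem mem_zeros_weightL {v j : ℕ} :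
    j ∈ zeros (weightL γ d Q v) ↔ j < d + 1 ∧ kernel Q v (γ ^ j) = 0 := by
  rw [mem_zeros, show (weightL γ d Q v).length = d + 1 by simp [weightL]]
  refine and_congr_right fun hj => ?_
  rw [getD_weightL hj, neg_eq_zero, inv_eq_zero]

/-- Exceptional indices give distinct roots `γ ^ j` of the nonzero polynomial `∑ i, (Q i).coeff v *
X ^ i` of degree at most `m`. The order of `γ` enters through `hγ`. -/
theorem length_zeros_weightL_le (hγ : Set.InjOn (fun j : ℕ => γ ^ j) {j | j < d + 1}) {v : ℕ}
    (hv : ∃ i, (Q i).coeff v ≠ 0) : (zeros (weightL γ d Q v)).length ≤ m := by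
  set p : F[X] := ∑ i : Fin (m + 1), C ((Q i).coeff v) * X ^ (i : ℕ) with hp
  have hc : ∀ i : Fin (m + 1), p.coeff i = (Q i).coeff v := fun i => by
    simp [hp, coeff_X_pow, Fin.val_inj]
  have hp0 : p ≠ 0 := fun h => by
    obtain ⟨i, hi⟩ := hv
    exact hi (by rw [← hc, h, coeff_zero])
  have hd : p.natDegree ≤ m := by
    refine natDegree_sum_le_of_forall_le _ _ fun i _ => ?_
    exact (natDegree_C_mul_X_pow_le _ _).trans (by omega)
  have he : ∀ g, p.eval g = kernel Q v g := fun g => by simp [hp, kernel, eval_finsetSum]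
  have hn : ((zeros (weightL γ d Q v)).map fun j => γ ^ j).Nodup :=
    (nodup_zeros _).map_on fun i hi j hj h =>
      hγ (mem_zeros_weightL.1 hi).1 (mem_zeros_weightL.1 hj).1 h
  have hle : (((zeros (weightL γ d Q v)).map fun j => γ ^ j : List F) : Multiset F) ≤ p.roots := by
    rw [Multiset.le_iff_subset (Multiset.coe_nodup.2 hn)]
    intro x hx
    obtain ⟨j, hj, rfl⟩ := List.mem_map.1 (Multiset.mem_coe.1 hx)
    rw [mem_roots hp0, IsRoot, he]
    exact (mem_zeros_weightL.1 hj).2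
  have := (Multiset.card_le_card hle).trans ((card_roots' p).trans hd)
  simpa using this

variable (γ d D Qt Q) in
/-- The arguments shared by the computations of the generators. -/
def generatorContext (v : ℕ) : Val F :=
  .context ((coeffL D Qt).map .elem ++ List.replicate d .nil)
    (List.replicate (Nat.clog 2 (d + 1)) .nil)
    ((List.ofFn fun i => coeffL D (Q i)).map (·.drop v)) (List.ofFn fun i => coeffL D (Q i))
    (weightL γ d Q v) ((List.range (d + 1)).map fun i => γ ^ i)

theorem isRecSol_polyOf (hQ : ∀ i, (Q i).natDegree ≤ D) {v : ℕ} {a u f : List F}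
    (hf : f.length = d + 1)
    (h : ∀ j < d + 1, f.getD j 0 = u.getD j 0 + (weightL γ d Q v).getD j 0 * (a.getD j 0 +
      ∑ i ∈ Finset.range j, f.getD i 0 * kern (j - i)
        (((List.range (d + 1)).map fun i => γ ^ i).getD i 0)
          ((List.ofFn fun i => coeffL D (Q i)).map (·.drop v)))) :
    IsRecSol (d + 1) (fun j => -(kernel Q v (γ ^ j))⁻¹)
      (fun i j => kernel Q (v + (j - i)) (γ ^ i)) (polyOf a) (polyOf u) (polyOf f) := by
  refine ⟨hf ▸ degree_polyOf_lt f, fun j hj => ?_⟩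
  rw [coeff_polyOf, coeff_polyOf, coeff_polyOf, h j hj, getD_weightL hj]
  congr 3
  refine Finset.sum_congr rfl fun i hi => ?_
  rw [Finset.mem_range] at hi
  rw [coeff_polyOf, kern_map_drop, kern_coeffL hQ]
  simp [hi.trans hj]

/-- Connects the program with `exists_comb_iff` for `R = D + d + 1`, a strict bound for the degree
of every residual. -/
theorem exists_computes_generators (hQt : Qt.natDegree ≤ D) (hQ : ∀ i, (Q i).natDegree ≤ D)
    {v : ℕ} (hv : ∀ i, ∀ l < v, (Q i).coeff l = 0) :
    ∃ (w : List F) (ws : List (List F)),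
      Computes solver Fn.vec (.pair (generatorContext d D γ Qt Q v) (.pair (.elem 1)
        (.pair .nil (.pair (.poly ((coeffL D Qt).drop v)) (.poly (coeffL D Qt)))))) (.poly w)
        (vecCost (m + 1) (Nat.clog 2 (d + 1)) (D + d + 2) + (D + 1)) ∧
      Computes solver Fn.gens (.pair (generatorContext d D γ Qt Q v)
        (.polys ((zeros (weightL γ d Q v)).map (unitL F)))) (.polys ws)
        ((zeros (weightL γ d Q v)).length *
          vecCost (m + 1) (Nat.clog 2 (d + 1)) (D + d + 2)) ∧
      ws.length = (zeros (weightL γ d Q v)).length ∧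
      (∀ u ∈ w :: ws, u.length = (D + d + 1) + (d + 2)) ∧ Indep (w :: ws) ∧
      ∀ x, (∃ c, comb c (w :: ws) = X ^ (D + d + 1) * x) ↔ ∃ (h : F) (f : F[X]),
        x = C h + X * f ∧ f.degree < (d + 1 : ℕ) ∧ C h * Qt + shiftMap γ Q f = 0 := by
  have hwl : (weightL γ d Q v).length = d + 1 := by simp [weightL]
  set r : List (Val F) := (coeffL D Qt).map .elem ++ List.replicate d .nil with hr
  set k : List (Val F) := List.replicate (Nat.clog 2 (d + 1)) .nil with hk
  have hrl : r.length = D + d + 1 := by simp [hr]; ring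
  have hkl : k.length = Nat.clog 2 (d + 1) := by simp [hk]
  have hw : (weightL γ d Q v).length ≤ 2 ^ k.length := by
    rw [hwl, hkl]
    exact Nat.le_pow_clog (by norm_num) _
  have hl : ((List.ofFn fun i => coeffL D (Q i)).map (·.drop v)).length =
      (List.ofFn fun i => coeffL D (Q i)).length := List.length_map _
  have hq : ∀ q ∈ List.ofFn fun i => coeffL D (Q i),
      q.length + (weightL γ d Q v).length ≤ D + d + 2 := by
    intro q hq
    obtain ⟨i, rfl⟩ := (List.mem_ofFn' _ _).1 hq
    rw [length_coeffL, hwl]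
    omega
  have hcon : ∀ f : List F, f.length = d + 1 →
      contribP ((List.range (d + 1)).map fun i => γ ^ i) (List.ofFn fun i => coeffL D (Q i)) f =
        shiftMap γ Q (polyOf f) := fun f hf => contribP_eq_shiftMap hQ hf.le
  have hR : ∀ f : F[X], f.degree < (d + 1 : ℕ) →
      (shiftMap γ Q f).degree < (D + d + 1 : ℕ) := fun f => degree_shiftMap_lt hQ
  have hQt' : Qt.degree < (D + d + 1 : ℕ) := by
    refine degree_le_natDegree.trans_lt ?_
    exact_mod_cast (by omega : Qt.natDegree < D + d + 1)
  have hRl : ∀ f : List F, f.length = (weightL γ d Q v).length →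
      (contribP ((List.range (d + 1)).map fun i => γ ^ i)
        (List.ofFn fun i => coeffL D (Q i)) f).degree < r.length := fun f hf => by
    rw [hwl] at hf
    rw [hcon f hf, hrl]
    exact hR _ (hf ▸ degree_polyOf_lt f)
  have hRl' : ∀ f : List F, f.length = (weightL γ d Q v).length →
      (polyOf (coeffL D Qt) + contribP ((List.range (d + 1)).map fun i => γ ^ i)
        (List.ofFn fun i => coeffL D (Q i)) f).degree < r.length := fun f hf => by
    refine (degree_add_le _ _).trans_lt (max_lt ?_ (hRl f hf))
    rwa [polyOf_coeffL hQt, hrl]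
  obtain ⟨f, w, f₁, f₂, w₁, w₂, w₃⟩ := exists_computes_vec hw hl hq (by rw [hwl]; omega) 1 []
    ((coeffL D Qt).drop v) (coeffL D Qt) hRl'
  obtain ⟨ws, h₁, h₂⟩ := exists_computes_gens hw hl hq (by rw [hwl]; omega) hRl
    ((zeros (weightL γ d Q v)).map (unitL F))
  rw [hwl] at f₁ f₂ w₁
  rw [hcon f f₁, polyOf_coeffL hQt, hrl, C_1] at w₂
  rw [List.length_ofFn, hkl] at w₃ h₂
  rw [length_coeffL] at w₃
  rw [List.length_map] at h₂
  have hf := isRecSol_polyOf hQ f₁ f₂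
  have ha : ∀ j, (polyOf ((coeffL D Qt).drop v)).coeff j = Qt.coeff (v + j) := fun j => by
    rw [coeff_polyOf, getD_drop, getD_coeffL hQt]
  have hlen := h₁.length_eq
  rw [List.length_map] at hlen
  have h₃ : List.Forall₂ (fun u w => ∃ f, IsRecSol (d + 1) (fun j => -(kernel Q v (γ ^ j))⁻¹)
      (fun i j => kernel Q (v + (j - i)) (γ ^ i)) 0 (polyOf u) f ∧
      polyOf w = shiftMap γ Q f + X ^ (D + d + 1) * (X * f))
      ((zeros (weightL γ d Q v)).map (unitL F)) ws := by
    refine h₁.imp fun u w ⟨f, f₁, f₂, _, f₄⟩ => ⟨polyOf f, ?_, ?_⟩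
    · rw [hwl] at f₁ f₂
      refine isRecSol_polyOf (a := []) hQ f₁ ?_
      simpa using f₂
    · rw [hwl] at f₁
      rw [f₄, hcon f f₁, hrl]
  have h₄ : ∀ u ∈ ws, u.length = (D + d + 1) + (d + 2) := by
    intro u hu
    obtain ⟨_, _, _, _, h, _⟩ := exists_of_forall₂_of_mem h₁ hu
    rw [h, hrl, hwl]
  refine ⟨w, ws, w₃, h₂, hlen.symm, ?_, ?_, ?_⟩
  · simp only [List.mem_cons, forall_eq_or_imp]
    exact ⟨by rw [w₁, hrl], h₄⟩
  · exact indep_generators hR hQt' (fun j hj => (mem_zeros_weightL.1 hj).1) (nodup_zeros _) hf w₂ h₃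
  · exact exists_comb_iff hR hQt' hv ha (fun j => mem_zeros_weightL) (nodup_zeros _) hf w₂ h₃

end Main
-- The run of the main function.
section Main

variable {F : Type*} [Field F] {m d D : ℕ} {γ : F} {Qt : F[X]} {Q : Fin (m + 1) → F[X]}

/-- The cost of the solver, where `l` bounds the number of generators. -/
def mainCost (D d q l : ℕ) : ℕ :=
  (d + 1) + (D + 1) * q + (d + 1) * (2 * q + 3) + (d + 1) +
    (vecCost q (Nat.clog 2 (d + 1)) (D + d + 2) + (D + 1)) +
    l * vecCost q (Nat.clog 2 (d + 1)) (D + d + 2) +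
    ((D + d + 1) * l + l * (1 + l * (2 + 2 * (D + d + 1 + (d + 2))))) + (l + (d + 1) + 1) +
    (l + 1 + l * (2 + 2 * (d + 1))) + l * (d + 1)

/-- If all `Q_i` vanish, the program stops after the normalization, so the bound holds for every
`l`. -/
theorem computes_main_nil
    (h : Computes solver Fn.norm (.pair (.poly (coeffL D Qt))
      (.polys (List.ofFn fun i => coeffL D (Q i)))) .nil
      ((D + 1) * (List.ofFn fun i => coeffL D (Q i)).length)) (l : ℕ) :
    Computes solver Fn.main (.pair (.elem γ) (.pair (.ofNat d)
      (.polys (coeffL D Qt :: List.ofFn fun i => coeffL D (Q i))))) .nil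
      (mainCost D d (m + 1) l) := by
  have hp := computes_powers (Val.nil :: List.replicate d Val.nil) γ 1
  rw [List.length_ofFn] at h
  simp only [Val.ofList_cons] at hp
  generalize (List.ofFn fun i => coeffL D (Q i)) = qs at h ⊢
  generalize coeffL D Qt = qt at h ⊢
  rw [Computes, wpCall_solver Fn.main rfl]
  simp [Body.main, Val.ofNat]
  refine Computes.wpCall hp fun c₁ hc₁ => Computes.wpCall h fun c₂ hc₂ => ?_
  simp at hc₁
  simp [mainCost]
  omega

theorem computes_main {v : ℕ} {w : List F} {ws : List (List F)} {l : ℕ}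
    (hQ : ∀ i, (Q i).natDegree ≤ D)
    (h : Computes solver Fn.norm (.pair (.poly (coeffL D Qt))
      (.polys (List.ofFn fun i => coeffL D (Q i))))
      (.pair (.poly ((coeffL D Qt).drop v))
        (.polys ((List.ofFn fun i => coeffL D (Q i)).map (·.drop v))))
      ((D + 1) * (List.ofFn fun i => coeffL D (Q i)).length))
    (hw : Computes solver Fn.vec (.pair (generatorContext d D γ Qt Q v) (.pair (.elem 1)
        (.pair .nil (.pair (.poly ((coeffL D Qt).drop v)) (.poly (coeffL D Qt)))))) (.poly w)
        (vecCost (m + 1) (Nat.clog 2 (d + 1)) (D + d + 2) + (D + 1)))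
    (hws : Computes solver Fn.gens (.pair (generatorContext d D γ Qt Q v)
        (.polys ((zeros (weightL γ d Q v)).map (unitL F)))) (.polys ws)
        (ws.length * vecCost (m + 1) (Nat.clog 2 (d + 1)) (D + d + 2)))
    (hl : ∀ u ∈ w :: ws, u.length = (D + d + 1) + (d + 2)) (hl' : ws.length + 1 ≤ l) :
    Computes solver Fn.main (.pair (.elem γ) (.pair (.ofNat d)
      (.polys (coeffL D Qt :: List.ofFn fun i => coeffL D (Q i)))))
      ((pivotL (elimNL (D + d + 1) (w :: ws))).elim .nil fun p =>
        .polys (p :: (elimL (elimNL (D + d + 1) (w :: ws))).map (addL p)))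
      (mainCost D d (m + 1) l) := by
  have hp := computes_powers (Val.nil :: List.replicate d Val.nil) γ 1
  have hwt := computes_weights (((List.ofFn fun i => coeffL D (Q i)).map (·.drop v)).map
    (·.getD 0 0)) ((List.range (d + 1)).map fun i => γ ^ i)
  rw [map_range_eq_weightL hQ] at hwt
  have hL : ((coeffL D Qt).map Val.elem ++ List.replicate d Val.nil).length = D + d + 1 := by
    simp
    ring
  have he := computes_elimN (n := (coeffL D Qt).map Val.elem ++ List.replicate d Val.nil)
    (vs := w :: ws) (l := d + 2) (by rwa [hL])
  rw [hL] at he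
  have hm := length_of_mem_elimNL hl
  have hle := length_elimNL_le (D + d + 1) (w :: ws)
  have hpv := computes_pivot (n := d + 1) fun u hu => (hm u hu).le
  obtain ⟨ce, he₁, he₂⟩ := computes_elim (n := d + 1) fun u hu => (hm u hu).le
  have hcl := fun P => wpCall_clog_two (Q := P) (weightL γ d Q v)
  have hwl : (weightL γ d Q v).length = d + 1 := by simp [weightL]
  rw [hwl] at hcl
  simp only [List.length_map, List.length_range, List.length_ofFn] at hwt h
  simp only [Val.ofList_cons] at hp
  simp only [List.length_cons, List.length_replicate, one_mul] at hp
  rw [generatorContext, Val.context] at hw hws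
  simp only [Val.polys_cons] at he
  generalize (List.ofFn fun i => coeffL D (Q i)) = qs at *
  generalize coeffL D Qt = qt at *
  generalize hV : elimNL (D + d + 1) (w :: ws) = V at *
  rw [Computes, wpCall_solver Fn.main rfl]
  simp [Body.main, wpCall_append_ofNat]
  simp only [Val.ofNat] at *
  refine Computes.wpCall hp fun c₁ hc₁ => Computes.wpCall h fun c₂ hc₂ => ?_
  simp only [Val.onList_pair, wpCall_heads]
  refine Computes.wpCall hwt fun c₃ hc₃ => ?_
  rw [hcl]
  refine Computes.wpCall hw fun c₄ hc₄ => ?_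
  rw [wpCall_units]
  refine Computes.wpCall hws fun c₅ hc₅ => Computes.wpCall he fun c₆ hc₆ =>
    Computes.wpCall hpv fun c₇ hc₇ => ?_
  rw [hwl]
  simp only [List.length_cons] at hc₆ hle
  have k₅ : c₅ ≤ l * vecCost (m + 1) (Nat.clog 2 (d + 1)) (D + d + 2) :=
    hc₅.trans (Nat.mul_le_mul_right _ (by omega))
  have k₆ : c₆ ≤ (D + d + 1) * l + l * (1 + l * (2 + 2 * (D + d + 1 + (d + 2)))) :=
    hc₆.trans (by gcongr)
  have hVl : V.length ≤ l := hle.trans hl'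
  cases hpc : pivotL V with
  | none =>
    simp [mainCost]
    omega
  | some p =>
    have hlp := length_pivotL hpc hm
    have hla := computes_addAll p (elimL V)
    have hlt := length_elimL_le V
    have k₈ : ce ≤ l + 1 + l * (2 + 2 * (d + 1)) := by
      rcases he₂ with he₂ | ⟨he₂, -⟩
      · omega
      · exact he₂.trans (by gcongr)
    have k₉ : (elimL V).length * p.length ≤ l * (d + 1) := by
      rw [hlp]
      exact Nat.mul_le_mul_right _ (by omega)
    simp
    refine Computes.wpCall he₁ fun c₈ hc₈ => Computes.wpCall hla fun c₉ hc₉ => ⟨rfl, ?_⟩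
    rw [mainCost]
    omega

end Main
-- The total cost.
section Cost

theorem mulBound_le {n b : ℕ} (hb : Nat.log 2 (n + 2) ≤ b) :
    mulBound n ≤ 10 ^ 11 * ((n + 1) * b ^ 12) := by
  rw [mulBound]
  gcongr

theorem solveCost_le {q k b : ℕ} (hb : ∀ j < k, Nat.log 2 (3 * 2 ^ j + 2) ≤ b) :
    solveCost q k ≤ 2 ^ k * (2 + k * (q * (10 ^ 11 * (4 * b ^ 12) + 6) + 3)) := by
  induction k with
  | zero => simp [solveCost]
  | succ k ih =>
    have h₁ := ih fun j hj => hb j (by omega)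
    have h₂ : mulBound (3 * 2 ^ k) ≤ 2 ^ k * (10 ^ 11 * (4 * b ^ 12)) := by
      refine (mulBound_le (hb k (by omega))).trans ?_
      calc 10 ^ 11 * ((3 * 2 ^ k + 1) * b ^ 12)
          ≤ 10 ^ 11 * ((3 * 2 ^ k + 2 ^ k) * b ^ 12) := by
            gcongr
            exact Nat.one_le_two_pow
        _ = _ := by ring
    calc solveCost q (k + 1)
        ≤ 2 * (2 ^ k * (2 + k * (q * (10 ^ 11 * (4 * b ^ 12) + 6) + 3))) +
          q * (2 ^ k * (10 ^ 11 * (4 * b ^ 12)) + 6 * 2 ^ k) + 3 * 2 ^ k := by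
          rw [solveCost]
          gcongr
      _ ≤ 2 * (2 ^ k * (2 + k * (q * (10 ^ 11 * (4 * b ^ 12) + 6) + 3))) +
          2 * (q * (2 ^ k * (10 ^ 11 * (4 * b ^ 12)) + 6 * 2 ^ k) + 3 * 2 ^ k) := by omega
      _ = _ := by ring

theorem log_mul_four_le {n : ℕ} (hn : 2 ≤ n) : Nat.log 2 (n * 4) ≤ 3 * Nat.log 2 n := by
  have h₁ : Nat.log 2 (n * 4) = Nat.log 2 n + 2 := by
    rw [show n * 4 = n * 2 * 2 by ring, Nat.log_mul_base (by norm_num) (by omega),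
      Nat.log_mul_base (by norm_num) (by omega)]
  have h₂ : 1 ≤ Nat.log 2 n := Nat.log_pos (by norm_num) hn
  omega

/-- All product lengths are at most a small multiple of `n`, and `log (4 * n) ≤ 3 * log n`, whence
`531441 = 3 ^ 12`. The recursion depth supplies the thirteenth logarithm. -/
theorem vecCost_le {q N n : ℕ} (hN : 1 ≤ N) (hn : N + 1 ≤ n) (hq : 1 ≤ q) :
    vecCost q (Nat.clog 2 N) n ≤ 10 ^ 19 * (n * q * Nat.log 2 n ^ 13) := by
  set L := Nat.log 2 n with hL
  have hn2 : 2 ≤ n := by omega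
  have hL1 : 1 ≤ L := Nat.log_pos (by norm_num) hn2
  have h4 := log_mul_four_le hn2
  rw [← hL] at h4
  set k := Nat.clog 2 N with hk
  have hpow : ∀ j < k, 2 ^ j < N := fun j hj => (Nat.lt_clog_iff_pow_lt (by norm_num)).1 hj
  have h2k : 2 ^ k ≤ 2 * n := by
    rcases Nat.eq_zero_or_pos k with h | h
    · rw [h]
      omega
    · obtain ⟨j, hj⟩ := Nat.exists_eq_add_of_le' h
      have := hpow j (by omega)
      rw [hj, pow_succ]
      omega
  have hkL : k ≤ 2 * L := by
    rcases Nat.eq_zero_or_pos k with h | h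
    · rw [h]
      omega
    · obtain ⟨j, hj⟩ := Nat.exists_eq_add_of_le' h
      have h₁ := hpow j (by omega)
      have h₂ : j ≤ L := Nat.le_log_of_pow_le (by norm_num) (by omega)
      omega
  have h₁ : solveCost q k ≤ 2 ^ k * (2 + k * (q * (10 ^ 11 * (4 * (3 * L) ^ 12) + 6) + 3)) :=
    solveCost_le fun j hj => (Nat.log_mono_right (by have := hpow j hj; omega)).trans h4
  have h₂ : mulBound n ≤ 10 ^ 11 * ((n + 1) * (3 * L) ^ 12) :=
    mulBound_le ((Nat.log_mono_right (by omega)).trans h4)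
  have hY : 1 ≤ L ^ 12 := Nat.one_le_pow _ _ hL1
  have e : (3 * L) ^ 12 = 531441 * L ^ 12 := by rw [mul_pow]; norm_num
  rw [e] at h₁ h₂
  rw [show L ^ 13 = L ^ 12 * L from pow_succ L 12]
  generalize L ^ 12 = Y at *
  have hqY : 1 ≤ q * Y := Nat.mul_pos hq hY
  have hqYL : 1 ≤ q * Y * L := Nat.mul_pos hqY hL1
  have h₃ : q * (10 ^ 11 * (4 * (531441 * Y)) + 6) + 3 ≤ 3 * 10 ^ 17 * (q * Y) := by
    have : q ≤ q * Y := Nat.le_mul_of_pos_right _ hY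
    calc _ = 10 ^ 11 * 4 * 531441 * (q * Y) + 6 * q + 3 := by ring
      _ ≤ _ := by omega
  have h₄ : solveCost q k ≤ 2 * 10 ^ 18 * (n * (q * Y * L)) :=
    calc solveCost q k ≤ 2 * n * (2 + 2 * L * (3 * 10 ^ 17 * (q * Y))) :=
          h₁.trans (by gcongr)
      _ = n * (4 + 12 * 10 ^ 17 * (q * Y * L)) := by ring
      _ ≤ n * (2 * 10 ^ 18 * (q * Y * L)) := by
        gcongr
        omega
      _ = _ := by ring
  have h₅ : q * (mulBound n + 2 * n) + n ≤ 10 ^ 18 * (n * (q * Y * L)) :=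
    calc q * (mulBound n + 2 * n) + n
        ≤ q * (10 ^ 11 * ((n + n) * (531441 * Y)) + 2 * n) + n := by
          gcongr
          refine h₂.trans ?_
          gcongr
          omega
      _ = n * (2 * 10 ^ 11 * 531441 * (q * Y) + 2 * q + 1) := by ring
      _ ≤ n * (10 ^ 18 * (q * Y * L)) := by
        have h₆ : q ≤ q * Y := Nat.le_mul_of_pos_right _ hY
        have h₇ : q * Y ≤ q * Y * L := Nat.le_mul_of_pos_right _ hL1
        gcongr
        omega
      _ = _ := by ring
  calc vecCost q k n = solveCost q k + (q * (mulBound n + 2 * n) + n) := by rw [vecCost, add_assoc]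
    _ ≤ 10 ^ 19 * (n * (q * Y * L)) := by omega
    _ = _ := by ring

theorem mainCost_le (D d m : ℕ) : mainCost D d (m + 1) (m + 1) ≤
    10 ^ 20 * ((D + d + 1) * (m + 1) ^ 2 * Nat.log 2 (D + d + 2) ^ 13) := by
  have hv := vecCost_le (q := m + 1) (N := d + 1) (n := D + d + 2) (by omega) (by omega) (by omega)
  have hL : 1 ≤ Nat.log 2 (D + d + 2) ^ 13 :=
    Nat.one_le_pow _ _ (Nat.log_pos (by norm_num) (by omega))
  rw [mainCost]
  generalize vecCost (m + 1) (Nat.clog 2 (d + 1)) (D + d + 2) = V at *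
  generalize Nat.log 2 (D + d + 2) ^ 13 = Y at *
  generalize hM : m + 1 = M at *
  have hM1 : 1 ≤ M := by omega
  have hle : D + d + 2 ≤ 2 * (D + d + 1) := by omega
  obtain ⟨s, hs⟩ : ∃ s, s = D + d + 1 := ⟨_, rfl⟩
  have hd : d + 1 ≤ s := by omega
  have hD : D + 1 ≤ s := by omega
  rw [← hs] at hle ⊢
  have hs1 : 1 ≤ s := by omega
  have k₁ : s ≤ s * M := Nat.le_mul_of_pos_right _ hM1
  have k₂ : s * M ≤ s * M ^ 2 := by
    rw [pow_two, ← mul_assoc]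
    exact Nat.le_mul_of_pos_right _ hM1
  have k₃ : s * M ^ 2 ≤ s * M ^ 2 * Y := Nat.le_mul_of_pos_right _ hL
  have k₄ : M ≤ s * M := Nat.le_mul_of_pos_left _ hs1
  have k₅ : (D + 1) * M ≤ s * M := by gcongr
  have k₆ : (d + 1) * (2 * M + 3) ≤ 2 * (s * M) + 3 * s := by
    calc (d + 1) * (2 * M + 3) ≤ s * (2 * M + 3) := by gcongr
      _ = _ := by ring
  have k₇ : M * (d + 1) ≤ s * M := by
    rw [mul_comm]
    gcongr
  have k₈ : M * (2 + 2 * (d + 1)) ≤ 2 * M + 2 * (s * M) := by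
    calc M * (2 + 2 * (d + 1)) ≤ M * (2 + 2 * s) := by gcongr
      _ = _ := by ring
  have k₉ : M * (1 + M * (2 + 2 * (s + (d + 2)))) ≤ M + 8 * (s * M ^ 2) := by
    calc M * (1 + M * (2 + 2 * (s + (d + 2)))) ≤ M * (1 + M * (8 * s)) := by
          gcongr
          omega
      _ = _ := by ring
  have k₀ : V ≤ 2 * 10 ^ 19 * (s * M * Y) :=
    hv.trans (by
      calc 10 ^ 19 * ((D + d + 2) * M * Y) ≤ 10 ^ 19 * (2 * s * M * Y) := by gcongr
        _ = _ := by ring)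
  have k₁₀ : M * V ≤ 2 * 10 ^ 19 * (s * M ^ 2 * Y) := by
    calc M * V ≤ M * (2 * 10 ^ 19 * (s * M * Y)) := by gcongr
      _ = _ := by ring
  have k₁₁ : s * M * Y ≤ s * M ^ 2 * Y := by gcongr
  omega

end Cost

/-! ### Assembling correctness, encoding and cost. -/

section Solver

variable {F : Type*} [Field F] {m d D : ℕ} {Qt : F[X]} {Q : Fin (m + 1) → F[X]}

/-- `orderOf γ = 0` encodes infinite order, where all powers are distinct. -/
theorem injOn_pow {γ : Fˣ} (hγ : orderOf γ = 0 ∨ d < orderOf γ) :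
    Set.InjOn (fun j : ℕ => (γ : F) ^ j) {j | j < d + 1} := by
  intro i hi j hj h
  have h' : γ ^ i = γ ^ j := Units.ext (by simpa using h)
  rcases hγ with h0 | hd
  · exact (injective_pow_iff_not_isOfFinOrder.2 (orderOf_eq_zero_iff.1 h0)) h'
  · exact pow_injOn_Iio_orderOf (Set.mem_Iio.2 (lt_of_le_of_lt (Nat.lt_succ_iff.1 hi) hd))
      (Set.mem_Iio.2 (lt_of_le_of_lt (Nat.lt_succ_iff.1 hj) hd)) h'

/-- The solver computes an affine basis of the solutions. -/
theorem exists_computes_solutions {γ : Fˣ} (hγ : orderOf γ = 0 ∨ d < orderOf γ)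
    (h0 : affinePoly Qt Q ≠ 0) (hQt : Qt.natDegree ≤ D) (hQ : ∀ i, (Q i).natDegree ≤ D) :
    ∃ L : List (List F), (∀ l ∈ L, l.length = d + 1) ∧ L.length ≤ m + 1 ∧
      IsAffineBasisOf (fun i : Fin L.length => polyOf (L.get i))
        (functionalSolutions (γ : F) d (affinePoly Qt Q)) ∧
      Computes solver Fn.main (.pair (.elem (γ : F)) (.pair (.ofNat d)
        (.polys (coeffL D Qt :: List.ofFn fun i => coeffL D (Q i))))) (.polys L)
        (mainCost D d (m + 1) (m + 1)) := by
  have hmem : ∀ i, coeffL D (Q i) ∈ List.ofFn fun i => coeffL D (Q i) :=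
    fun i => (List.mem_ofFn' _ _).2 ⟨i, rfl⟩
  rcases computes_norm (D + 1) (coeffL D Qt) (List.ofFn fun i => coeffL D (Q i)) (by simp)
    (fun q hq => by
      obtain ⟨i, rfl⟩ := (List.mem_ofFn' _ _).1 hq
      simp) with ⟨v, h₁, ⟨q, hq, h₂⟩, h₃⟩ | ⟨h₁, h₂⟩
  · have hv : ∀ i, ∀ l < v, (Q i).coeff l = 0 := fun i l hl => by
      rw [← getD_coeffL (hQ i)]
      exact h₁ _ (hmem i) l hl
    obtain ⟨i, rfl⟩ := (List.mem_ofFn' _ _).1 hq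
    rw [getD_coeffL (hQ i)] at h₂
    have hz := length_zeros_weightL_le (injOn_pow hγ) (Q := Q) ⟨i, h₂⟩
    obtain ⟨w, ws, g₁, g₂, g₃, g₄, g₅, g₆⟩ := exists_computes_generators (γ := (γ : F)) (d := d)
      hQt hQ hv
    rw [← g₃] at g₂ hz
    have hm := computes_main (l := m + 1) hQ h₃ g₁ g₂ g₄ (by omega)
    cases hp : pivotL (elimNL (D + d + 1) (w :: ws)) with
    | none =>
      rw [hp] at hm
      refine ⟨[], by simp, by simp, ?_, hm⟩
      rw [functionalSolutions_eq_empty g₆ hp]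
      exact isAffineBasisOf_empty _
    | some p =>
      rw [hp] at hm
      have hl := length_of_mem_elimNL g₄
      refine ⟨_, ?_, ?_, isAffineBasisOf_functionalSolutions g₆ g₅ hp, hm⟩
      · have hpl := length_pivotL hp hl
        simp only [List.mem_cons, List.mem_map, forall_eq_or_imp]
        refine ⟨hpl, ?_⟩
        rintro _ ⟨u, hu, rfl⟩
        rw [length_addL, hpl, length_of_mem_elimL hl u hu, max_self]
      · have k₁ := length_elimL_lt hp
        have k₂ := length_elimNL_le (D + d + 1) (w :: ws)
        simp only [List.length_cons, List.length_map] at k₁ k₂ ⊢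
        omega
  -- All `Q_i` vanish, so a solution would force `Q̃ = 0` and hence the whole polynomial to be zero.
  · have hQ0 : Q = 0 := funext fun i => by
      rw [← polyOf_coeffL (hQ i), h₁ _ (hmem i)]
      rfl
    have hS : functionalSolutions (γ : F) d (affinePoly Qt Q) = ∅ := by
      rw [Set.eq_empty_iff_forall_notMem]
      intro f hf
      have hf := (mem_functionalSolutions.1 hf).2
      refine h0 ?_
      rw [hQ0] at hf ⊢
      have : Qt = 0 := by simpa [shiftMap] using hf
      simp [affinePoly, this]
    refine ⟨[], by simp, by simp, ?_, computes_main_nil h₂ _⟩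
    rw [hS]
    exact isAffineBasisOf_empty _

theorem coeffVec_eq (n : ℕ) (p : F[X]) : Val.coeffVec n p = Val.poly (coeffL n p) := by
  rw [Val.coeffVec, Val.poly, coeffL, List.map_map]
  rfl

theorem solverInput_eq (γ : F) : solverInput γ d D Qt Q = .pair (.elem γ) (.pair (.ofNat d)
    (.polys (coeffL D Qt :: List.ofFn fun i => coeffL D (Q i)))) := by
  simp only [solverInput, coeffVec_eq, Val.polys, List.map_cons, List.map_ofFn]
  rfl

theorem coeffL_polyOf {l : List F} (hl : l.length = d + 1) : coeffL d (polyOf l) = l := by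
  refine List.ext_getElem (by simp [hl]) fun i h₁ h₂ => ?_
  simp [coeffL, coeff_polyOf, h₂]

theorem solverOutput_eq {L : List (List F)} (hL : ∀ l ∈ L, l.length = d + 1) :
    solverOutput d (fun i : Fin L.length => polyOf (L.get i)) = .polys L := by
  have : (fun j : Fin L.length => Val.coeffVec d (polyOf (L.get j))) =
      fun j => Val.poly (L.get j) := funext fun j => by
    rw [coeffVec_eq, coeffL_polyOf (hL _ (List.get_mem _ _))]
  rw [solverOutput, this, Val.polys]
  congr 1
  refine List.ext_getElem (by simp) fun i h₁ h₂ => by simp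

theorem Computes.runs {P : Program} {u v : Val F} {c : ℕ} (h : Computes P 0 u v c) :
    ∃ c' ≤ c, P.Runs u v c' := by
  obtain ⟨b, hb, _, c', h, rfl, hc⟩ := h
  exact ⟨0 + c', by omega, .call (.var rfl) hb h⟩

end Solver

end FieldAlg

theorem mainTheorem5 :
    (∀ (F : Type u) [Field F] (γ : Fˣ) (d D m : ℕ) (Qt : F[X]) (Q : Fin (m + 1) → F[X]),
      (orderOf γ = 0 ∨ d < orderOf γ) →
      affinePoly Qt Q ≠ 0 → Qt.natDegree ≤ D → (∀ i, (Q i).natDegree ≤ D) →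
      ∃ A : AffineSubspace F F[X],
        (A : Set F[X]) = functionalSolutions (γ : F) d (affinePoly Qt Q) ∧
        Module.rank F A.direction ≤ m) ∧
    ∃ (P : FieldAlg.Program) (K a e : ℕ),
      ∀ (F : Type u) [Field F] (γ : Fˣ) (d D m : ℕ) (Qt : F[X]) (Q : Fin (m + 1) → F[X]),
        (orderOf γ = 0 ∨ d < orderOf γ) →
        affinePoly Qt Q ≠ 0 → Qt.natDegree ≤ D → (∀ i, (Q i).natDegree ≤ D) →
        ∃ (k : ℕ) (b : Fin k → F[X]) (cost : ℕ),
          IsAffineBasisOf b (functionalSolutions (γ : F) d (affinePoly Qt Q)) ∧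
          P.Runs (solverInput (γ : F) d D Qt Q) (solverOutput d b) cost ∧
          cost ≤ K * ((D + d + 1) * (m + 1) ^ a * Nat.log 2 (D + d + 2) ^ e) := by
  refine ⟨fun F _ γ d D m Qt Q hγ h0 hQt hQ => ?_, FieldAlg.solver, 10 ^ 20, 2, 13,
    fun F _ γ d D m Qt Q hγ h0 hQt hQ => ?_⟩
  -- The solution set is the affine span of the at most `m + 1` output points, hence of dimension at
  -- most `m`. The empty output is treated apart, since the dimension bound for a span needs at
  -- least one point.
  · obtain ⟨L, -, hm, ⟨-, hb⟩, -⟩ := FieldAlg.exists_computes_solutions hγ h0 hQt hQ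
    refine ⟨_, hb, ?_⟩
    rw [direction_affineSpan]
    rcases Nat.eq_zero_or_pos L.length with hL | hL
    · have : IsEmpty (Fin L.length) := by rw [hL]; infer_instance
      rw [Set.range_eq_empty, vectorSpan_empty, rank_bot]
      exact zero_le
    · obtain ⟨n, hL⟩ := Nat.exists_eq_add_of_le' hL
      rw [← Module.finrank_eq_rank]
      have := finrank_vectorSpan_range_le F (fun i : Fin L.length => FieldAlg.polyOf (L.get i))
        (n := n) (by rw [Fintype.card_fin, hL])
      exact_mod_cast this.trans (by omega)
  · obtain ⟨L, hl, -, hb, hc⟩ := FieldAlg.exists_computes_solutions hγ h0 hQt hQ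
    obtain ⟨c, hc, hr⟩ := hc.runs
    exact ⟨_, _, c, hb, by rwa [FieldAlg.solverInput_eq, FieldAlg.solverOutput_eq hl], hc.trans (FieldAlg.mainCost_le D d m)⟩
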